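/- Fix a constant $0<\tau\le 1/2$. Consider any sequence of settings (indexed by $k\in\mathbb N$, the index being suppressed below) with sample size $n\to\infty$ and dimensions $p,q$ with $p+q\to\infty$; $n,p,q$ and the laws of the random vectors may all vary with $k$. Let $X\in\mathbb R^p$ and $Y\in\mathbb R^q$ be independent random vectors with $\mathbb E X=0$, $\mathbb E Y=0$, $\mathbb E\|X\|^{4+4\tau}+\mathbb E\|Y\|^{4+4\tau}<\infty$, neither of them almost surely zero, and let $(X_1,Y_1),\dots,(X_n,Y_n)$ be i.i.d. copies of $(X,Y)$. Here $\|\cdot\|$ is the Euclidean norm. With $a_{k,l}=\|X_k-X_l\|$, $b_{k,l}=\|Y_k-Y_l\|$, let $$A^*_{k,l}=a_{k,l}-\frac1{n-2}\sum_{i=1}^n a_{i,l}-\frac1{n-2}\sum_{j=1}^n a_{k,j}+\frac1{(n-1)(n-2)}\sum_{i,j=1}^n a_{i,j},$$ let $B^*_{k,l}$ be defined in the same way from the $b_{k,l}$, and let $$\mathcal V_n^*(X,Y)=\frac1{n(n-3)}\sum_{k\ne l}A^*_{k,l}B^*_{k,l},\qquad \mathcal V_n^*(X)=\mathcal V_n^*(X,X),\quad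 \mathcal V_n^*(Y)=\mathcal V_n^*(Y,Y).$$ Let $\mathcal R_n^*(X,Y)=\mathcal V_n^*(X,Y)/\sqrt{\mathcal V_n^*(X)\mathcal V_n^*(Y)}$ if $\mathcal V_n^*(X)\mathcal V_n^*(Y)>0$ and $\mathcal R_n^*(X,Y)=0$ otherwise, and let $$T_n=\sqrt{\frac{n(n-1)}2}\;\mathcal R_n^*(X,Y).$$ With $X_1,X_2$ independent copies of $X$ and $\Sigma_x=\mathbb E[XX^T]$, define $$B_X=\mathbb E\|X_1-X_2\|^2,\qquad L_{x,\tau}=\mathbb E\Big(\big|\|X\|^2-\mathbb E\|X\|^2\big|^{2+2\tau}\Big)+\mathbb E\big(|X_1^TX_2|^{2+2\tau}\big),$$ $$E_x=\frac{\mathbb E[(X_1^T\Sigma_xX_2)^2]+B_X^{-2\tau}L_{x,\tau}^{(2+\tau)/(1+\tau)}}{\big(\mathbb E[(X_1^TX_2)^2]\big)^2},$$ and define $B_Y$, $L_{y,\tau}$, $E_y$, $\Sigma_y$ in the same way from $Y$. Assume that $$\frac{n^{-\tau}L_{x,\tau}L_{y,\tau}}{\big(\mathbb E[(X_1^TX_2)^2]\,\mathbb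 E[(Y_1^TY_2)^2]\big)^{1+\tau}}\to0,$$ that $E_x\to0$ whenever $p\to\infty$, and that $E_y\to0$ whenever $q\to\infty$ (that is, $E_x\to 0$ along every subsequence of the settings along which $p\to\infty$, and likewise for $E_y$ and $q$; the condition is void for a dimension that stays bounded). Then $T_n$ converges in distribution to $N(0,1)$. -/

import Mathlib

open MeasureTheory ProbabilityTheory Filter Topology

namespace DistCorr

noncomputable section

/-! ### Bias-corrected sample distance correlation -/

/-- Matrix of pairwise Euclidean distances of a sample. -/
def pairDist {n d : ℕ} (x : Fin n → EuclideanSpace ℝ (Fin d)) (k l : Fin n) : ℝ :=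
  ‖x k - x l‖

/-- The `U`-centered version of a matrix `a` of pairwise distances. -/
def uCenter {n : ℕ} (a : Fin n → Fin n → ℝ) (k l : Fin n) : ℝ :=
  a k l - 1 / ((n : ℝ) - 2) * ∑ i, a i l - 1 / ((n : ℝ) - 2) * ∑ j, a k j
    + 1 / (((n : ℝ) - 1) * ((n : ℝ) - 2)) * ∑ i, ∑ j, a i j

/-- The unbiased estimator `V_n^*(X, Y)` of the squared distance covariance. -/
def sampleDCov {n p q : ℕ} (x : Fin n → EuclideanSpace ℝ (Fin p))
    (y : Fin n → EuclideanSpace ℝ (Fin q)) : ℝ :=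
  1 / ((n : ℝ) * ((n : ℝ) - 3)) *
    ∑ k, ∑ l, if k ≠ l then uCenter (pairDist x) k l * uCenter (pairDist y) k l else 0

/-- The bias-corrected sample distance correlation `R_n^*(X, Y)`. -/
def sampleDCor {n p q : ℕ} (x : Fin n → EuclideanSpace ℝ (Fin p))
    (y : Fin n → EuclideanSpace ℝ (Fin q)) : ℝ :=
  if 0 < sampleDCov x x * sampleDCov y y then
    sampleDCov x y / √(sampleDCov x x * sampleDCov y y)
  else 0

/-- The rescaled test statistic `T_n`. -/
def testStat {n p q : ℕ} (x : Fin n → EuclideanSpace ℝ (Fin p))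
    (y : Fin n → EuclideanSpace ℝ (Fin q)) : ℝ :=
  √((n : ℝ) * ((n : ℝ) - 1) / 2) * sampleDCor x y

/-! ### Moments of a law `μ` on `ℝ^d`; expectations over two independent copies are
integrals with respect to `μ.prod μ` -/

/-- `B_X = E ‖X₁ - X₂‖²`. -/
def momB {d : ℕ} (μ : Measure (EuclideanSpace ℝ (Fin d))) : ℝ :=
  ∫ z, ‖z.1 - z.2‖ ^ 2 ∂(μ.prod μ)

/-- `E (X₁ᵀ X₂)²`. -/
def momSq {d : ℕ} (μ : Measure (EuclideanSpace ℝ (Fin d))) : ℝ :=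
  ∫ z, (inner ℝ z.1 z.2) ^ 2 ∂(μ.prod μ)

/-- `L_{x,τ} = E |‖X‖² - E ‖X‖²|^{2+2τ} + E |X₁ᵀ X₂|^{2+2τ}`. -/
def momL {d : ℕ} (μ : Measure (EuclideanSpace ℝ (Fin d))) (τ : ℝ) : ℝ :=
  ∫ x, |‖x‖ ^ 2 - ∫ x', ‖x'‖ ^ 2 ∂μ| ^ (2 + 2 * τ) ∂μ
    + ∫ z, |inner ℝ z.1 z.2| ^ (2 + 2 * τ) ∂(μ.prod μ)

/-- The matrix `Σ_x = E [X Xᵀ]`. -/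
def covMat {d : ℕ} (μ : Measure (EuclideanSpace ℝ (Fin d))) : Matrix (Fin d) (Fin d) ℝ :=
  Matrix.of fun i j => ∫ x, x i * x j ∂μ

/-- `E (X₁ᵀ Σ_x X₂)²`. -/
def momCov {d : ℕ} (μ : Measure (EuclideanSpace ℝ (Fin d))) : ℝ :=
  ∫ z, (∑ i, ∑ j, z.1 i * covMat μ i j * z.2 j) ^ 2 ∂(μ.prod μ)

/-- The quantity `E_x`. -/
def momE {d : ℕ} (μ : Measure (EuclideanSpace ℝ (Fin d))) (τ : ℝ) : ℝ :=
  (momCov μ + momB μ ^ (-2 * τ) * momL μ τ ^ ((2 + τ) / (1 + τ))) / momSq μ ^ 2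

end

end DistCorr

set_option linter.unusedSectionVars false

namespace DistCorr

/-! ### Integration tools -/

section Tools

variable {α β : Type*} [MeasurableSpace α] [MeasurableSpace β]

/-! Write `D(x, y) = ‖x - y‖ - E‖x - U‖ - E‖y - U‖ + E‖U - U'‖` for the doubly centred distance
(`distKernel`). All its sections have mean zero, and U-centring annihilates terms that depend on one
index only, so distances may be replaced by `D` in every sample quantity (`sampleDCov_eq`). Up to
the factor `1/(n(n-3))`, the sample distance covariance is the off-diagonal sum of `D_μ(X_k, X_l)
D_ν(Y_k, Y_l)` plus a remainder `covRem` of relative size `n^(-1/2)` (`integral_sq_covRem_le`). The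
leading sum is a degenerate U-statistic whose kernel is a product. The sample variances are
consistent by a weak law with truncation (`integral_abs_offSum_sq_add_covRem_sub_le`), so
studentizing changes nothing in the limit.

The central limit theorem for degenerate U-statistics is proved by Tikhomirov's method: the
characteristic function `φ` of the normalized sum nearly solves `φ' = -tφ`. Removing one sample
point, expanding in the row of that point and putting it back (`norm_charFun_sub_gaussian_le`)
leaves errors governed by two scale-invariant ratios. One is the Lyapunov ratio `momRatio`, damped
by `n^(-τ)`; the other is the spectral ratio `specRatio` of the iterated kernel. Both are
multiplicative over product kernels. Hence smallness of one spectral ratio suffices, the other being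
at most one, and this is why only `p + q → ∞` is needed.

It remains to bound the ratios of `D` by the moments in the hypotheses. When `E_x` is small,
expanding the distance around `√B` gives `D = -(xᵀy/√B + R)` with `R` negligible in `L²`
(`distKernel_eq`, `distKernel_bounds_of_momE_le`). When the dimension is bounded there is no such
expansion. There `E D²` is bounded below by pairing `D` with `xᵀy` and writing the distance as a
mixture of Gaussian kernels, for which the pairing has a sign (`sq_integral_normSq_le_dist_inner`,
`distKernel_bounds_of_dim`). A dimension threshold separates the two regimes, so one constant serves
along the whole sequence (`exists_forall_momRatio_le`). -/

lemma integral_add₃ {μ : Measure α} {f g h : α → ℝ} (hf : Integrable f μ) (hg : Integrable g μ)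
    (hh : Integrable h μ) :
    ∫ x, (f x + g x + h x) ∂μ = ∫ x, f x ∂μ + ∫ x, g x ∂μ + ∫ x, h x ∂μ := by
  rw [← integral_add hf hg]
  exact integral_add (hf.add hg) hh

lemma integral_add₄ {μ : Measure α} {f g h k : α → ℝ} (hf : Integrable f μ) (hg : Integrable g μ)
    (hh : Integrable h μ) (hk : Integrable k μ) :
    ∫ x, (f x + g x + h x + k x) ∂μ
      = ∫ x, f x ∂μ + ∫ x, g x ∂μ + ∫ x, h x ∂μ + ∫ x, k x ∂μ := by
  rw [← integral_add₃ hf hg hh]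
  exact integral_add ((hf.add hg).add hh) hk

/-- Cauchy–Schwarz, from the discriminant of the nonnegative quadratic `t ↦ ∫ (t f + g)²`. -/
lemma sq_integral_mul_le {μ : Measure α} {f g : α → ℝ} (hf : MemLp f 2 μ) (hg : MemLp g 2 μ) :
    (∫ x, f x * g x ∂μ) ^ 2 ≤ (∫ x, f x ^ 2 ∂μ) * ∫ x, g x ^ 2 ∂μ := by
  have hfg : Integrable (fun x => f x * g x) μ := hf.integrable_mul hg
  have h : ∀ t : ℝ, 0 ≤ (∫ x, f x ^ 2 ∂μ) * (t * t) + (2 * ∫ x, f x * g x ∂μ) * t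
      + ∫ x, g x ^ 2 ∂μ := by
    intro t
    have e : (∫ x, f x ^ 2 ∂μ) * (t * t) + (2 * ∫ x, f x * g x ∂μ) * t + ∫ x, g x ^ 2 ∂μ
        = ∫ x, (t * f x + g x) ^ 2 ∂μ := by
      have : ∀ x, (t * f x + g x) ^ 2 = (t * t) * f x ^ 2 + (2 * t) * (f x * g x) + g x ^ 2 :=
        fun x => by ring
      simp_rw [this]
      rw [integral_add₃ (hf.integrable_sq.const_mul _) (hfg.const_mul _) hg.integrable_sq,
        integral_const_mul, integral_const_mul]
      ring
    rw [e]
    exact integral_nonneg fun x => sq_nonneg _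
  have := discrim_le_zero h
  simp only [discrim] at this
  nlinarith

lemma abs_integral_le_sqrt {μ : Measure α} [IsProbabilityMeasure μ] {f : α → ℝ}
    (hf : MemLp f 2 μ) : ∫ x, |f x| ∂μ ≤ √(∫ x, f x ^ 2 ∂μ) := by
  have h := sq_integral_mul_le (hf.abs) (memLp_const (1 : ℝ) (μ := μ))
  simp only [Pi.abs_apply, mul_one, sq_abs, one_pow, integral_const, probReal_univ, smul_eq_mul] at h
  exact Real.le_sqrt_of_sq_le h

lemma rpow_integral_le {μ : Measure α} [IsProbabilityMeasure μ] {f : α → ℝ} {s : ℝ} (hs : 1 ≤ s)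
    (h0 : ∀ x, 0 ≤ f x) (hf : Integrable f μ) (hfs : Integrable (fun x => f x ^ s) μ) :
    (∫ x, f x ∂μ) ^ s ≤ ∫ x, f x ^ s ∂μ :=
  (convexOn_rpow hs).map_integral_le
    (Real.continuous_rpow_const (by linarith)).continuousOn isClosed_Ici
    (Eventually.of_forall h0) hf hfs

lemma measurePreserving_insertNth (π : Measure α) [SigmaFinite π] {n : ℕ} (i : Fin (n + 1)) :
    MeasurePreserving (fun p : α × (Fin n → α) => i.insertNth (α := fun _ => α) p.1 p.2)
      (π.prod (Measure.pi fun _ => π)) (Measure.pi fun _ : Fin (n + 1) => π) :=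
  (measurePreserving_piFinSuccAbove (fun _ : Fin (n + 1) => π) i).symm

lemma measurableEmbedding_insertNth {n : ℕ} (i : Fin (n + 1)) :
    MeasurableEmbedding (fun p : α × (Fin n → α) => i.insertNth (α := fun _ => α) p.1 p.2) :=
  (MeasurableEquiv.piFinSuccAbove (fun _ : Fin (n + 1) => α) i).symm.measurableEmbedding

lemma integral_pi_insertNth (π : Measure α) [SigmaFinite π] {n : ℕ} (i : Fin (n + 1))
    {E : Type*} [NormedAddCommGroup E] [NormedSpace ℝ E] (f : (Fin (n + 1) → α) → E) :
    ∫ z, f z ∂(Measure.pi fun _ : Fin (n + 1) => π) =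
      ∫ p, f (i.insertNth (α := fun _ => α) p.1 p.2) ∂(π.prod (Measure.pi fun _ : Fin n => π)) :=
  ((measurePreserving_insertNth π i).integral_comp (measurableEmbedding_insertNth i) f).symm

lemma memLp_pi_insertNth_iff (π : Measure α) [SigmaFinite π] {n : ℕ} (i : Fin (n + 1))
    {E : Type*} [NormedAddCommGroup E] {s : ENNReal} {f : (Fin (n + 1) → α) → E} :
    MemLp (fun p : α × (Fin n → α) => f (i.insertNth (α := fun _ => α) p.1 p.2)) s
      (π.prod (Measure.pi fun _ : Fin n => π)) ↔
    MemLp f s (Measure.pi fun _ : Fin (n + 1) => π) := by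
  rw [← (measurePreserving_insertNth π i).map_eq, (measurableEmbedding_insertNth i).memLp_map_measure_iff]
  rfl

lemma integrable_pi_insertNth_iff (π : Measure α) [SigmaFinite π] {n : ℕ} (i : Fin (n + 1))
    {E : Type*} [NormedAddCommGroup E] {f : (Fin (n + 1) → α) → E} :
    Integrable (fun p : α × (Fin n → α) => f (i.insertNth (α := fun _ => α) p.1 p.2))
      (π.prod (Measure.pi fun _ : Fin n => π)) ↔
    Integrable f (Measure.pi fun _ : Fin (n + 1) => π) := by
  rw [← memLp_one_iff_integrable, ← memLp_one_iff_integrable, memLp_pi_insertNth_iff]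

end Tools

/-! ### Sums over pairs of distinct indices -/

/-- The sum of the off-diagonal entries of a matrix. -/
noncomputable def offSum {n : ℕ} (A : Fin n → Fin n → ℝ) : ℝ := ∑ k, ∑ l, if k = l then 0 else A k l

/-- The leave-one-out identity: deleting index `i` removes exactly its row and its column. It drives
the inductions on the sample size and the central limit theorem. -/
lemma offSum_succAbove {n : ℕ} (A : Fin (n + 1) → Fin (n + 1) → ℝ) (i : Fin (n + 1)) :
    offSum A = offSum (fun k l => A (i.succAbove k) (i.succAbove l))
      + ∑ k, (A i (i.succAbove k) + A (i.succAbove k) i) := by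
  unfold offSum
  rw [Fin.sum_univ_succAbove _ i]
  simp only [Fin.sum_univ_succAbove _ i, Fin.succAbove_ne, (Fin.succAbove_ne i _).symm, if_true,
    if_false, Fin.succAbove_right_inj, Finset.sum_add_distrib]
  ring

lemma sum_eq_diag_add_offSum {n : ℕ} (A : Fin n → Fin n → ℝ) :
    ∑ k, ∑ l, A k l = ∑ k, A k k + offSum A := by
  unfold offSum
  rw [← Finset.sum_add_distrib]
  refine Finset.sum_congr rfl fun k _ => ?_
  have : ∀ l, A k l = (if k = l then A k k else 0) + if k = l then 0 else A k l := by
    intro l; split_ifs with h <;> simp [h]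
  rw [Finset.sum_congr rfl fun l _ => this l, Finset.sum_add_distrib]
  simp

lemma offSum_const (n : ℕ) (a : ℝ) : offSum (fun _ _ : Fin n => a) = n * (n - 1) * a := by
  have := sum_eq_diag_add_offSum (fun _ _ : Fin n => a)
  simp at this
  linarith

lemma offSum_mul_left {n : ℕ} (a : ℝ) (A : Fin n → Fin n → ℝ) :
    offSum (fun k l => a * A k l) = a * offSum A := by
  simp only [offSum, Finset.mul_sum, mul_ite, mul_zero]

lemma offSum_add {n : ℕ} (A B : Fin n → Fin n → ℝ) :
    offSum (fun k l => A k l + B k l) = offSum A + offSum B := by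
  simp only [offSum, ← Finset.sum_add_distrib]
  refine Finset.sum_congr rfl fun k _ => Finset.sum_congr rfl fun l _ => ?_
  split_ifs <;> simp

lemma offSum_nonneg {n : ℕ} {A : Fin n → Fin n → ℝ} (h : ∀ k l, 0 ≤ A k l) : 0 ≤ offSum A :=
  Finset.sum_nonneg fun k _ => Finset.sum_nonneg fun l _ => by split_ifs <;> simp [h]

/-! ### Moments of sums of i.i.d. centred variables -/

/-- For `|y| ≤ 1`, split off `(1 + y)²` and apply Bernoulli to the concave power `r - 2 ≤ 1`. For
`|y| > 1` everything is dominated by `|y|^r`: `8 = 2³` from `|1 + y| ≤ 2|y|` and `3` from the linear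
term, which makes `11`. -/
lemma abs_one_add_rpow_le {r : ℝ} (h2 : 2 ≤ r) (h3 : r ≤ 3) (y : ℝ) :
    |1 + y| ^ r ≤ 1 + r * y + 11 * (y ^ 2 + |y| ^ r) := by
  by_cases hy : |y| ≤ 1
  · have hy1 : -1 ≤ y := (abs_le.1 hy).1
    have hy2 : y ≤ 1 := (abs_le.1 hy).2
    have h0 : 0 ≤ 1 + y := by linarith
    have hb := rpow_one_add_le_one_add_mul_self hy1 (p := r - 2) (by linarith) (by linarith)
    have e : (1 + y) ^ r = (1 + y) ^ 2 * (1 + y) ^ (r - 2) := by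
      rcases h0.eq_or_lt with h | h
      · rw [← h, Real.zero_rpow (by linarith)]; simp
      · rw [← Real.rpow_natCast, ← Real.rpow_add h]; congr 1; push_cast; ring
    rw [abs_of_nonneg h0, e]
    have h4 : 0 ≤ |y| ^ r := by positivity
    have h5 : (1 + y) ^ 2 * (1 + y) ^ (r - 2) ≤ (1 + y) ^ 2 * (1 + (r - 2) * y) := by gcongr
    have h6 : y ^ 3 ≤ y ^ 2 := by nlinarith [sq_nonneg y]
    nlinarith [sq_nonneg y]
  · push Not at hy
    have h1 : |1 + y| ≤ 2 * |y| := by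
      calc |1 + y| ≤ |1| + |y| := abs_add_le _ _
        _ ≤ 2 * |y| := by rw [abs_one]; linarith
    have h4 : |1 + y| ^ r ≤ 8 * |y| ^ r := by
      calc |1 + y| ^ r ≤ (2 * |y|) ^ r := by gcongr
        _ = 2 ^ r * |y| ^ r := Real.mul_rpow (by norm_num) (abs_nonneg _)
        _ ≤ 8 * |y| ^ r := by
          gcongr
          calc (2 : ℝ) ^ r ≤ 2 ^ (3 : ℝ) := Real.rpow_le_rpow_of_exponent_le (by norm_num) h3
            _ = 8 := by norm_num
    have h5 : |y| ≤ |y| ^ r := by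
      conv_lhs => rw [← Real.rpow_one |y|]
      exact Real.rpow_le_rpow_of_exponent_le hy.le (by linarith)
    have h6 : -(r * y) ≤ 3 * |y| := by
      have := neg_abs_le y
      nlinarith [abs_nonneg y]
    nlinarith [sq_nonneg y]

/-- The previous bound, rescaled by `s`. Strict `2 < r` makes the powers of `s` vanish at `s = 0`.
-/
lemma abs_add_rpow_le {r : ℝ} (h2 : 2 < r) (h3 : r ≤ 3) (s x : ℝ) :
    |s + x| ^ r ≤ |s| ^ r + r * (s * |s| ^ (r - 2)) * x + 11 * (|s| ^ (r - 2) * x ^ 2 + |x| ^ r) := by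
  rcases eq_or_ne s 0 with rfl | hs
  · have h : (0 : ℝ) ^ (r - 2) = 0 := Real.zero_rpow (by linarith)
    have h' : (0 : ℝ) ^ r = 0 := Real.zero_rpow (by linarith)
    have : 0 ≤ |x| ^ r := by positivity
    simp [h, h']
    linarith
  · have hs' : 0 < |s| := abs_pos.2 hs
    have h := abs_one_add_rpow_le h2.le h3 (x / s)
    have hp : 0 < |s| ^ r := by positivity
    have e1 : |s + x| ^ r = |s| ^ r * |1 + x / s| ^ r := by
      rw [← Real.mul_rpow (abs_nonneg _) (abs_nonneg _), ← abs_mul]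
      congr 2; field_simp
    have e2 : |s| ^ r * |x / s| ^ r = |x| ^ r := by
      rw [← Real.mul_rpow (abs_nonneg _) (abs_nonneg _), ← abs_mul]
      congr 2; field_simp
    have e3 : |s| ^ r = |s| ^ (r - 2) * s ^ 2 := by
      rw [← sq_abs, ← Real.rpow_natCast |s| 2, ← Real.rpow_add hs']; congr 1; push_cast; ring
    rw [e1]
    calc |s| ^ r * |1 + x / s| ^ r
        ≤ |s| ^ r * (1 + r * (x / s) + 11 * ((x / s) ^ 2 + |x / s| ^ r)) := by gcongr
      _ = |s| ^ r + r * (|s| ^ r * (x / s)) + 11 * (|s| ^ r * (x / s) ^ 2 + |s| ^ r * |x / s| ^ r) := by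
        ring
      _ = _ := by
        rw [e2, e3]; field_simp

section IID

variable {α : Type*} [MeasurableSpace α] {π : Measure α} [IsProbabilityMeasure π]

lemma memLp_eval {n : ℕ} {s : ENNReal} {f : α → ℝ} (hf : MemLp f s π) (k : Fin n) :
    MemLp (fun w : Fin n → α => f (w k)) s (Measure.pi fun _ => π) :=
  hf.comp_measurePreserving (measurePreserving_eval (fun _ : Fin n => π) k)

lemma integral_eval {n : ℕ} {f : α → ℝ} (hf : AEStronglyMeasurable f π) (k : Fin n) :
    ∫ w, f (w k) ∂(Measure.pi fun _ : Fin n => π) = ∫ x, f x ∂π := by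
  have h := measurePreserving_eval (fun _ : Fin n => π) k
  conv_rhs => rw [← h.map_eq]
  rw [integral_map h.measurable.aemeasurable (by rw [h.map_eq]; exact hf)]

lemma memLp_sum_mul {n : ℕ} {s : ENNReal} {f : α → ℝ} (hf : MemLp f s π) (c : Fin n → ℝ) :
    MemLp (fun w : Fin n → α => ∑ k, c k * f (w k)) s (Measure.pi fun _ => π) :=
  memLp_finsetSum _ fun k _ => (memLp_eval hf k).const_mul _

lemma integral_prod_sq_add {β : Type*} [MeasurableSpace β] {ρ : Measure β} [IsProbabilityMeasure ρ]
    {f : α → ℝ} {g : β → ℝ} (hf : MemLp f 2 π) (h0 : ∫ x, f x ∂π = 0) (hg : MemLp g 2 ρ) :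
    ∫ p, (f p.1 + g p.2) ^ 2 ∂(π.prod ρ) = ∫ x, f x ^ 2 ∂π + ∫ y, g y ^ 2 ∂ρ := by
  have e : ∀ p : α × β, (f p.1 + g p.2) ^ 2 = f p.1 ^ 2 + g p.2 ^ 2 + 2 * (f p.1 * g p.2) :=
    fun p => by ring
  simp_rw [e]
  have i1 : Integrable (fun p : α × β => f p.1 ^ 2) (π.prod ρ) := (hf.comp_fst ρ).integrable_sq
  have i2 : Integrable (fun p : α × β => g p.2 ^ 2) (π.prod ρ) := (hg.comp_snd π).integrable_sq
  have i3 : Integrable (fun p : α × β => f p.1 * g p.2) (π.prod ρ) :=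
    (hf.comp_fst ρ).integrable_mul (hg.comp_snd π)
  rw [integral_add₃ i1 i2 (i3.const_mul 2), integral_const_mul,
    integral_prod_mul, h0, integral_fun_fst (fun x => f x ^ 2), integral_fun_snd (fun y => g y ^ 2)]
  simp

lemma integral_sq_sum_mul {f : α → ℝ} (hf : MemLp f 2 π) (h0 : ∫ x, f x ∂π = 0) {n : ℕ}
    (c : Fin n → ℝ) :
    ∫ w, (∑ k, c k * f (w k)) ^ 2 ∂(Measure.pi fun _ : Fin n => π)
      = (∑ k, c k ^ 2) * ∫ x, f x ^ 2 ∂π := by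
  induction n with
  | zero => simp
  | succ n ih =>
    rw [integral_pi_insertNth π 0]
    simp only [Fin.sum_univ_succAbove _ 0, Fin.insertNth_apply_same, Fin.insertNth_apply_succAbove]
    have h := integral_prod_sq_add (f := fun x => c 0 * f x) (hf.const_mul _)
      (by rw [integral_const_mul, h0, mul_zero]) (memLp_sum_mul hf fun k => c (Fin.succAbove 0 k))
    rw [ih] at h
    simp only [mul_pow] at h
    rw [integral_const_mul, ← add_mul] at h
    exact h

/-- A Marcinkiewicz–Zygmund type bound by induction on `n`. In the second order expansion of `|S +
f|^r` the linear term integrates to zero. The quadratic term is at most `11 n^(r/2-1) m` and the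
last one `11 m`, so each step adds at most `22 (n+1)^(r/2-1) m`. -/
lemma integral_abs_sum_rpow_le {r : ℝ} (h2 : 2 < r) (h3 : r ≤ 3) {f : α → ℝ}
    (hf : MemLp f (ENNReal.ofReal r) π) (h0 : ∫ x, f x ∂π = 0) (n : ℕ) :
    ∫ w, |∑ k, f (w k)| ^ r ∂(Measure.pi fun _ : Fin n => π)
      ≤ 22 * (n : ℝ) ^ (r / 2) * ∫ x, |f x| ^ r ∂π := by
  have hr0 : ENNReal.ofReal r ≠ 0 := by simp; linarith
  have hrt : (ENNReal.ofReal r).toReal = r := ENNReal.toReal_ofReal (by linarith)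
  have hf2 : MemLp f 2 π := hf.mono_exponent (by
    rw [show (2 : ENNReal) = ENNReal.ofReal 2 by simp]; exact ENNReal.ofReal_le_ofReal h2.le)
  have hS : ∀ (s : ENNReal) (n : ℕ), MemLp f s π →
      MemLp (fun w : Fin n → α => ∑ k, f (w k)) s (Measure.pi fun _ => π) := fun s n h => by
    simpa using memLp_sum_mul h (fun _ : Fin n => (1 : ℝ))
  have hir : ∀ {β : Type _} [MeasurableSpace β] {ρ : Measure β} [IsProbabilityMeasure ρ]
      {g : β → ℝ}, MemLp g (ENNReal.ofReal r) ρ → Integrable (fun x => |g x| ^ r) ρ := by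
    intro β _ ρ _ g hg
    have := hg.integrable_norm_rpow hr0 (by simp)
    simpa [hrt] using this
  set m := ∫ x, |f x| ^ r ∂π with hm
  set v := ∫ x, f x ^ 2 ∂π with hv
  have hm0 : 0 ≤ m := integral_nonneg fun x => by positivity
  have hv0 : 0 ≤ v := integral_nonneg fun x => by positivity
  have hvm : v ^ (r / 2) ≤ m := by
    have e : ∀ x, (f x ^ 2) ^ (r / 2) = |f x| ^ r := fun x => by
      rw [← sq_abs, ← Real.rpow_natCast, ← Real.rpow_mul (abs_nonneg _)]; congr 1; push_cast; ring
    have := rpow_integral_le (μ := π) (f := fun x => f x ^ 2) (s := r / 2) (by linarith)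
      (fun x => sq_nonneg _) hf2.integrable_sq (by simp_rw [e]; exact hir hf)
    simpa only [e] using this
  induction n with
  | zero =>
    have : (0 : ℝ) ^ r = 0 := Real.zero_rpow (by linarith)
    have h' : (0 : ℝ) ^ (r / 2) = 0 := Real.zero_rpow (by linarith)
    simp [this, h']
  | succ n ih =>
    rw [integral_pi_insertNth π 0]
    simp only [Fin.sum_univ_succAbove _ 0, Fin.insertNth_apply_same, Fin.insertNth_apply_succAbove]
    set ρ := Measure.pi fun _ : Fin n => π with hρ
    set S : (Fin n → α) → ℝ := fun w => ∑ k, f (w k) with hSdef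
    have hSr : MemLp S (ENNReal.ofReal r) ρ := hS _ n hf
    have hS2 : MemLp S 2 ρ := hS _ n hf2
    have hq : ∀ a : ℝ, |a| ^ (r - 2) ≤ 1 + |a| ^ r := fun a => by
      rcases le_total |a| 1 with h | h
      · have := Real.rpow_le_one (abs_nonneg a) h (z := r - 2) (by linarith)
        have : 0 ≤ |a| ^ r := by positivity
        linarith
      · have := Real.rpow_le_rpow_of_exponent_le h (show r - 2 ≤ r by linarith)
        linarith
    have hq' : ∀ a : ℝ, |a * |a| ^ (r - 2)| ≤ 1 + |a| ^ r := fun a => by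
      rw [abs_mul, abs_of_nonneg (by positivity : 0 ≤ |a| ^ (r - 2))]
      have e : |a| * |a| ^ (r - 2) = |a| ^ (r - 1) := by
        rcases (abs_nonneg a).eq_or_lt with h | h
        · rw [← h, Real.zero_rpow (by linarith : r - 1 ≠ 0), zero_mul]
        · rw [← Real.rpow_one_add' h.le (by linarith)]; congr 1; ring
      rw [e]
      rcases le_total |a| 1 with h | h
      · have := Real.rpow_le_one (abs_nonneg a) h (z := r - 1) (by linarith)
        have : 0 ≤ |a| ^ r := by positivity
        linarith
      · have := Real.rpow_le_rpow_of_exponent_le h (show r - 1 ≤ r by linarith)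
        linarith
    have iSr : Integrable (fun w => |S w| ^ r) ρ := hir hSr
    have iq : Integrable (fun w => |S w| ^ (r - 2)) ρ :=
      Integrable.mono' ((integrable_const 1).add iSr)
        ((Real.continuous_rpow_const (by linarith)).comp_aestronglyMeasurable hSr.1.norm)
        (Eventually.of_forall fun w => by
          rw [Real.norm_of_nonneg (by positivity)]; exact hq _)
    have iq' : Integrable (fun w => S w * |S w| ^ (r - 2)) ρ :=
      Integrable.mono' ((integrable_const 1).add iSr)
        (hSr.1.mul ((Real.continuous_rpow_const (by linarith)).comp_aestronglyMeasurable hSr.1.norm))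
        (Eventually.of_forall fun w => hq' _)
    have iv := hf2.integrable_sq
    have if1 : Integrable f π := hf2.integrable (by norm_num)
    have key : ∀ p : α × (Fin n → α), |f p.1 + S p.2| ^ r ≤ |S p.2| ^ r
        + r * (f p.1 * (S p.2 * |S p.2| ^ (r - 2)))
        + 11 * (f p.1 ^ 2 * |S p.2| ^ (r - 2)) + 11 * |f p.1| ^ r := fun p => by
      have := abs_add_rpow_le h2 h3 (S p.2) (f p.1)
      rw [add_comm (f p.1)]
      linarith
    have j1 : Integrable (fun p : α × (Fin n → α) => |S p.2| ^ r) (π.prod ρ) := iSr.comp_snd π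
    have j2 : Integrable (fun p : α × (Fin n → α) => r * (f p.1 * (S p.2 * |S p.2| ^ (r - 2))))
      (π.prod ρ) := (if1.mul_prod iq').const_mul _
    have j3 : Integrable (fun p : α × (Fin n → α) => 11 * (f p.1 ^ 2 * |S p.2| ^ (r - 2)))
      (π.prod ρ) := (iv.mul_prod iq).const_mul _
    have j4 : Integrable (fun p : α × (Fin n → α) => 11 * |f p.1| ^ r)
      (π.prod ρ) := ((hir hf).comp_fst ρ).const_mul _
    have hES : ∫ w, S w ^ 2 ∂ρ = n * v := by
      have := integral_sq_sum_mul hf2 h0 (fun _ : Fin n => (1 : ℝ))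
      simpa using this
    -- Since `r - 2 ≤ 2`, Jensen with the power `2/(r - 2)` compares this moment with `E S² = n v`.
    have hESq : ∫ w, |S w| ^ (r - 2) ∂ρ ≤ (n * v) ^ (r / 2 - 1) := by
      have e : ∀ w, (|S w| ^ (r - 2)) ^ (2 / (r - 2)) = S w ^ 2 := fun w => by
        rw [← Real.rpow_mul (abs_nonneg _), mul_div_cancel₀ _ (by linarith), ← sq_abs]
        norm_cast
      have := rpow_integral_le (μ := ρ) (f := fun w => |S w| ^ (r - 2)) (s := 2 / (r - 2))
        (by rw [le_div_iff₀ (by linarith)]; linarith) (fun x => by positivity) iq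
        (by simp_rw [e]; exact hS2.integrable_sq)
      simp_rw [e] at this
      rw [hES] at this
      have h' := Real.rpow_le_rpow (by positivity) this (show 0 ≤ r / 2 - 1 by linarith)
      rw [← Real.rpow_mul (integral_nonneg fun w => by positivity)] at h'
      have e2 : 2 / (r - 2) * (r / 2 - 1) = 1 := by
        have : r - 2 ≠ 0 := by linarith
        field_simp
      rwa [e2, Real.rpow_one] at h'
    have hstep : ∫ p, |f p.1 + S p.2| ^ r ∂(π.prod ρ) ≤
        ∫ w, |S w| ^ r ∂ρ + 11 * (v * ∫ w, |S w| ^ (r - 2) ∂ρ) + 11 * m := by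
      refine (integral_mono_of_nonneg (Eventually.of_forall fun p => by positivity)
        (((j1.add j2).add j3).add j4) (Eventually.of_forall key)).trans_eq ?_
      simp only [Pi.add_apply]
      rw [integral_add₄ j1 j2 j3 j4,
        integral_const_mul, integral_const_mul, integral_const_mul, 
        integral_prod_mul f (fun w => S w * |S w| ^ (r - 2)),
        integral_prod_mul (fun x => f x ^ 2) (fun w => |S w| ^ (r - 2)), h0, integral_fun_snd (fun w => |S w| ^ r),
        integral_fun_fst (fun x => |f x| ^ r)]
      simp [← hm, ← hv]
    have hvv : v * (n * v) ^ (r / 2 - 1) ≤ (n : ℝ) ^ (r / 2 - 1) * m := by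
      rw [Real.mul_rpow (by positivity) hv0]
      have : v * v ^ (r / 2 - 1) ≤ m := by
        rw [← Real.rpow_one_add' hv0 (by linarith)]
        simpa using hvm
      calc v * ((n : ℝ) ^ (r / 2 - 1) * v ^ (r / 2 - 1))
          = (n : ℝ) ^ (r / 2 - 1) * (v * v ^ (r / 2 - 1)) := by ring
        _ ≤ _ := by gcongr
    have hn1 : (n : ℝ) ^ (r / 2 - 1) ≤ ((n : ℝ) + 1) ^ (r / 2 - 1) := by
      apply Real.rpow_le_rpow <;> linarith [(n.cast_nonneg : (0 : ℝ) ≤ n)]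
    have hn2 : (1 : ℝ) ≤ ((n : ℝ) + 1) ^ (r / 2 - 1) :=
      Real.one_le_rpow (by linarith [(n.cast_nonneg : (0 : ℝ) ≤ n)]) (by linarith)
    have hn3 : (n : ℝ) ^ (r / 2) = n * (n : ℝ) ^ (r / 2 - 1) := by
      rw [← Real.rpow_one_add' n.cast_nonneg (by linarith)]; congr 1; ring
    have hn4 : ((n : ℝ) + 1) ^ (r / 2) = (n + 1) * ((n : ℝ) + 1) ^ (r / 2 - 1) := by
      rw [← Real.rpow_one_add' (by positivity) (by linarith)]; congr 1; ring
    have h5 : v * ∫ w, |S w| ^ (r - 2) ∂ρ ≤ (n : ℝ) ^ (r / 2 - 1) * m :=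
      (mul_le_mul_of_nonneg_left hESq hv0).trans hvv
    refine hstep.trans ?_
    push_cast
    rw [hn3] at ih
    rw [hn4]
    have h6 : (n : ℝ) ^ (r / 2 - 1) * m ≤ ((n : ℝ) + 1) ^ (r / 2 - 1) * m := by gcongr
    have h7 : m ≤ ((n : ℝ) + 1) ^ (r / 2 - 1) * m := le_mul_of_one_le_left hm0 hn2
    have h8 : n * ((n : ℝ) ^ (r / 2 - 1) * m) ≤ n * (((n : ℝ) + 1) ^ (r / 2 - 1) * m) := by gcongr
    nlinarith

end IID

/-! ### Degenerate kernels -/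

section Kernels

variable {α : Type*} [MeasurableSpace α] {π : Measure α} [IsProbabilityMeasure π]

/-- A symmetric square integrable kernel all of whose sections have mean zero. -/
structure DegenKernel (π : Measure α) (H : α → α → ℝ) : Prop where
  meas : Measurable (fun p : α × α => H p.1 p.2)
  symm : ∀ z w, H z w = H w z
  slice : ∀ z, MemLp (H z) 2 π
  mean : ∀ z, ∫ w, H z w ∂π = 0
  memLp : MemLp (fun p : α × α => H p.1 p.2) 2 (π.prod π)

lemma measurePreserving_eval_pair {n : ℕ} {k l : Fin n} (h : k ≠ l) :
    MeasurePreserving (fun w : Fin n → α => (w k, w l)) (Measure.pi fun _ => π) (π.prod π) := by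
  refine ⟨(measurable_pi_apply k).prodMk (measurable_pi_apply l), ?_⟩
  have hi : iIndepFun (fun (i : Fin n) (w : Fin n → α) => w i) (Measure.pi fun _ => π) :=
    iIndepFun_pi (X := fun _ => id) (fun _ => aemeasurable_id)
  have := (indepFun_iff_map_prod_eq_prod_map_map (measurable_pi_apply k).aemeasurable
    (measurable_pi_apply l).aemeasurable).1 (hi.indepFun h)
  rw [this, (measurePreserving_eval _ k).map_eq, (measurePreserving_eval _ l).map_eq]

lemma memLp_offSum {n : ℕ} {s : ENNReal} {H : α → α → ℝ}
    (hH : MemLp (fun p : α × α => H p.1 p.2) s (π.prod π)) (c : Fin n → Fin n → ℝ) :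
    MemLp (fun w : Fin n → α => offSum fun k l => c k l * H (w k) (w l)) s
      (Measure.pi fun _ => π) := by
  unfold offSum
  refine memLp_finsetSum _ fun k _ => memLp_finsetSum _ fun l _ => ?_
  split_ifs with h
  · exact MemLp.zero
  · exact (hH.comp_measurePreserving (measurePreserving_eval_pair h)).const_mul _

lemma integral_offSum {n : ℕ} {H : α → α → ℝ}
    (hH : Integrable (fun p : α × α => H p.1 p.2) (π.prod π)) :
    ∫ w, (offSum fun k l => H (w k) (w l)) ∂(Measure.pi fun _ : Fin n => π)
      = n * (n - 1) * ∫ p, H p.1 p.2 ∂(π.prod π) := by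
  have hkl : ∀ k l : Fin n, k ≠ l →
      Integrable (fun w : Fin n → α => H (w k) (w l)) (Measure.pi fun _ => π) ∧
      ∫ w, H (w k) (w l) ∂(Measure.pi fun _ : Fin n => π) = ∫ p, H p.1 p.2 ∂(π.prod π) := by
    intro k l h
    have hp := measurePreserving_eval_pair (π := π) h
    refine ⟨hp.integrable_comp_of_integrable hH, ?_⟩
    rw [← hp.map_eq, integral_map hp.measurable.aemeasurable (by rw [hp.map_eq]; exact hH.1)]
  rw [← offSum_const]
  unfold offSum
  have hi : ∀ k l : Fin n, Integrable (fun w : Fin n → α => if k = l then 0 else H (w k) (w l))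
      (Measure.pi fun _ => π) := by
    intro k l
    split_ifs with h
    · exact integrable_zero _ _ _
    · exact (hkl k l h).1
  rw [integral_finsetSum _ fun k _ => integrable_finsetSum _ fun l _ => hi k l]
  refine Finset.sum_congr rfl fun k _ => ?_
  rw [integral_finsetSum _ fun l _ => hi k l]
  refine Finset.sum_congr rfl fun l _ => ?_
  split_ifs with h
  · simp
  · exact (hkl k l h).2

lemma memLp_row {n : ℕ} {s : ENNReal} {H : α → α → ℝ}
    (hH : MemLp (fun p : α × α => H p.1 p.2) s (π.prod π)) (c : Fin n → ℝ) :
    MemLp (fun p : α × (Fin n → α) => ∑ k, c k * H p.1 (p.2 k)) s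
      (π.prod (Measure.pi fun _ => π)) :=
  memLp_finsetSum _ fun k _ => (hH.comp_measurePreserving
    ((MeasurePreserving.id π).prod (measurePreserving_eval (fun _ : Fin n => π) k))).const_mul _

namespace DegenKernel

variable {H : α → α → ℝ}

lemma mean_left (hH : DegenKernel π H) (w : α) : ∫ z, H z w ∂π = 0 := by
  simp_rw [hH.symm _ w]; exact hH.mean w

lemma integral_row_left (hH : DegenKernel π H) {n : ℕ} (c : Fin n → ℝ) (w : Fin n → α) :
    ∫ u, ∑ k, c k * H u (w k) ∂π = 0 := by
  rw [integral_finsetSum]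
  · refine Finset.sum_eq_zero fun k _ => ?_
    rw [integral_const_mul, hH.mean_left, mul_zero]
  · intro k _
    simp_rw [hH.symm _ (w k)]
    exact ((hH.slice (w k)).integrable (by norm_num)).const_mul _

lemma integral_sq_row (hH : DegenKernel π H) {n : ℕ} (c : Fin n → ℝ) :
    ∫ p, (∑ k, c k * H p.1 (p.2 k)) ^ 2 ∂(π.prod (Measure.pi fun _ : Fin n => π))
      = (∑ k, c k ^ 2) * ∫ p, H p.1 p.2 ^ 2 ∂(π.prod π) := by
  rw [integral_prod _ (memLp_row hH.memLp c).integrable_sq, integral_prod _ hH.memLp.integrable_sq,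
    ← integral_const_mul]
  congr 1 with u
  exact integral_sq_sum_mul (hH.slice u) (hH.mean u) c

/-- Induction on `n`: integrating out the new point kills its row, so the row is orthogonal to the
sum over the old points. As `c` need not be symmetric, the two weights of a pair are merged by `(a +
b)² ≤ 2(a² + b²)`; this is an equality when all weights are `1`. -/
theorem integral_sq_offSum_le (hH : DegenKernel π H) {n : ℕ} (c : Fin n → Fin n → ℝ) :
    ∫ w, (offSum fun k l => c k l * H (w k) (w l)) ^ 2 ∂(Measure.pi fun _ : Fin n => π)
      ≤ 2 * (offSum fun k l => c k l ^ 2) * ∫ p, H p.1 p.2 ^ 2 ∂(π.prod π) := by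
  have hv : 0 ≤ ∫ p, H p.1 p.2 ^ 2 ∂(π.prod π) := integral_nonneg fun p => sq_nonneg _
  induction n with
  | zero => simp [offSum]
  | succ n ih =>
    rw [integral_pi_insertNth π 0]
    simp only [offSum_succAbove _ (0 : Fin (n + 1)), Fin.insertNth_apply_same,
      Fin.insertNth_apply_succAbove]
    set c' : Fin n → Fin n → ℝ := fun k l => c (Fin.succAbove 0 k) (Fin.succAbove 0 l) with hc'
    set b : Fin n → ℝ := fun k => c 0 (Fin.succAbove 0 k) + c (Fin.succAbove 0 k) 0 with hb
    set ρ := Measure.pi fun _ : Fin n => π with hρ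
    have hA : MemLp (fun p : α × (Fin n → α) => offSum fun k l => c' k l * H (p.2 k) (p.2 l)) 2
      (π.prod ρ) := (memLp_offSum hH.memLp c').comp_snd π
    have hR := memLp_row hH.memLp b
    have e : ∀ p : α × (Fin n → α), ((offSum fun k l => c (Fin.succAbove 0 k) (Fin.succAbove 0 l) *
          H (p.2 k) (p.2 l)) + ∑ k, (c 0 (Fin.succAbove 0 k) * H p.1 (p.2 k)
          + c (Fin.succAbove 0 k) 0 * H (p.2 k) p.1)) ^ 2
        = (offSum fun k l => c' k l * H (p.2 k) (p.2 l)) ^ 2 + (∑ k, b k * H p.1 (p.2 k)) ^ 2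
          + 2 * ((offSum fun k l => c' k l * H (p.2 k) (p.2 l)) * ∑ k, b k * H p.1 (p.2 k)) := by
      intro p
      have : ∑ k, (c 0 (Fin.succAbove 0 k) * H p.1 (p.2 k)
          + c (Fin.succAbove 0 k) 0 * H (p.2 k) p.1) = ∑ k, b k * H p.1 (p.2 k) := by
        refine Finset.sum_congr rfl fun k _ => ?_
        rw [hH.symm (p.2 k), hb]; ring
      rw [this]; ring
    simp_rw [e]
    have hAR : Integrable (fun p : α × (Fin n → α) => (offSum fun k l => c' k l * H (p.2 k) (p.2 l))
        * ∑ k, b k * H p.1 (p.2 k)) (π.prod ρ) := hA.integrable_mul hR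
    have h0 : ∫ p, (offSum fun k l => c' k l * H (p.2 k) (p.2 l)) * ∑ k, b k * H p.1 (p.2 k)
        ∂(π.prod ρ) = 0 := by
      rw [integral_prod_symm _ hAR]
      simp_rw [integral_const_mul, hH.integral_row_left, mul_zero, integral_zero]
    rw [integral_add₃ hA.integrable_sq hR.integrable_sq (hAR.const_mul 2), integral_const_mul,
      h0, hH.integral_sq_row b,
      integral_fun_snd (fun w : Fin n → α => (offSum fun k l => c' k l * H (w k) (w l)) ^ 2)]
    have hb2 : ∑ k, b k ^ 2 ≤ 2 * ∑ k, (c 0 (Fin.succAbove 0 k) ^ 2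
        + c (Fin.succAbove 0 k) 0 ^ 2) := by
      rw [Finset.mul_sum]
      refine Finset.sum_le_sum fun k _ => ?_
      rw [hb]
      nlinarith [sq_nonneg (c 0 (Fin.succAbove 0 k) - c (Fin.succAbove 0 k) 0)]
    have := ih c'
    simp only [probReal_univ, one_smul]
    have h2 := mul_le_mul_of_nonneg_right hb2 hv
    linarith

end DegenKernel

/-- The iterated kernel `G(z, w) = E H(z, U) H(w, U)`. -/
noncomputable def iterKernel (π : Measure α) (H : α → α → ℝ) (z w : α) : ℝ :=
  ∫ u, H z u * H w u ∂π

lemma measurable_iterKernel {H : α → α → ℝ} (hH : Measurable (fun p : α × α => H p.1 p.2)) :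
    Measurable (fun p : α × α => iterKernel π H p.1 p.2) := by
  have : StronglyMeasurable (fun q : (α × α) × α => H q.1.1 q.2 * H q.1.2 q.2) := by
    apply Measurable.stronglyMeasurable
    exact (hH.comp ((measurable_fst.comp measurable_fst).prodMk measurable_snd)).mul
      (hH.comp ((measurable_snd.comp measurable_fst).prodMk measurable_snd))
  exact this.integral_prod_right.measurable

lemma sq_iterKernel_le {H : α → α → ℝ} (hH : DegenKernel π H) (z w : α) :
    iterKernel π H z w ^ 2 ≤ (∫ u, H z u ^ 2 ∂π) * ∫ u, H w u ^ 2 ∂π :=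
  sq_integral_mul_le (hH.slice z) (hH.slice w)

lemma DegenKernel.integrable_sq_slice {H : α → α → ℝ} (hH : DegenKernel π H) :
    Integrable (fun z => ∫ u, H z u ^ 2 ∂π) π :=
  hH.memLp.integrable_sq.integral_prod_left

/-- Fubini gives the zero mean and Cauchy–Schwarz the square integrability. Thus the variance bound
for degenerate sums also applies to the iterated kernel, which is how fluctuations of the
conditional variance are controlled. -/
lemma DegenKernel.iter {H : α → α → ℝ} (hH : DegenKernel π H) :
    DegenKernel π (iterKernel π H) where
  meas := measurable_iterKernel hH.meas
  symm z w := by simp only [iterKernel, mul_comm]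
  slice z := by
    have hm : Measurable (iterKernel π H z) :=
      (measurable_iterKernel hH.meas).comp measurable_prodMk_left
    refine (memLp_two_iff_integrable_sq hm.aestronglyMeasurable).2 ?_
    refine (hH.integrable_sq_slice.const_mul (∫ u, H z u ^ 2 ∂π)).mono'
      (hm.pow_const 2).aestronglyMeasurable (Eventually.of_forall fun w => ?_)
    rw [Real.norm_of_nonneg (sq_nonneg _)]
    exact sq_iterKernel_le hH z w
  mean z := by
    unfold iterKernel
    have hi : Integrable (fun p : α × α => H z p.2 * H p.1 p.2) (π.prod π) :=
      ((hH.slice z).comp_snd π).integrable_mul hH.memLp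
    rw [integral_integral_swap hi]
    simp_rw [integral_const_mul, hH.mean_left, mul_zero, integral_zero]
  memLp := by
    have hm := measurable_iterKernel (π := π) hH.meas
    refine (memLp_two_iff_integrable_sq hm.aestronglyMeasurable).2 ?_
    refine (hH.integrable_sq_slice.mul_prod hH.integrable_sq_slice).mono'
      (hm.pow_const 2).aestronglyMeasurable (Eventually.of_forall fun p => ?_)
    rw [Real.norm_of_nonneg (sq_nonneg _)]
    exact sq_iterKernel_le hH p.1 p.2

lemma integral_sq_iterKernel_le {H : α → α → ℝ} (hH : DegenKernel π H) :
    ∫ p, iterKernel π H p.1 p.2 ^ 2 ∂(π.prod π) ≤ (∫ p, H p.1 p.2 ^ 2 ∂(π.prod π)) ^ 2 := by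
  refine (integral_mono_of_nonneg (Eventually.of_forall fun p => sq_nonneg _)
    (hH.integrable_sq_slice.mul_prod hH.integrable_sq_slice)
    (Eventually.of_forall fun p => sq_iterKernel_le hH p.1 p.2)).trans_eq ?_
  rw [integral_prod_mul (fun z => ∫ u, H z u ^ 2 ∂π) (fun z => ∫ u, H z u ^ 2 ∂π),
    integral_prod _ hH.memLp.integrable_sq, sq]

lemma integral_iterKernel_diag {H : α → α → ℝ} (hH : DegenKernel π H) :
    ∫ z, iterKernel π H z z ∂π = ∫ p, H p.1 p.2 ^ 2 ∂(π.prod π) := by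
  rw [integral_prod _ hH.memLp.integrable_sq]
  simp only [iterKernel, sq]

/-- The conditional variance of a new point's row given the sample. It splits into an i.i.d. sum, to
which a law of large numbers applies, and a degenerate sum in the iterated kernel. -/
lemma integral_sq_row_left {H : α → α → ℝ} (hH : DegenKernel π H) {n : ℕ} (w : Fin n → α) :
    ∫ u, (∑ k, H u (w k)) ^ 2 ∂π
      = ∑ k, iterKernel π H (w k) (w k) + offSum fun k l => iterKernel π H (w k) (w l) := by
  have h := sum_eq_diag_add_offSum (fun k l => iterKernel π H (w k) (w l))
  rw [← h]
  simp_rw [sq, Finset.sum_mul_sum, iterKernel, hH.symm _ (w _)]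
  have hi : ∀ k l, Integrable (fun u => H (w k) u * H (w l) u) π := fun k l =>
    (hH.slice _).integrable_mul (hH.slice _)
  rw [integral_finsetSum _ fun k _ => integrable_finsetSum _ fun l _ => hi k l]
  refine Finset.sum_congr rfl fun k _ => ?_
  rw [integral_finsetSum _ fun l _ => hi k l]

end Kernels

/-! ### A central limit theorem for degenerate `U`-statistics -/

lemma norm_cexp_mul_I_sub_one_le (x : ℝ) : ‖Complex.exp (x * Complex.I) - 1‖ ≤ |x| := by
  have := Real.norm_exp_I_mul_ofReal_sub_one_le (x := x)
  rwa [mul_comm, Real.norm_eq_abs] at this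

/-- Interpolates between the quadratic Taylor bound, used for `|x| ≤ 1`, and the linear bound, used
for `|x| ≥ 1`. It is needed with `q = r - 1`, since only `r` moments are available. -/
lemma norm_cexp_mul_I_sub_le {q : ℝ} (h1 : 1 ≤ q) (h2 : q ≤ 2) (x : ℝ) :
    ‖Complex.exp (x * Complex.I) - 1 - x * Complex.I‖ ≤ 2 * |x| ^ q := by
  have hn : ‖(x : ℂ) * Complex.I‖ = |x| := by simp
  rcases le_total |x| 1 with h | h
  · have h3 := Complex.norm_exp_sub_one_sub_id_le (x := (x : ℂ) * Complex.I) (by rw [hn]; exact h)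
    rw [hn] at h3
    refine h3.trans ?_
    rcases (abs_nonneg x).eq_or_lt with h0 | h0
    · rw [← h0, Real.zero_rpow (by linarith)]; simp
    · have h4 : |x| ^ (2 : ℝ) ≤ |x| ^ q := Real.rpow_le_rpow_of_exponent_ge h0 h h2
      rw [Real.rpow_two] at h4
      nlinarith [sq_nonneg |x|]
  · have h3 : |x| ≤ |x| ^ q := by
      conv_lhs => rw [← Real.rpow_one |x|]
      exact Real.rpow_le_rpow_of_exponent_le h h1
    calc _ ≤ ‖Complex.exp (x * Complex.I) - 1‖ + ‖(x : ℂ) * Complex.I‖ := norm_sub_le _ _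
      _ ≤ |x| + |x| := add_le_add (norm_cexp_mul_I_sub_one_le x) hn.le
      _ ≤ _ := by linarith

/-- With the integrating factor `exp (t²/2)`, the derivative of `φ(t) exp (t²/2)` is `(φ' + tφ) exp
(t²/2)`. The mean value inequality on the segment from `0` to `t` does the rest. -/
lemma norm_sub_gaussian_le_of_deriv {φ φ' : ℝ → ℂ} {ε : ℝ} (hφ : ∀ t, HasDerivAt φ (φ' t) t)
    (h0 : φ 0 = 1) (hb : ∀ t, ‖φ' t + t * φ t‖ ≤ (1 + t ^ 2) * ε) (t : ℝ) :
    ‖φ t - Real.exp (-t ^ 2 / 2)‖ ≤ |t| * (1 + t ^ 2) * ε := by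
  have hε : 0 ≤ ε := by
    have := (norm_nonneg _).trans (hb 0)
    simpa using this
  have he : ∀ s : ℝ, HasDerivAt (fun s : ℝ => ((Real.exp (s ^ 2 / 2) : ℝ) : ℂ))
      ((s * Real.exp (s ^ 2 / 2) : ℝ) : ℂ) s := fun s => by
    have : HasDerivAt (fun s : ℝ => Real.exp (s ^ 2 / 2)) (s * Real.exp (s ^ 2 / 2)) s := by
      exact ((hasDerivAt_pow 2 s).div_const 2).exp.congr_deriv (by simp; ring)
    exact this.ofReal_comp
  have hψ : ∀ s : ℝ, HasDerivAt (fun s : ℝ => φ s * ((Real.exp (s ^ 2 / 2) : ℝ) : ℂ))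
      ((φ' s + s * φ s) * ((Real.exp (s ^ 2 / 2) : ℝ) : ℂ)) s := fun s => by
    exact ((hφ s).mul (he s)).congr_deriv (by push_cast; ring)
  have hs : ∀ s ∈ Set.uIcc 0 t, s ^ 2 ≤ t ^ 2 := by
    intro s hs
    rw [sq_le_sq]
    rcases Set.mem_uIcc.1 hs with h | h
    · rw [abs_of_nonneg h.1, abs_of_nonneg (h.1.trans h.2)]; exact h.2
    · rw [abs_of_nonpos h.2, abs_of_nonpos (h.1.trans h.2)]; linarith [h.1]
  have hmv := Convex.norm_image_sub_le_of_norm_hasDerivWithin_le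
    (f := fun s : ℝ => φ s * ((Real.exp (s ^ 2 / 2) : ℝ) : ℂ)) (s := Set.uIcc 0 t)
    (C := (1 + t ^ 2) * ε * Real.exp (t ^ 2 / 2)) (x := 0) (y := t)
    (fun s _ => (hψ s).hasDerivWithinAt) (fun s h => by
      rw [norm_mul, Complex.norm_real, Real.norm_of_nonneg (Real.exp_pos _).le]
      have h1 := hs s h
      exact mul_le_mul ((hb s).trans (by gcongr)) (Real.exp_le_exp.2 (by linarith))
        (Real.exp_pos _).le (by positivity)) (convex_uIcc _ _) Set.left_mem_uIcc Set.right_mem_uIcc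
  have e : φ t - Real.exp (-t ^ 2 / 2) = (φ t * ((Real.exp (t ^ 2 / 2) : ℝ) : ℂ)
      - φ 0 * ((Real.exp ((0 : ℝ) ^ 2 / 2) : ℝ) : ℂ)) * ((Real.exp (-t ^ 2 / 2) : ℝ) : ℂ) := by
    have : ((Real.exp (t ^ 2 / 2) : ℝ) : ℂ) * ((Real.exp (-t ^ 2 / 2) : ℝ) : ℂ) = 1 := by
      rw [← Complex.ofReal_mul, ← Real.exp_add]
      simp [neg_div]
    rw [sub_mul, mul_assoc, this, h0]
    simp
  rw [e, norm_mul, Complex.norm_real, Real.norm_of_nonneg (Real.exp_pos _).le]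
  calc _ ≤ (1 + t ^ 2) * ε * Real.exp (t ^ 2 / 2) * ‖t - 0‖ * Real.exp (-t ^ 2 / 2) := by gcongr
    _ = |t| * (1 + t ^ 2) * ε * (Real.exp (t ^ 2 / 2) * Real.exp (-t ^ 2 / 2)) := by
      rw [sub_zero, Real.norm_eq_abs]; ring
    _ = _ := by rw [← Real.exp_add]; simp [neg_div]

section CLT

variable {α : Type*} [MeasurableSpace α] {π : Measure α} [IsProbabilityMeasure π]

lemma integrable_mul_cexp {β : Type*} [MeasurableSpace β] {ρ : Measure β} {f g : β → ℝ}
    (hf : Integrable f ρ) (hg : AEStronglyMeasurable g ρ) :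
    Integrable (fun x => (f x : ℂ) * Complex.exp (g x * Complex.I)) ρ := by
  have hm : AEStronglyMeasurable (fun x => Complex.exp (g x * Complex.I)) ρ :=
    (by fun_prop : Continuous fun x : ℝ => Complex.exp (x * Complex.I)).comp_aestronglyMeasurable hg
  refine hf.ofReal.mul_bdd (c := 1) hm (Eventually.of_forall fun x => ?_)
  rw [Complex.norm_exp_ofReal_mul_I]

lemma hasDerivAt_integral_cexp {β : Type*} [MeasurableSpace β] {ρ : Measure β}
    [IsProbabilityMeasure ρ] {S : β → ℝ} (hS : Integrable S ρ) (t : ℝ) :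
    HasDerivAt (fun t : ℝ => ∫ x, Complex.exp ((t * S x : ℝ) * Complex.I) ∂ρ)
      (∫ x, Complex.I * (S x * Complex.exp ((t * S x : ℝ) * Complex.I)) ∂ρ) t := by
  have hm : ∀ t : ℝ, AEStronglyMeasurable (fun x => Complex.exp ((t * S x : ℝ) * Complex.I)) ρ :=
    fun t => (by fun_prop : Continuous fun x : ℝ =>
      Complex.exp ((t * x : ℝ) * Complex.I)).comp_aestronglyMeasurable hS.1
  refine (hasDerivAt_integral_of_dominated_loc_of_deriv_le (μ := ρ)
    (F := fun (t : ℝ) x => Complex.exp ((t * S x : ℝ) * Complex.I))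
    (F' := fun (t : ℝ) x => Complex.I * (S x * Complex.exp ((t * S x : ℝ) * Complex.I)))
    (bound := fun x => ‖S x‖) (s := Set.univ) (x₀ := t) univ_mem (Eventually.of_forall hm) ?_ ?_ ?_
    hS.norm ?_).2
  · exact (integrable_const (1 : ℝ)).mono' (hm t) (Eventually.of_forall fun x => by
      rw [Complex.norm_exp_ofReal_mul_I])
  · exact ((integrable_mul_cexp hS (hS.1.const_mul t)).const_mul Complex.I).1
  · refine Eventually.of_forall fun x s _ => ?_
    rw [norm_mul, norm_mul, Complex.norm_exp_ofReal_mul_I]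
    simp
  · refine Eventually.of_forall fun x s _ => ?_
    have h1 : HasDerivAt (fun s : ℝ => ((s * S x : ℝ) : ℂ) * Complex.I) (S x * Complex.I) s := by
      have := (((hasDerivAt_id s).mul_const (S x)).ofReal_comp).mul_const Complex.I
      simpa using this
    exact h1.cexp.congr_deriv (by ring)

/-- Error term in the central limit theorem for degenerate `U`-statistics. -/
noncomputable def cltError (π : Measure α) (H : α → α → ℝ) (r : ℝ) (n : ℕ) : ℝ :=
  ((n : ℝ) + 1) / 2 * (2 * ∫ p, |∑ k, H p.1 (p.2 k)| ^ r ∂(π.prod (Measure.pi fun _ : Fin n => π))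
    + ∫ w, |∫ u, (∑ k, H u (w k)) ^ 2 ∂π - n * ∫ p, H p.1 p.2 ^ 2 ∂(π.prod π)|
        ∂(Measure.pi fun _ : Fin n => π)
    + n * (∫ p, H p.1 p.2 ^ 2 ∂(π.prod π)) * √(n * ∫ p, H p.1 p.2 ^ 2 ∂(π.prod π)))

/-- The sample has `n + 1` points, so that `n` remain after deleting one, and `hv` says that the
statistic `S` has variance one. By exchangeability `φ'(t)` is `i (n+1)/2` times `E R exp(it(T +
R))`, with `R` the row of the deleted point and `T` the statistic of the others. The zeroth order
term in `R` vanishes by degeneracy and the first order term produces `-tφ(t)`. The errors are `e1`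
(Taylor remainder), `e2` (conditional variance against its mean) and `e3` (replacing `T` by `T +
R`). -/
theorem norm_charFun_sub_gaussian_le {H : α → α → ℝ} (hH : DegenKernel π H) {r : ℝ} (h2 : 2 < r)
    (h3 : r ≤ 3) (hr : MemLp (fun p : α × α => H p.1 p.2) (ENNReal.ofReal r) (π.prod π)) {n : ℕ}
    (hv : (n + 1) * n * ∫ p, H p.1 p.2 ^ 2 ∂(π.prod π) = 2) (t : ℝ) :
    ‖∫ w, Complex.exp ((t * (1 / 2 * offSum fun k l => H (w k) (w l)) : ℝ) * Complex.I)
        ∂(Measure.pi fun _ : Fin (n + 1) => π) - Real.exp (-t ^ 2 / 2)‖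
      ≤ |t| * (1 + t ^ 2) * cltError π H r n := by
  have hr0 : ENNReal.ofReal r ≠ 0 := by simp; linarith
  have hrt : (ENNReal.ofReal r).toReal = r := ENNReal.toReal_ofReal (by linarith)
  set v := ∫ p, H p.1 p.2 ^ 2 ∂(π.prod π) with hvdef
  have hv0 : 0 ≤ v := integral_nonneg fun p => sq_nonneg _
  set ρ := Measure.pi fun _ : Fin n => π with hρ
  set S : (Fin (n + 1) → α) → ℝ := fun w => 1 / 2 * offSum fun k l => H (w k) (w l) with hS
  set T : (Fin n → α) → ℝ := fun w => 1 / 2 * offSum fun k l => H (w k) (w l) with hT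
  set R : α × (Fin n → α) → ℝ := fun p => ∑ k, H p.1 (p.2 k) with hR
  set V : (Fin n → α) → ℝ := fun w => ∫ u, (∑ k, H u (w k)) ^ 2 ∂π with hVdef
  have hoff : ∀ n : ℕ, MemLp (fun w : Fin n → α => 1 / 2 * offSum fun k l => H (w k) (w l)) 2
      (Measure.pi fun _ => π) := fun n => by
    have := (memLp_offSum hH.memLp (fun _ _ : Fin n => (1 : ℝ))).const_mul (1 / 2)
    simpa using this
  have hS2 : MemLp S 2 (Measure.pi fun _ => π) := hoff _
  have hT2 : MemLp T 2 ρ := hoff _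
  have hTm : AEStronglyMeasurable (fun p : α × (Fin n → α) => T p.2) (π.prod ρ) :=
    (hT2.comp_snd π).1
  have hR2 : MemLp R 2 (π.prod ρ) := by
    have := memLp_row hH.memLp (fun _ : Fin n => (1 : ℝ))
    simpa using this
  have hRr : MemLp R (ENNReal.ofReal r) (π.prod ρ) := by
    have := memLp_row hr (fun _ : Fin n => (1 : ℝ))
    simpa using this
  have iRr : Integrable (fun p => |R p| ^ r) (π.prod ρ) := by
    have := hRr.integrable_norm_rpow hr0 (by simp)
    simpa [hrt] using this
  have iR : Integrable R (π.prod ρ) := hR2.integrable (by norm_num)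
  have hins : ∀ (i : Fin (n + 1)) (p : α × (Fin n → α)),
      S (i.insertNth (α := fun _ => α) p.1 p.2) = T p.2 + R p := by
    intro i p
    simp only [hS, hT, hR]
    rw [offSum_succAbove _ i]
    simp only [Fin.insertNth_apply_same, Fin.insertNth_apply_succAbove, hH.symm (p.2 _) p.1]
    rw [mul_add, Finset.mul_sum]
    congr 1
    exact Finset.sum_congr rfl fun k _ => by ring
  have hER2 : ∫ p, R p ^ 2 ∂(π.prod ρ) = n * v := by
    have := hH.integral_sq_row (fun _ : Fin n => (1 : ℝ))
    simpa using this
  have hERabs : ∫ p, |R p| ∂(π.prod ρ) ≤ √(n * v) := hER2 ▸ abs_integral_le_sqrt hR2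
  have hVint : Integrable V ρ := hR2.integrable_sq.integral_prod_right
  set φ : ℝ → ℂ := fun t => ∫ w, Complex.exp ((t * S w : ℝ) * Complex.I)
    ∂(Measure.pi fun _ : Fin (n + 1) => π) with hφ
  have hφ0 : φ 0 = 1 := by simp [hφ]
  have hderiv := fun t => hasDerivAt_integral_cexp (hS2.integrable (by norm_num)) t
  refine norm_sub_gaussian_le_of_deriv hderiv hφ0 (fun t => ?_) t
  -- reduction to a leave-one-out expression
  have hident : ∫ w, Complex.I * (S w * Complex.exp ((t * S w : ℝ) * Complex.I))
      ∂(Measure.pi fun _ : Fin (n + 1) => π) = Complex.I * ((n + 1) / 2 *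
        ∫ p, (R p : ℂ) * Complex.exp ((t * (T p.2 + R p) : ℝ) * Complex.I) ∂(π.prod ρ)) := by
    rw [integral_const_mul]
    congr 1
    have hrow : ∀ i : Fin (n + 1), ∀ p : α × (Fin n → α),
        (∑ l, if i = l then 0 else H (i.insertNth (α := fun _ => α) p.1 p.2 i)
          (i.insertNth (α := fun _ => α) p.1 p.2 l)) = R p := by
      intro i p
      rw [Fin.sum_univ_succAbove _ i]
      simp [hR, (Fin.succAbove_ne i _).symm]
    have hi : ∀ i : Fin (n + 1), Integrable (fun w : Fin (n + 1) → α =>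
        (((∑ l, if i = l then 0 else H (w i) (w l)) : ℝ) : ℂ)
          * Complex.exp ((t * S w : ℝ) * Complex.I)) (Measure.pi fun _ => π) := by
      intro i
      rw [← integrable_pi_insertNth_iff π i]
      simp_rw [hrow i, hins i]
      exact integrable_mul_cexp iR ((hTm.add iR.1).const_mul t)
    have e : ∀ w : Fin (n + 1) → α, (S w : ℂ) * Complex.exp ((t * S w : ℝ) * Complex.I)
        = ∑ i, 1 / 2 * ((((∑ l, if i = l then 0 else H (w i) (w l)) : ℝ) : ℂ)
          * Complex.exp ((t * S w : ℝ) * Complex.I)) := by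
      intro w
      have hSw : (S w : ℂ) = 1 / 2 * ((∑ i, ∑ l, if i = l then 0 else H (w i) (w l) : ℝ) : ℂ) := by
        simp only [hS, offSum]; push_cast; ring
      rw [← Finset.mul_sum, ← Finset.sum_mul, ← Complex.ofReal_sum, hSw]
      ring
    simp_rw [e]
    rw [integral_finsetSum _ fun i _ => (hi i).const_mul _]
    have : ∀ i : Fin (n + 1), ∫ w, 1 / 2 * ((((∑ l, if i = l then 0 else H (w i) (w l)) : ℝ) : ℂ)
          * Complex.exp ((t * S w : ℝ) * Complex.I)) ∂(Measure.pi fun _ : Fin (n + 1) => π)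
        = 1 / 2 * ∫ p, (R p : ℂ) * Complex.exp ((t * (T p.2 + R p) : ℝ) * Complex.I)
          ∂(π.prod ρ) := by
      intro i
      rw [integral_const_mul, integral_pi_insertNth π i]
      simp_rw [hrow i, hins i, hρ]
    simp_rw [this]
    simp
    ring
  rw [hident]
  -- Taylor expansion
  have i1 : Integrable (fun p => (R p : ℂ) * Complex.exp ((t * T p.2 : ℝ) * Complex.I))
    (π.prod ρ) := integrable_mul_cexp iR (hTm.const_mul t)
  have i2 : Integrable (fun p => ((R p ^ 2 : ℝ) : ℂ) * Complex.exp ((t * T p.2 : ℝ) * Complex.I))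
    (π.prod ρ) := integrable_mul_cexp hR2.integrable_sq (hTm.const_mul t)
  have i3 : Integrable (fun p => (R p : ℂ) * Complex.exp ((t * (T p.2 + R p) : ℝ) * Complex.I))
    (π.prod ρ) := integrable_mul_cexp iR ((hTm.add iR.1).const_mul t)
  have hz : ∫ p, (R p : ℂ) * Complex.exp ((t * T p.2 : ℝ) * Complex.I) ∂(π.prod ρ) = 0 := by
    rw [integral_prod_symm _ i1]
    have : ∀ w : Fin n → α, ∫ u, (R (u, w) : ℂ) ∂π = 0 := fun w => by
      have h := hH.integral_row_left (fun _ : Fin n => (1 : ℝ)) w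
      simp only [one_mul] at h
      exact (integral_ofReal (𝕜 := ℂ) (f := fun u => R (u, w))).trans (by simp [hR, h])
    simp_rw [integral_mul_const, this, zero_mul, integral_zero]
  set e1 : ℂ := ∫ p, ((R p : ℂ) * Complex.exp ((t * (T p.2 + R p) : ℝ) * Complex.I)
      - (R p : ℂ) * Complex.exp ((t * T p.2 : ℝ) * Complex.I)
      - (t * Complex.I) * (((R p ^ 2 : ℝ) : ℂ) * Complex.exp ((t * T p.2 : ℝ) * Complex.I)))
      ∂(π.prod ρ) with he1
  have hexp : ∫ p, (R p : ℂ) * Complex.exp ((t * (T p.2 + R p) : ℝ) * Complex.I) ∂(π.prod ρ)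
      = e1 + (t * Complex.I) * ∫ p, ((R p ^ 2 : ℝ) : ℂ)
        * Complex.exp ((t * T p.2 : ℝ) * Complex.I) ∂(π.prod ρ) := by
    rw [he1, integral_sub, integral_sub i3 i1, hz, integral_const_mul]
    · ring
    · exact i3.sub i1
    · exact i2.const_mul _
  have hsplit : ∀ p : α × (Fin n → α), Complex.exp ((t * (T p.2 + R p) : ℝ) * Complex.I)
      = Complex.exp ((t * T p.2 : ℝ) * Complex.I) * Complex.exp ((t * R p : ℝ) * Complex.I) := by
    intro p
    rw [← Complex.exp_add]; congr 1; push_cast; ring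
  have hb1 : ‖e1‖ ≤ |t| ^ (r - 1) * (2 * ∫ p, |R p| ^ r ∂(π.prod ρ)) := by
    rw [← integral_const_mul, ← integral_const_mul]
    refine norm_integral_le_of_norm_le ((iRr.const_mul _).const_mul _)
      (Eventually.of_forall fun p => ?_)
    have e : (R p : ℂ) * Complex.exp ((t * (T p.2 + R p) : ℝ) * Complex.I)
      - (R p : ℂ) * Complex.exp ((t * T p.2 : ℝ) * Complex.I)
      - (t * Complex.I) * (((R p ^ 2 : ℝ) : ℂ) * Complex.exp ((t * T p.2 : ℝ) * Complex.I))
      = R p * Complex.exp ((t * T p.2 : ℝ) * Complex.I) *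
        (Complex.exp ((t * R p : ℝ) * Complex.I) - 1 - (t * R p : ℝ) * Complex.I) := by
      rw [hsplit]; push_cast; ring
    rw [e, norm_mul, norm_mul, Complex.norm_exp_ofReal_mul_I, Complex.norm_real, Real.norm_eq_abs,
      mul_one]
    have h := norm_cexp_mul_I_sub_le (q := r - 1) (by linarith) (by linarith) (t * R p)
    rw [abs_mul, Real.mul_rpow (abs_nonneg _) (abs_nonneg _)] at h
    have hpow : |R p| ^ r = |R p| * |R p| ^ (r - 1) := by
      rw [← Real.rpow_one_add' (abs_nonneg _) (by linarith)]; congr 1; ring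
    rw [hpow]
    calc _ ≤ |R p| * (2 * (|t| ^ (r - 1) * |R p| ^ (r - 1))) := by gcongr
      _ = _ := by ring
  set e2 : ℂ := ∫ w, ((V w - n * v : ℝ) : ℂ) * Complex.exp ((t * T w : ℝ) * Complex.I) ∂ρ with he2
  have hb2 : ‖e2‖ ≤ ∫ w, |V w - n * v| ∂ρ := by
    refine norm_integral_le_of_norm_le (hVint.sub (integrable_const _)).abs
      (Eventually.of_forall fun w => ?_)
    rw [norm_mul, Complex.norm_exp_ofReal_mul_I, Complex.norm_real, Real.norm_eq_abs, mul_one]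
  set e3 : ℂ := ∫ p, (Complex.exp ((t * T p.2 : ℝ) * Complex.I)
    - Complex.exp ((t * (T p.2 + R p) : ℝ) * Complex.I)) ∂(π.prod ρ) with he3
  have hb3 : ‖e3‖ ≤ |t| * √(n * v) := by
    refine le_trans ?_ (mul_le_mul_of_nonneg_left hERabs (abs_nonneg t))
    rw [← integral_const_mul]
    refine norm_integral_le_of_norm_le (iR.abs.const_mul _) (Eventually.of_forall fun p => ?_)
    have e : Complex.exp ((t * T p.2 : ℝ) * Complex.I)
        - Complex.exp ((t * (T p.2 + R p) : ℝ) * Complex.I)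
        = - (Complex.exp ((t * T p.2 : ℝ) * Complex.I)
          * (Complex.exp ((t * R p : ℝ) * Complex.I) - 1)) := by
      rw [hsplit]; ring
    rw [e, norm_neg, norm_mul, Complex.norm_exp_ofReal_mul_I, one_mul, ← abs_mul]
    exact norm_cexp_mul_I_sub_one_le _
  have hie : ∀ {β : Type _} [MeasurableSpace β] {ρ : Measure β} [IsProbabilityMeasure ρ]
      {g : β → ℝ}, AEStronglyMeasurable g ρ →
      Integrable (fun x => Complex.exp (g x * Complex.I)) ρ := by
    intro β _ ρ _ g hg
    have := integrable_mul_cexp (integrable_const (1 : ℝ)) hg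
    simpa using this
  have hφeq : φ t = ∫ p, Complex.exp ((t * (T p.2 + R p) : ℝ) * Complex.I) ∂(π.prod ρ) := by
    simp only [hφ]
    rw [integral_pi_insertNth π 0]
    simp_rw [hins 0, hρ]
  have hTR : AEStronglyMeasurable (fun p => t * (T p.2 + R p)) (π.prod ρ) :=
    (hTm.add iR.1).const_mul t
  have h3eq : ∫ w, Complex.exp ((t * T w : ℝ) * Complex.I) ∂ρ = e3 + φ t := by
    rw [he3, integral_sub (hie (hTm.const_mul t)) (hie hTR), ← hφeq,
      integral_fun_snd (fun w => Complex.exp ((t * T w : ℝ) * Complex.I))]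
    simp
  have h2eq : ∫ p, ((R p ^ 2 : ℝ) : ℂ) * Complex.exp ((t * T p.2 : ℝ) * Complex.I) ∂(π.prod ρ)
      = e2 + n * v * (e3 + φ t) := by
    rw [integral_prod_symm _ i2]
    have : ∀ w : Fin n → α, ∫ u, ((R (u, w) ^ 2 : ℝ) : ℂ) ∂π = V w := fun w => integral_ofReal
    simp_rw [integral_mul_const, this]
    have j1 : Integrable (fun w => ((V w - n * v : ℝ) : ℂ) * Complex.exp ((t * T w : ℝ) * Complex.I))
      ρ := integrable_mul_cexp (hVint.sub (integrable_const (n * v))) (hT2.1.const_mul t)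
    rw [← h3eq, he2, ← integral_const_mul (n * v : ℂ),
      ← integral_add j1 ((hie (hT2.1.const_mul t)).const_mul (n * v : ℂ))]
    congr 1 with w
    push_cast; ring
  rw [hexp, h2eq]
  have hvC : ((n : ℂ) + 1) * n * v = 2 := by exact_mod_cast hv
  -- By the normalization `(n+1)/2 · n v = 1`, the main term is `i · it · φ(t) = -tφ(t)` and
  -- cancels; only the three errors remain.
  have efin : Complex.I * ((n + 1) / 2 * (e1 + t * Complex.I * (e2 + n * v * (e3 + φ t))))
      + t * φ t = Complex.I * ((n + 1) / 2) * (e1 + t * Complex.I * (e2 + n * v * e3)) := by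
    have hI : Complex.I ^ 2 = -1 := Complex.I_sq
    linear_combination (t * φ t / 2 * Complex.I ^ 2) * hvC + (t * φ t) * hI
  rw [efin]
  have hn0 : (0 : ℝ) ≤ n := n.cast_nonneg
  have ht1 : |t| ≤ 1 + t ^ 2 := by nlinarith [sq_abs t, sq_nonneg (|t| - 1)]
  have ht2 : |t| ^ (r - 1) ≤ 1 + t ^ 2 := by
    rcases le_total |t| 1 with h | h
    · have := Real.rpow_le_one (abs_nonneg t) h (z := r - 1) (by linarith)
      nlinarith [sq_nonneg t]
    · have h4 : |t| ^ (r - 1) ≤ |t| ^ (2 : ℝ) :=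
        Real.rpow_le_rpow_of_exponent_le h (by linarith)
      rw [Real.rpow_two, sq_abs] at h4
      linarith
  have hnorm : ‖Complex.I * (((n : ℂ) + 1) / 2)‖ = ((n : ℝ) + 1) / 2 := by
    rw [norm_mul, Complex.norm_I, one_mul]
    have : ((n : ℂ) + 1) / 2 = (((n : ℝ) + 1) / 2 : ℝ) := by push_cast; ring
    rw [this, Complex.norm_real, Real.norm_of_nonneg (by positivity)]
  rw [norm_mul, hnorm, cltError]
  have hA0 : 0 ≤ ∫ p, |R p| ^ r ∂(π.prod ρ) := integral_nonneg fun p => by positivity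
  have hB0 : 0 ≤ ∫ w, |V w - n * v| ∂ρ := integral_nonneg fun p => by positivity
  have hsq0 := Real.sqrt_nonneg (n * v)
  have hmain : ‖e1 + t * Complex.I * (e2 + n * v * e3)‖
      ≤ (1 + t ^ 2) * (2 * ∫ p, |R p| ^ r ∂(π.prod ρ)) + ((1 + t ^ 2) * ∫ w, |V w - n * v| ∂ρ
        + (1 + t ^ 2) * (n * v * √(n * v))) := by
    refine (norm_add_le _ _).trans (add_le_add (hb1.trans (by gcongr)) ?_)
    rw [norm_mul]
    have e5 : ‖(t : ℂ) * Complex.I‖ = |t| := by simp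
    have e6 : ‖(n : ℂ) * v * e3‖ ≤ n * v * (|t| * √(n * v)) := by
      rw [norm_mul, norm_mul, Complex.norm_natCast, Complex.norm_real, Real.norm_of_nonneg hv0]
      gcongr
    rw [e5]
    calc |t| * ‖e2 + n * v * e3‖ ≤ |t| * (∫ w, |V w - n * v| ∂ρ + n * v * (|t| * √(n * v))) := by
          gcongr
          exact (norm_add_le _ _).trans (add_le_add hb2 e6)
      _ = |t| * ∫ w, |V w - n * v| ∂ρ + t ^ 2 * (n * v * √(n * v)) := by rw [← sq_abs t]; ring
      _ ≤ _ := by gcongr; linarith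
  calc _ ≤ ((n : ℝ) + 1) / 2 * ((1 + t ^ 2) * (2 * ∫ p, |R p| ^ r ∂(π.prod ρ))
        + ((1 + t ^ 2) * ∫ w, |V w - n * v| ∂ρ + (1 + t ^ 2) * (n * v * √(n * v)))) := by gcongr
    _ = _ := by ring

end CLT

/-! ### Double centring -/

section DblCenter

variable {α : Type*} [MeasurableSpace α] {π : Measure α} [IsProbabilityMeasure π]

/-- The doubly centred version of a symmetric kernel. -/
noncomputable def dblCenter (π : Measure α) (K : α → α → ℝ) (z w : α) : ℝ :=
  K z w - ∫ u, K z u ∂π - ∫ u, K w u ∂π + ∫ p, K p.1 p.2 ∂(π.prod π)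

lemma integrable_abs_rpow {β : Type*} [MeasurableSpace β] {ρ : Measure β} {g : β → ℝ} {r : ℝ}
    (hr : 0 < r) (hg : MemLp g (ENNReal.ofReal r) ρ) : Integrable (fun x => |g x| ^ r) ρ := by
  have := hg.integrable_norm_rpow (by simp [hr]) (by simp)
  simpa [ENNReal.toReal_ofReal hr.le] using this

lemma memLp_of_integrable_abs_rpow {β : Type*} [MeasurableSpace β] {ρ : Measure β} {g : β → ℝ}
    {r : ℝ} (hr : 0 < r) (hm : AEStronglyMeasurable g ρ) (hg : Integrable (fun x => |g x| ^ r) ρ) :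
    MemLp g (ENNReal.ofReal r) ρ := by
  rw [← integrable_norm_rpow_iff hm (by simp [hr]) (by simp)]
  simpa [ENNReal.toReal_ofReal hr.le] using hg

lemma abs_integral_rpow_le {β : Type*} [MeasurableSpace β] {ρ : Measure β} [IsProbabilityMeasure ρ]
    {g : β → ℝ} {r : ℝ} (hr : 1 ≤ r) (hg : MemLp g (ENNReal.ofReal r) ρ) :
    |∫ x, g x ∂ρ| ^ r ≤ ∫ x, |g x| ^ r ∂ρ := by
  have h1 : MemLp g 1 ρ := hg.mono_exponent (by simpa using ENNReal.ofReal_le_ofReal hr)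
  calc |∫ x, g x ∂ρ| ^ r ≤ (∫ x, |g x| ∂ρ) ^ r := by
        gcongr
        exact abs_integral_le_integral_abs
    _ ≤ _ := rpow_integral_le hr (fun x => abs_nonneg _) (h1.integrable le_rfl).abs
        (integrable_abs_rpow (by linarith) hg)

/-- The sum is at most four times the largest modulus, and `4^r ≤ 64`. -/
lemma abs_add₄_rpow_le {r : ℝ} (h1 : 1 ≤ r) (h3 : r ≤ 3) (a b c d : ℝ) :
    |a + b + c + d| ^ r ≤ 64 * (|a| ^ r + |b| ^ r + |c| ^ r + |d| ^ r) := by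
  set m := max (max |a| |b|) (max |c| |d|) with hm
  have hm0 : 0 ≤ m := le_max_of_le_left (le_max_of_le_left (abs_nonneg a))
  have ha : |a| ≤ m := (le_max_left _ _).trans (le_max_left _ _)
  have hb : |b| ≤ m := (le_max_right _ _).trans (le_max_left _ _)
  have hc : |c| ≤ m := (le_max_left _ _).trans (le_max_right _ _)
  have hd : |d| ≤ m := (le_max_right _ _).trans (le_max_right _ _)
  have hs : |a + b + c + d| ≤ 4 * m := by
    have := abs_add_le (a + b + c) d
    have := abs_add_le (a + b) c
    have := abs_add_le a b
    linarith
  have h4 : (4 : ℝ) ^ r ≤ 64 := by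
    calc (4 : ℝ) ^ r ≤ 4 ^ (3 : ℝ) := Real.rpow_le_rpow_of_exponent_le (by norm_num) h3
      _ = 64 := by norm_num
  have pa : 0 ≤ |a| ^ r := by positivity
  have pb : 0 ≤ |b| ^ r := by positivity
  have pc : 0 ≤ |c| ^ r := by positivity
  have pd : 0 ≤ |d| ^ r := by positivity
  have hmr : m ^ r ≤ |a| ^ r + |b| ^ r + |c| ^ r + |d| ^ r := by
    rcases max_choice (max |a| |b|) (max |c| |d|) with h | h
    · rcases max_choice |a| |b| with h' | h' <;> rw [hm, h, h'] <;> linarith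
    · rcases max_choice |c| |d| with h' | h' <;> rw [hm, h, h'] <;> linarith
  calc |a + b + c + d| ^ r ≤ (4 * m) ^ r := by gcongr
    _ = 4 ^ r * m ^ r := Real.mul_rpow (by norm_num) hm0
    _ ≤ _ := by gcongr

lemma memLp_integral_slice {K : α → α → ℝ} {r : ℝ} (hr : 1 ≤ r)
    (hm : Measurable (fun p : α × α => K p.1 p.2))
    (hs : ∀ z, MemLp (K z) (ENNReal.ofReal r) π)
    (hK : MemLp (fun p : α × α => K p.1 p.2) (ENNReal.ofReal r) (π.prod π)) :
    MemLp (fun z => ∫ u, K z u ∂π) (ENNReal.ofReal r) π ∧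
      ∫ z, |∫ u, K z u ∂π| ^ r ∂π ≤ ∫ p, |K p.1 p.2| ^ r ∂(π.prod π) := by
  have hr0 : 0 < r := by linarith
  have hmm : StronglyMeasurable (fun z => ∫ u, K z u ∂π) :=
    hm.stronglyMeasurable.integral_prod_right
  have hi := integrable_abs_rpow hr0 hK
  have hle : ∀ z, |∫ u, K z u ∂π| ^ r ≤ ∫ u, |K z u| ^ r ∂π := fun z =>
    abs_integral_rpow_le hr (hs z)
  have hint : Integrable (fun z => |∫ u, K z u ∂π| ^ r) π :=
    hi.integral_prod_left.mono' ((Real.continuous_rpow_const hr0.le).comp_aestronglyMeasurable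
      hmm.aestronglyMeasurable.norm) (Eventually.of_forall fun z => by
        rw [Real.norm_of_nonneg (by positivity)]; exact hle z)
  refine ⟨memLp_of_integrable_abs_rpow hr0 hmm.aestronglyMeasurable hint, ?_⟩
  rw [integral_prod _ hi]
  exact integral_mono hint hi.integral_prod_left hle

/-- By Jensen each of the four terms of the double centring has `r`-th moment at most that of `K`;
hence `256 = 64 · 4`. -/
lemma memLp_dblCenter {K : α → α → ℝ} {r : ℝ} (hr : 1 ≤ r) (hr3 : r ≤ 3)
    (hm : Measurable (fun p : α × α => K p.1 p.2))
    (hs : ∀ z, MemLp (K z) (ENNReal.ofReal r) π)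
    (hK : MemLp (fun p : α × α => K p.1 p.2) (ENNReal.ofReal r) (π.prod π)) :
    MemLp (fun p : α × α => dblCenter π K p.1 p.2) (ENNReal.ofReal r) (π.prod π) ∧
      ∫ p, |dblCenter π K p.1 p.2| ^ r ∂(π.prod π) ≤ 256 * ∫ p, |K p.1 p.2| ^ r ∂(π.prod π) := by
  have hr0 : 0 < r := by linarith
  obtain ⟨ha, hab⟩ := memLp_integral_slice hr hm hs hK
  have h1 : MemLp (fun p : α × α => ∫ u, K p.1 u ∂π) (ENNReal.ofReal r) (π.prod π) :=
    ha.comp_fst π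
  have h2 : MemLp (fun p : α × α => ∫ u, K p.2 u ∂π) (ENNReal.ofReal r) (π.prod π) :=
    ha.comp_snd π
  have hD : MemLp (fun p : α × α => dblCenter π K p.1 p.2) (ENNReal.ofReal r) (π.prod π) :=
    ((hK.sub h1).sub h2).add (memLp_const _)
  refine ⟨hD, ?_⟩
  set θ := ∫ p, K p.1 p.2 ∂(π.prod π) with hθ
  set m := ∫ p, |K p.1 p.2| ^ r ∂(π.prod π) with hmdef
  have hθm : |θ| ^ r ≤ m := abs_integral_rpow_le hr hK
  have i0 := integrable_abs_rpow hr0 hK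
  have i1 := integrable_abs_rpow hr0 h1
  have i2 := integrable_abs_rpow hr0 h2
  have hle : ∀ p : α × α, |dblCenter π K p.1 p.2| ^ r ≤ 64 * (|K p.1 p.2| ^ r
      + |∫ u, K p.1 u ∂π| ^ r + |∫ u, K p.2 u ∂π| ^ r + |θ| ^ r) := fun p => by
    have := abs_add₄_rpow_le hr hr3 (K p.1 p.2) (-∫ u, K p.1 u ∂π) (-∫ u, K p.2 u ∂π) θ
    rw [abs_neg, abs_neg] at this
    exact this
  have h4 := integral_mono (integrable_abs_rpow hr0 hD)
    ((((i0.add i1).add i2).add (integrable_const (|θ| ^ r))).const_mul 64) hle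
  refine h4.trans ?_
  rw [integral_const_mul]
  have e := integral_add₄ i0 i1 i2 (integrable_const (|θ| ^ r) (μ := π.prod π))
  simp only [Pi.add_apply]
  rw [e, integral_fun_fst (fun z => |∫ u, K z u ∂π| ^ r),
    integral_fun_snd (fun z => |∫ u, K z u ∂π| ^ r)]
  simp only [probReal_univ, one_smul, integral_const]
  linarith

lemma degenKernel_dblCenter {K : α → α → ℝ} (hm : Measurable (fun p : α × α => K p.1 p.2))
    (hsymm : ∀ z w, K z w = K w z) (hs : ∀ z, MemLp (K z) 2 π)
    (hK : MemLp (fun p : α × α => K p.1 p.2) 2 (π.prod π)) :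
    DegenKernel π (dblCenter π K) := by
  have e2 : (2 : ENNReal) = ENNReal.ofReal 2 := by simp
  have hmm : Measurable (fun z => ∫ u, K z u ∂π) :=
    (hm.stronglyMeasurable.integral_prod_right).measurable
  have ha : MemLp (fun z => ∫ u, K z u ∂π) 2 π := by
    rw [e2] at hs hK ⊢
    exact (memLp_integral_slice (by norm_num) hm hs hK).1
  refine ⟨?_, ?_, ?_, ?_, ?_⟩
  · exact ((hm.sub (hmm.comp measurable_fst)).sub (hmm.comp measurable_snd)).add_const _
  · intro z w
    simp only [dblCenter, hsymm z w]
    ring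
  · intro z
    exact (((hs z).sub (memLp_const _)).sub ha).add (memLp_const _)
  · intro z
    have i1 := (hs z).integrable (μ := π) (by norm_num)
    have i2 := ha.integrable (by norm_num)
    have e : ∫ w, ∫ u, K w u ∂π ∂π = ∫ p, K p.1 p.2 ∂(π.prod π) :=
      (integral_prod _ (hK.integrable (by norm_num))).symm
    unfold dblCenter
    have := integral_add₄ i1 (integrable_const (-∫ u, K z u ∂π)) i2.neg
      (integrable_const (∫ p, K p.1 p.2 ∂(π.prod π)))
    simp only [Pi.neg_apply, ← sub_eq_add_neg] at this
    rw [this, integral_const, integral_const, integral_neg, e]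
    simp
  · rw [e2] at hs hK ⊢
    exact (memLp_dblCenter (by norm_num) (by norm_num) hm hs hK).1

/-! ### Weak laws of large numbers with truncation -/

/-- Truncation of a nonnegative variable at level `M`. -/
noncomputable def trunc (M x : ℝ) : ℝ := if x ≤ M then x else 0

lemma measurable_trunc (M : ℝ) : Measurable (trunc M) :=
  Measurable.ite measurableSet_Iic measurable_id measurable_const

lemma trunc_nonneg (M : ℝ) {x : ℝ} (hx : 0 ≤ x) : 0 ≤ trunc M x := by
  unfold trunc; split_ifs <;> simp [hx]

lemma trunc_le (M : ℝ) {x : ℝ} (hx : 0 ≤ x) : trunc M x ≤ x := by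
  unfold trunc; split_ifs <;> simp [hx]

lemma trunc_le_level {M : ℝ} (hM : 0 ≤ M) (x : ℝ) : trunc M x ≤ M := by
  unfold trunc; split_ifs with h <;> simp [hM, h]

lemma sub_trunc_le {M s x : ℝ} (hM : 0 < M) (hs : 1 ≤ s) (hx : 0 ≤ x) :
    x - trunc M x ≤ M ^ (1 - s) * x ^ s := by
  unfold trunc
  split_ifs with h
  · rw [sub_self]; positivity
  · push Not at h
    rw [sub_zero]
    have hx0 : 0 < x := hM.trans h
    have : x ^ (1 - s) ≤ M ^ (1 - s) := Real.rpow_le_rpow_of_nonpos hM h.le (by linarith)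
    calc x = x ^ (1 - s) * x ^ s := by rw [← Real.rpow_add hx0]; simp
      _ ≤ _ := by gcongr

lemma sq_trunc_le {M s x : ℝ} (hM : 0 < M) (hs : 1 ≤ s) (hs2 : s ≤ 2) (hx : 0 ≤ x) :
    trunc M x ^ 2 ≤ M ^ (2 - s) * x ^ s := by
  unfold trunc
  split_ifs with h
  · rcases hx.eq_or_lt with h0 | h0
    · rw [← h0]; simp [Real.zero_rpow (by linarith : s ≠ 0)]
    · have : x ^ (2 - s) ≤ M ^ (2 - s) := Real.rpow_le_rpow hx h (by linarith)
      calc x ^ 2 = x ^ (2 - s) * x ^ s := by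
            rw [← Real.rpow_add h0, ← Real.rpow_natCast]; congr 1; push_cast; ring
        _ ≤ _ := by gcongr
  · have : 0 ≤ M ^ (2 - s) * x ^ s := by positivity
    simpa using this

lemma integrable_of_rpow {β : Type*} [MeasurableSpace β] {ρ : Measure β} [IsProbabilityMeasure ρ]
    {g : β → ℝ} {s : ℝ} (hs : 1 ≤ s) (hm : AEStronglyMeasurable g ρ) (h0 : ∀ x, 0 ≤ g x)
    (hg : Integrable (fun x => g x ^ s) ρ) : Integrable g ρ := by
  refine ((integrable_const 1).add hg).mono' hm (Eventually.of_forall fun x => ?_)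
  rw [Real.norm_of_nonneg (h0 x)]
  have h := h0 x
  have : 0 ≤ g x ^ s := by positivity
  rcases le_total (g x) 1 with h1 | h1
  · simp only [Pi.add_apply]; linarith
  · have h2 : g x ^ (1 : ℝ) ≤ g x ^ s := Real.rpow_le_rpow_of_exponent_le h1 hs
    rw [Real.rpow_one] at h2
    simp only [Pi.add_apply]; linarith

lemma integral_trunc {β : Type*} [MeasurableSpace β] {ρ : Measure β} [IsProbabilityMeasure ρ]
    {g : β → ℝ} {s M : ℝ} (hs : 1 ≤ s) (hs2 : s ≤ 2) (hM : 0 < M) (hm : Measurable g)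
    (h0 : ∀ x, 0 ≤ g x) (hg : Integrable (fun x => g x ^ s) ρ) :
    MemLp (fun x => trunc M (g x)) 2 ρ ∧
    ∫ x, (g x - trunc M (g x)) ∂ρ ≤ M ^ (1 - s) * ∫ x, g x ^ s ∂ρ ∧
    ∫ x, trunc M (g x) ^ 2 ∂ρ ≤ M ^ (2 - s) * ∫ x, g x ^ s ∂ρ := by
  have hgi := integrable_of_rpow hs hm.aestronglyMeasurable h0 hg
  have hmt : Measurable (fun x => trunc M (g x)) := (measurable_trunc M).comp hm
  have h2 : MemLp (fun x => trunc M (g x)) 2 ρ :=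
    (memLp_top_of_bound hmt.aestronglyMeasurable M (Eventually.of_forall fun x => by
      rw [Real.norm_of_nonneg (trunc_nonneg M (h0 x))]
      exact trunc_le_level hM.le _)).mono_exponent le_top
  refine ⟨h2, ?_, ?_⟩
  · rw [← integral_const_mul]
    exact integral_mono (hgi.sub (h2.integrable (by norm_num))) (hg.const_mul _)
      fun x => sub_trunc_le hM hs (h0 x)
  · rw [← integral_const_mul]
    exact integral_mono h2.integrable_sq (hg.const_mul _) fun x => sq_trunc_le hM hs hs2 (h0 x)

lemma integral_sq_sub_mean_le {β : Type*} [MeasurableSpace β] {ρ : Measure β}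
    [IsProbabilityMeasure ρ] {f : β → ℝ} (hf : MemLp f 2 ρ) :
    ∫ x, (f x - ∫ y, f y ∂ρ) ^ 2 ∂ρ ≤ ∫ x, f x ^ 2 ∂ρ := by
  set c := ∫ y, f y ∂ρ with hc
  have e : ∀ x, (f x - c) ^ 2 = f x ^ 2 + (-2 * c) * f x + c ^ 2 := fun x => by ring
  simp_rw [e]
  rw [integral_add₃ hf.integrable_sq ((hf.integrable (by norm_num)).const_mul _)
    (integrable_const _), integral_const_mul, ← hc]
  simp
  nlinarith [sq_nonneg c]

/-- Only a moment of order `s ≤ 2` is available, so `g` is cut at level `M`. The discarded part is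
estimated in `L¹`, once for its sum and once for its mean, and the bounded part in `L²` through its
variance. -/
theorem integral_abs_sum_sub_le {g : α → ℝ} {s M : ℝ} (hs : 1 ≤ s) (hs2 : s ≤ 2) (hM : 0 < M)
    (hm : Measurable g) (h0 : ∀ x, 0 ≤ g x) (hg : Integrable (fun x => g x ^ s) π) (n : ℕ) :
    ∫ w, |∑ k, g (w k) - n * ∫ x, g x ∂π| ∂(Measure.pi fun _ : Fin n => π)
      ≤ 2 * (n * (M ^ (1 - s) * ∫ x, g x ^ s ∂π)) + √(n * (M ^ (2 - s) * ∫ x, g x ^ s ∂π)) := by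
  obtain ⟨ht2, hd, hsq⟩ := integral_trunc hs hs2 hM hm h0 hg
  have hgi := integrable_of_rpow hs hm.aestronglyMeasurable h0 hg
  have hti := ht2.integrable (by norm_num)
  set θ := ∫ x, g x ∂π with hθ
  set θ' := ∫ x, trunc M (g x) ∂π with hθ'
  set m := ∫ x, g x ^ s ∂π with hmdef
  have hdθ : θ - θ' ≤ M ^ (1 - s) * m := by rwa [hθ, hθ', ← integral_sub hgi hti]
  have hdθ0 : 0 ≤ θ - θ' := by
    rw [hθ, hθ', ← integral_sub hgi hti]
    exact integral_nonneg fun x => sub_nonneg.2 (trunc_le M (h0 x))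
  have hc2 : MemLp (fun x => trunc M (g x) - θ') 2 π := ht2.sub (memLp_const _)
  have hc0 : ∫ x, (trunc M (g x) - θ') ∂π = 0 := by
    rw [integral_sub hti (integrable_const _)]; simp [hθ']
  set A : (Fin n → α) → ℝ := fun w => ∑ k, (g (w k) - trunc M (g (w k))) with hA
  set B : (Fin n → α) → ℝ := fun w => ∑ k, (trunc M (g (w k)) - θ') with hB
  have hB2 : MemLp B 2 (Measure.pi fun _ : Fin n => π) := by
    simpa only [one_mul] using memLp_sum_mul hc2 (fun _ : Fin n => (1 : ℝ))
  have hAi : Integrable A (Measure.pi fun _ : Fin n => π) :=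
    integrable_finsetSum _ fun k _ => (memLp_eval (memLp_one_iff_integrable.2 (hgi.sub hti))
      k).integrable le_rfl
  have hAe : ∫ w, A w ∂(Measure.pi fun _ : Fin n => π) = n * (θ - θ') := by
    rw [integral_finsetSum]
    · have : ∀ k : Fin n, ∫ w, (g (w k) - trunc M (g (w k))) ∂(Measure.pi fun _ : Fin n => π)
          = θ - θ' := fun k => by
        rw [integral_eval (f := fun x => g x - trunc M (g x)) (hgi.sub hti).1 k,
          integral_sub hgi hti]
      simp [this, mul_sub]
    · exact fun k _ => (memLp_eval (memLp_one_iff_integrable.2 (hgi.sub hti)) k).integrable le_rfl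
  have hBe : ∫ w, |B w| ∂(Measure.pi fun _ : Fin n => π) ≤ √(n * (M ^ (2 - s) * m)) := by
    refine (abs_integral_le_sqrt hB2).trans (Real.sqrt_le_sqrt ?_)
    have := integral_sq_sum_mul hc2 hc0 (fun _ : Fin n => (1 : ℝ))
    simp only [one_mul, one_pow, Finset.sum_const, Finset.card_univ, Fintype.card_fin,
      nsmul_eq_mul, mul_one] at this
    rw [hB, this]
    gcongr
    exact (integral_sq_sub_mean_le ht2).trans hsq
  have key : ∀ w : Fin n → α, |∑ k, g (w k) - n * θ| ≤ A w + |B w| + n * (θ - θ') := by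
    intro w
    have e : ∑ k, g (w k) - n * θ = A w + B w - n * (θ - θ') := by
      simp only [hA, hB, Finset.sum_sub_distrib]
      simp; ring
    have hA0 : 0 ≤ A w := Finset.sum_nonneg fun k _ => sub_nonneg.2 (trunc_le M (h0 _))
    have hn : 0 ≤ n * (θ - θ') := by positivity
    rw [e, abs_le]
    constructor <;> linarith [neg_abs_le (B w), le_abs_self (B w)]
  have hBi := (hB2.integrable (by norm_num)).abs
  calc _ ≤ ∫ w, (A w + |B w| + n * (θ - θ')) ∂(Measure.pi fun _ : Fin n => π) :=
        integral_mono_of_nonneg (Eventually.of_forall fun w => abs_nonneg _)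
          ((hAi.add hBi).add (integrable_const _)) (Eventually.of_forall key)
    _ = n * (θ - θ') + ∫ w, |B w| ∂(Measure.pi fun _ : Fin n => π) + n * (θ - θ') := by
        rw [integral_add₃ hAi hBi (integrable_const _), hAe]; simp
    _ ≤ _ := by
        have : n * (θ - θ') ≤ n * (M ^ (1 - s) * m) := by gcongr
        linarith

/-- The same truncation for pairs. The truncated kernel is split by Hoeffding's decomposition into a
degenerate part `B` and a sum `C` of one-point projections, which is of the larger order `n^3` in
variance. -/
theorem integral_abs_offSum_sub_le {K : α → α → ℝ} {s M : ℝ} (hs : 1 ≤ s) (hs2 : s ≤ 2)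
    (hM : 0 < M) (hm : Measurable (fun p : α × α => K p.1 p.2)) (h0 : ∀ x y, 0 ≤ K x y)
    (hsymm : ∀ x y, K x y = K y x)
    (hK : Integrable (fun p : α × α => K p.1 p.2 ^ s) (π.prod π)) {n : ℕ} (hn : 1 ≤ n) :
    ∫ w, |(offSum fun k l => K (w k) (w l)) - n * (n - 1) * ∫ p, K p.1 p.2 ∂(π.prod π)|
        ∂(Measure.pi fun _ : Fin n => π)
      ≤ 2 * (n * (n - 1) * (M ^ (1 - s) * ∫ p, K p.1 p.2 ^ s ∂(π.prod π)))
        + √(1032 * n ^ 3 * (M ^ (2 - s) * ∫ p, K p.1 p.2 ^ s ∂(π.prod π))) := by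
  have hn1 : (1 : ℝ) ≤ n := by exact_mod_cast hn
  obtain ⟨ht2, hd, hsq⟩ := integral_trunc (g := fun p : α × α => K p.1 p.2) hs hs2 hM hm
    (fun p => h0 _ _) hK
  have hKi := integrable_of_rpow (g := fun p : α × α => K p.1 p.2) hs hm.aestronglyMeasurable
    (fun p => h0 _ _) hK
  have hti := ht2.integrable (by norm_num)
  set T : α → α → ℝ := fun x y => trunc M (K x y) with hT
  have hTm : Measurable (fun p : α × α => T p.1 p.2) := (measurable_trunc M).comp hm
  have hTs : ∀ z, MemLp (T z) 2 π := fun z =>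
    (memLp_top_of_bound (hTm.comp measurable_prodMk_left).aestronglyMeasurable M
      (Eventually.of_forall fun x => by
        show ‖T z x‖ ≤ M
        rw [Real.norm_of_nonneg (trunc_nonneg M (h0 _ _))]
        exact trunc_le_level hM.le _)).mono_exponent le_top
  have hTD : DegenKernel π (dblCenter π T) :=
    degenKernel_dblCenter hTm (fun z w => by simp only [hT, hsymm z w]) hTs ht2
  set θ := ∫ p, K p.1 p.2 ∂(π.prod π) with hθ
  set θ' := ∫ p, T p.1 p.2 ∂(π.prod π) with hθ'
  set m := ∫ p, K p.1 p.2 ^ s ∂(π.prod π) with hmdef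
  have hdθ : θ - θ' ≤ M ^ (1 - s) * m := by rwa [hθ, hθ', ← integral_sub hKi hti]
  have hdθ0 : 0 ≤ θ - θ' := by
    rw [hθ, hθ', ← integral_sub hKi hti]
    exact integral_nonneg fun x => sub_nonneg.2 (trunc_le M (h0 _ _))
  set a : α → ℝ := fun z => ∫ u, T z u ∂π with ha
  have e2 : (2 : ENNReal) = ENNReal.ofReal 2 := by simp
  have hT2 := ht2
  rw [e2] at hT2 hTs
  obtain ⟨ha2, hab⟩ := memLp_integral_slice (by norm_num) hTm hTs hT2
  have hDb := (memLp_dblCenter (by norm_num) (by norm_num) hTm hTs hT2).2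
  simp only [Real.rpow_two, sq_abs] at hab hDb
  rw [← e2] at ha2
  have hae : ∫ z, a z ∂π = θ' := (integral_prod _ hti).symm
  have hc2 : MemLp (fun z => a z - θ') 2 π := ha2.sub (memLp_const _)
  have hc0 : ∫ x, (a x - θ') ∂π = 0 := by
    rw [integral_sub (ha2.integrable (by norm_num)) (integrable_const _), hae]; simp
  have hcv : ∫ x, (a x - θ') ^ 2 ∂π ≤ M ^ (2 - s) * m := by
    rw [← hae]
    exact (integral_sq_sub_mean_le ha2).trans (hab.trans hsq)
  set ρ := Measure.pi fun _ : Fin n => π with hρ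
  set A : (Fin n → α) → ℝ := fun w => offSum fun k l => (K (w k) (w l) - T (w k) (w l)) with hA
  set B : (Fin n → α) → ℝ := fun w => offSum fun k l => dblCenter π T (w k) (w l) with hB
  set C : (Fin n → α) → ℝ := fun w => ∑ k, 2 * ((n : ℝ) - 1) * (a (w k) - θ') with hC
  have hAi : Integrable A ρ := by
    have := memLp_offSum (H := fun x y => K x y - T x y)
      (memLp_one_iff_integrable.2 (hKi.sub hti)) (fun _ _ : Fin n => (1 : ℝ))
    simp only [one_mul] at this
    exact this.integrable le_rfl
  have hAe : ∫ w, A w ∂ρ = n * (n - 1) * (θ - θ') := by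
    rw [hA, integral_offSum (H := fun x y => K x y - T x y) (hKi.sub hti), integral_sub hKi hti]
  have hB2 : MemLp B 2 ρ := by
    simpa only [one_mul] using memLp_offSum hTD.memLp (fun _ _ : Fin n => (1 : ℝ))
  have hC2 : MemLp C 2 ρ := memLp_sum_mul hc2 (fun _ : Fin n => 2 * ((n : ℝ) - 1))
  have hBsq : ∫ w, B w ^ 2 ∂ρ ≤ 512 * n ^ 3 * (M ^ (2 - s) * m) := by
    have h := hTD.integral_sq_offSum_le (fun _ _ : Fin n => (1 : ℝ))
    simp only [one_mul, one_pow, offSum_const, mul_one] at h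
    refine h.trans ?_
    have h5 : ∫ p, dblCenter π T p.1 p.2 ^ 2 ∂(π.prod π) ≤ 256 * (M ^ (2 - s) * m) := by
      linarith
    have h6 : 0 ≤ M ^ (2 - s) * m := (integral_nonneg fun p => sq_nonneg _).trans hsq
    have h7 : 2 * ((n : ℝ) * (n - 1)) ≤ 2 * n ^ 3 := by nlinarith [sq_nonneg ((n : ℝ) - 1)]
    have h8 : 0 ≤ 2 * ((n : ℝ) * (n - 1)) := by nlinarith
    calc _ ≤ 2 * ((n : ℝ) * (n - 1)) * (256 * (M ^ (2 - s) * m)) := by gcongr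
      _ ≤ 2 * n ^ 3 * (256 * (M ^ (2 - s) * m)) := by gcongr
      _ = _ := by ring
  have hCsq : ∫ w, C w ^ 2 ∂ρ ≤ 4 * n ^ 3 * (M ^ (2 - s) * m) := by
    rw [hC, integral_sq_sum_mul hc2 hc0]
    simp only [Finset.sum_const, Finset.card_univ, Fintype.card_fin, nsmul_eq_mul]
    have h6 : 0 ≤ M ^ (2 - s) * m := (integral_nonneg fun p => sq_nonneg _).trans hsq
    have h7 : (n : ℝ) * (2 * ((n : ℝ) - 1)) ^ 2 ≤ 4 * n ^ 3 := by nlinarith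
    calc _ ≤ (n : ℝ) * (2 * ((n : ℝ) - 1)) ^ 2 * (M ^ (2 - s) * m) := by gcongr
      _ ≤ _ := by gcongr
  -- From `(B + C)² ≤ 2B² + 2C²`: `1032 = 2 (512 + 4)`.
  have hBC : ∫ w, |B w + C w| ∂ρ ≤ √(1032 * n ^ 3 * (M ^ (2 - s) * m)) := by
    refine (abs_integral_le_sqrt (hB2.add hC2)).trans (Real.sqrt_le_sqrt ?_)
    have h := integral_mono (hB2.add hC2).integrable_sq
      ((hB2.integrable_sq.const_mul 2).add (hC2.integrable_sq.const_mul 2)) (fun w => by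
        show (B w + C w) ^ 2 ≤ 2 * B w ^ 2 + 2 * C w ^ 2
        nlinarith [sq_nonneg (B w - C w)])
    simp only [Pi.add_apply] at h ⊢
    rw [integral_add (hB2.integrable_sq.const_mul 2) (hC2.integrable_sq.const_mul 2),
      integral_const_mul, integral_const_mul] at h
    linarith
  have key : ∀ w : Fin n → α, |(offSum fun k l => K (w k) (w l)) - n * (n - 1) * θ|
      ≤ A w + |B w + C w| + n * (n - 1) * (θ - θ') := by
    intro w
    have hoff : (offSum fun k l : Fin n => (a (w k) + a (w l))) = 2 * (n - 1) * ∑ k, a (w k) := by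
      have h := sum_eq_diag_add_offSum (fun k l : Fin n => (a (w k) + a (w l)))
      simp only [Finset.sum_add_distrib, Finset.sum_const, Finset.card_univ, Fintype.card_fin,
        nsmul_eq_mul, ← Finset.mul_sum] at h
      linarith
    have e1 : (offSum fun k l => K (w k) (w l)) = A w + offSum fun k l => T (w k) (w l) := by
      rw [hA, ← offSum_add]; congr 1; ext k l; ring
    have e3 : (offSum fun k l => T (w k) (w l))
        = B w + (offSum fun k l : Fin n => (a (w k) + a (w l))) + n * (n - 1) * (-θ') := by
      rw [hB, ← offSum_const, ← offSum_add, ← offSum_add]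
      congr 1; ext k l
      simp only [dblCenter, ha, hθ']; ring
    have e4 : C w = 2 * (n - 1) * ∑ k, a (w k) - 2 * (n * (n - 1)) * θ' := by
      rw [hC]
      simp only [← Finset.mul_sum, Finset.sum_sub_distrib]
      simp; ring
    have e : (offSum fun k l => K (w k) (w l)) - n * (n - 1) * θ
        = A w + (B w + C w) - n * (n - 1) * (θ - θ') := by
      rw [e1, e3, hoff, e4]; ring
    have hA0 : 0 ≤ A w := offSum_nonneg fun k l => sub_nonneg.2 (trunc_le M (h0 _ _))
    have hn' : 0 ≤ n * (n - 1) * (θ - θ') :=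
      mul_nonneg (mul_nonneg (by linarith) (by linarith)) hdθ0
    rw [e, abs_le]
    constructor <;> linarith [neg_abs_le (B w + C w), le_abs_self (B w + C w)]
  have hBi := ((hB2.add hC2).integrable (by norm_num)).abs
  have hnn : 0 ≤ (n : ℝ) * (n - 1) := mul_nonneg (by linarith) (by linarith)
  calc _ ≤ ∫ w, (A w + |B w + C w| + n * (n - 1) * (θ - θ')) ∂ρ :=
        integral_mono_of_nonneg (Eventually.of_forall fun w => abs_nonneg _)
          ((hAi.add hBi).add (integrable_const _)) (Eventually.of_forall key)
    _ = n * (n - 1) * (θ - θ') + ∫ w, |B w + C w| ∂ρ + n * (n - 1) * (θ - θ') := by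
        have := integral_add₃ hAi hBi (integrable_const (n * (n - 1) * (θ - θ')))
        simp only [Pi.add_apply] at this
        rw [this, hAe]; simp
    _ ≤ _ := by
        have : n * (n - 1) * (θ - θ') ≤ n * (n - 1) * (M ^ (1 - s) * m) := by gcongr
        linarith

end DblCenter

/-! ### Explicit error in the degenerate central limit theorem -/

section CLTBound

variable {α : Type*} [MeasurableSpace α] {π : Measure α} [IsProbabilityMeasure π]

lemma integral_abs_row_rpow_le {H : α → α → ℝ} (hH : DegenKernel π H) {r : ℝ} (h2 : 2 < r)
    (h3 : r ≤ 3) (hr : MemLp (fun p : α × α => H p.1 p.2) (ENNReal.ofReal r) (π.prod π)) (n : ℕ) :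
    ∫ p, |∑ k, H p.1 (p.2 k)| ^ r ∂(π.prod (Measure.pi fun _ : Fin n => π))
      ≤ 22 * (n : ℝ) ^ (r / 2) * ∫ p, |H p.1 p.2| ^ r ∂(π.prod π) := by
  have hr0 : 0 < r := by linarith
  have hR : MemLp (fun p : α × (Fin n → α) => ∑ k, H p.1 (p.2 k)) (ENNReal.ofReal r)
      (π.prod (Measure.pi fun _ : Fin n => π)) := by
    simpa only [one_mul] using memLp_row hr (fun _ : Fin n => (1 : ℝ))
  have i1 := integrable_abs_rpow hr0 hR
  have i2 := integrable_abs_rpow hr0 hr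
  rw [integral_prod _ i1, integral_prod _ i2, ← integral_const_mul]
  refine integral_mono_ae i1.integral_prod_left (i2.integral_prod_left.const_mul _) ?_
  filter_upwards [i2.prod_right_ae] with u hu
  refine integral_abs_sum_rpow_le h2 h3 ?_ (hH.mean u) n
  exact memLp_of_integrable_abs_rpow hr0 (hH.slice u).1 hu

/-- The diagonal of the iterated kernel has mean `E H²` and, by Jensen, `s`-th moment at most
`E|H|^(2s)`, so the truncated weak law applies to it. The off-diagonal part is degenerate and is
bounded in `L²`. -/
lemma integral_abs_condVar_sub_le {H : α → α → ℝ} (hH : DegenKernel π H) {s M : ℝ} (hs : 1 ≤ s)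
    (hs2 : s ≤ 3 / 2) (hM : 0 < M)
    (hr : MemLp (fun p : α × α => H p.1 p.2) (ENNReal.ofReal (2 * s)) (π.prod π)) (n : ℕ) :
    ∫ w, |∫ u, (∑ k, H u (w k)) ^ 2 ∂π - n * ∫ p, H p.1 p.2 ^ 2 ∂(π.prod π)|
        ∂(Measure.pi fun _ : Fin n => π)
      ≤ 2 * (n * (M ^ (1 - s) * ∫ p, |H p.1 p.2| ^ (2 * s) ∂(π.prod π)))
        + √(n * (M ^ (2 - s) * ∫ p, |H p.1 p.2| ^ (2 * s) ∂(π.prod π)))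
        + √(2 * (n * (n - 1)) * ∫ p, iterKernel π H p.1 p.2 ^ 2 ∂(π.prod π)) := by
  have hr0 : 0 < 2 * s := by linarith
  have hG := hH.iter
  set g : α → ℝ := fun z => iterKernel π H z z with hg
  have hg0 : ∀ z, 0 ≤ g z := fun z => integral_nonneg fun u => mul_self_nonneg _
  have hgm : Measurable g := hG.meas.comp (measurable_id.prodMk measurable_id)
  have i2 := integrable_abs_rpow hr0 hr
  have hle : ∀ᵐ z ∂π, g z ^ s ≤ ∫ u, |H z u| ^ (2 * s) ∂π := by
    filter_upwards [i2.prod_right_ae] with z hz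
    have e : ∀ u, (H z u * H z u) ^ s = |H z u| ^ (2 * s) := fun u => by
      rw [← abs_mul_abs_self, ← sq, ← Real.rpow_natCast, ← Real.rpow_mul (abs_nonneg _)]
      push_cast; rfl
    have := rpow_integral_le (μ := π) (f := fun u => H z u * H z u) hs
      (fun u => mul_self_nonneg _) ((hH.slice z).integrable_mul (hH.slice z))
      (by simp_rw [e]; exact hz)
    simp_rw [e] at this
    exact this
  have hgi : Integrable (fun z => g z ^ s) π := by
    refine i2.integral_prod_left.mono'
      ((hgm.pow_const s).aestronglyMeasurable) ?_
    filter_upwards [hle] with z hz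
    have := hg0 z
    rwa [Real.norm_of_nonneg (by positivity)]
  have hgm' : ∫ z, g z ^ s ∂π ≤ ∫ p, |H p.1 p.2| ^ (2 * s) ∂(π.prod π) := by
    rw [integral_prod _ i2]
    exact integral_mono_ae hgi i2.integral_prod_left hle
  have h1 := integral_abs_sum_sub_le hs (by linarith) hM hgm hg0 hgi n
  rw [hg, integral_iterKernel_diag hH, ← hg] at h1
  have hB2 : MemLp (fun w : Fin n → α => offSum fun k l => iterKernel π H (w k) (w l)) 2
      (Measure.pi fun _ => π) := by
    simpa only [one_mul] using memLp_offSum hG.memLp (fun _ _ : Fin n => (1 : ℝ))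
  have hB : ∫ w, |offSum fun k l => iterKernel π H (w k) (w l)| ∂(Measure.pi fun _ : Fin n => π)
      ≤ √(2 * (n * (n - 1)) * ∫ p, iterKernel π H p.1 p.2 ^ 2 ∂(π.prod π)) := by
    refine (abs_integral_le_sqrt hB2).trans (Real.sqrt_le_sqrt ?_)
    have h := hG.integral_sq_offSum_le (fun _ _ : Fin n => (1 : ℝ))
    simpa only [one_mul, one_pow, offSum_const, mul_one] using h
  set v := ∫ p, H p.1 p.2 ^ 2 ∂(π.prod π) with hv
  have hAi : Integrable (fun w : Fin n → α => |∑ k, g (w k) - n * v|) (Measure.pi fun _ => π) := by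
    have hgint : Integrable g π := integrable_of_rpow hs hgm.aestronglyMeasurable hg0 hgi
    have : Integrable (fun w : Fin n → α => ∑ k, g (w k)) (Measure.pi fun _ => π) :=
      integrable_finsetSum _ fun k _ =>
        (memLp_eval (memLp_one_iff_integrable.2 hgint) k).integrable le_rfl
    exact (this.sub (integrable_const _)).abs
  have hBi := (hB2.integrable (by norm_num)).abs
  have key : ∀ w : Fin n → α, |∫ u, (∑ k, H u (w k)) ^ 2 ∂π - n * v| ≤
      |∑ k, g (w k) - n * v| + |offSum fun k l => iterKernel π H (w k) (w l)| := fun w => by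
    rw [integral_sq_row_left hH w]
    refine le_trans (le_of_eq ?_) (abs_add_le _ _)
    congr 1; ring
  refine (integral_mono_of_nonneg (Eventually.of_forall fun w => abs_nonneg _) (hAi.add hBi)
    (Eventually.of_forall key)).trans ?_
  simp only [Pi.add_apply]
  rw [integral_add hAi hBi]
  refine add_le_add (h1.trans ?_) hB
  gcongr

/-- The Lyapunov-type moment ratio `E |H|^(2+2τ) / (E H²)^(1+τ)`. -/
noncomputable def momRatio (π : Measure α) (H : α → α → ℝ) (τ : ℝ) : ℝ :=
  (∫ p, |H p.1 p.2| ^ (2 + 2 * τ) ∂(π.prod π)) / (∫ p, H p.1 p.2 ^ 2 ∂(π.prod π)) ^ (1 + τ)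

/-- The spectral ratio `E G(Z₁,Z₂)² / (E H²)²` with `G` the iterated kernel. -/
noncomputable def specRatio (π : Measure α) (H : α → α → ℝ) : ℝ :=
  (∫ p, iterKernel π H p.1 p.2 ^ 2 ∂(π.prod π)) / (∫ p, H p.1 p.2 ^ 2 ∂(π.prod π)) ^ 2

/-- With `N = n + 1` the normalization reads `n v = 2/N`, and all terms reduce to `A = N^(-τ) ·
momRatio`, `specRatio` and `1/N`. The coefficient `92` is `88 = 22 · 4` from the row moment plus `4`
from the truncation bias. -/
lemma cltError_le {H : α → α → ℝ} (hH : DegenKernel π H) {τ : ℝ} (hτ : 0 < τ) (hτ2 : τ ≤ 1 / 2)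
    (hr : MemLp (fun p : α × α => H p.1 p.2) (ENNReal.ofReal (2 + 2 * τ)) (π.prod π)) {n : ℕ}
    (hn : 1 ≤ n) (hv : (n + 1) * n * ∫ p, H p.1 p.2 ^ 2 ∂(π.prod π) = 2) :
    cltError π H (2 + 2 * τ) n ≤ 92 * (((n + 1 : ℕ) : ℝ) ^ (-τ) * momRatio π H τ)
      + 2 * √(((n + 1 : ℕ) : ℝ) ^ (-τ) * momRatio π H τ) + 2 * √(specRatio π H)
      + 2 * √(1 / ((n + 1 : ℕ) : ℝ)) := by
  have hn1 : (1 : ℝ) ≤ n := by exact_mod_cast hn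
  have hn0 : (0 : ℝ) < n := by linarith
  unfold momRatio specRatio cltError
  set v := ∫ p, H p.1 p.2 ^ 2 ∂(π.prod π) with hvdef
  set m := ∫ p, |H p.1 p.2| ^ (2 + 2 * τ) ∂(π.prod π) with hm
  set g2 := ∫ p, iterKernel π H p.1 p.2 ^ 2 ∂(π.prod π) with hg2
  have hm0 : 0 ≤ m := integral_nonneg fun p => by positivity
  have hg0 : 0 ≤ g2 := integral_nonneg fun p => by positivity
  have hvpos : 0 < v := by
    by_contra h
    push Not at h
    have : ((n : ℝ) + 1) * n * v ≤ 0 := mul_nonpos_of_nonneg_of_nonpos (by positivity) h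
    linarith
  set N : ℝ := (n : ℝ) + 1 with hN
  have hNc : ((n + 1 : ℕ) : ℝ) = N := by push_cast; rfl
  rw [hNc]
  have hN0 : 0 < N := by positivity
  have hN2 : 2 ≤ N := by linarith
  have hnv : n * v = 2 / N := by field_simp; linarith
  set A := N ^ (-τ) * (m / v ^ (1 + τ)) with hA
  have hA0 : 0 ≤ A := by positivity
  have hmA : m = A * N ^ τ * v ^ (1 + τ) := by
    rw [hA, Real.rpow_neg hN0.le]
    field_simp
  have h1 := integral_abs_row_rpow_le hH (r := 2 + 2 * τ) (by linarith) (by linarith) hr n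
  have e2s : 2 + 2 * τ = 2 * (1 + τ) := by ring
  -- Truncating at the mean `n v` of the conditional variance expresses both the bias and the
  -- variance term through `A`.
  have h2 := integral_abs_condVar_sub_le hH (s := 1 + τ) (M := n * v) (by linarith) (by linarith)
    (by positivity) (e2s ▸ hr) n
  rw [← e2s, ← hm, ← hvdef, ← hg2] at h2
  rw [← hm, show (2 + 2 * τ) / 2 = 1 + τ by ring] at h1
  -- moment term
  have two_rpow : (2 : ℝ) ^ τ ≤ 2 := by
    calc (2 : ℝ) ^ τ ≤ 2 ^ (1 : ℝ) := Real.rpow_le_rpow_of_exponent_le (by norm_num) (by linarith)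
      _ = 2 := by norm_num
  have t1 : N * ((n : ℝ) ^ (1 + τ) * m) ≤ 4 * A := by
    have e : (n : ℝ) ^ (1 + τ) * v ^ (1 + τ) = 2 / N * (2 ^ τ / N ^ τ) := by
      rw [← Real.mul_rpow hn0.le hvpos.le, hnv, Real.rpow_add (by positivity), Real.rpow_one,
        Real.div_rpow (by norm_num) hN0.le]
    have : N * ((n : ℝ) ^ (1 + τ) * m) = 2 * 2 ^ τ * A := by
      calc N * ((n : ℝ) ^ (1 + τ) * m)
          = N * A * N ^ τ * ((n : ℝ) ^ (1 + τ) * v ^ (1 + τ)) := by rw [hmA]; ring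
        _ = _ := by rw [e]; field_simp
    rw [this]
    nlinarith
  have hNn : N ^ τ ≤ 2 * (n : ℝ) ^ τ := by
    calc N ^ τ ≤ (2 * n) ^ τ := Real.rpow_le_rpow hN0.le (by linarith) hτ.le
      _ = 2 ^ τ * (n : ℝ) ^ τ := Real.mul_rpow (by norm_num) hn0.le
      _ ≤ _ := by gcongr
  have hbase : N * (n * ((n * v) ^ (-τ) * m)) ≤ 4 * A := by
    have e : (n * v) ^ (-τ) * v ^ (1 + τ) = v * ((n : ℝ) ^ τ)⁻¹ := by
      rw [Real.mul_rpow hn0.le hvpos.le, Real.rpow_neg hn0.le, Real.rpow_neg hvpos.le,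
        Real.rpow_add hvpos, Real.rpow_one]
      field_simp
    have : N * (n * ((n * v) ^ (-τ) * m)) = 2 * A * (N ^ τ * ((n : ℝ) ^ τ)⁻¹) := by
      calc N * (n * ((n * v) ^ (-τ) * m))
          = N * n * A * N ^ τ * ((n * v) ^ (-τ) * v ^ (1 + τ)) := by rw [hmA]; ring
        _ = (N * n * v) * A * (N ^ τ * ((n : ℝ) ^ τ)⁻¹) := by rw [e]; ring
        _ = _ := by rw [hv]
    rw [this]
    have : N ^ τ * ((n : ℝ) ^ τ)⁻¹ ≤ 2 := by
      rw [← div_eq_mul_inv, div_le_iff₀ (by positivity)]; exact hNn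
    nlinarith
  have four_sqrt : ∀ x : ℝ, 4 * √x = √(16 * x) := fun x => by
    rw [Real.sqrt_mul (by norm_num), show (16 : ℝ) = 4 ^ 2 by norm_num, Real.sqrt_sq (by norm_num)]
  have t2 : N * √(n * ((n * v) ^ (2 - (1 + τ)) * m)) ≤ 4 * √A := by
    have e : N * √(n * ((n * v) ^ (2 - (1 + τ)) * m))
        = √(2 * (N * (n * ((n * v) ^ (-τ) * m)))) := by
      rw [← Real.sqrt_sq hN0.le, ← Real.sqrt_mul (by positivity), Real.sqrt_sq hN0.le]
      congr 1
      rw [show 2 - (1 + τ) = 1 + -τ by ring, Real.rpow_add (by positivity), Real.rpow_one]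
      calc N ^ 2 * (n * (n * v * (n * v) ^ (-τ) * m))
          = (N * n * v) * (N * (n * ((n * v) ^ (-τ) * m))) := by ring
        _ = _ := by rw [hv]
    rw [e, four_sqrt]
    exact Real.sqrt_le_sqrt (by linarith)
  have t3 : N * √(2 * (n * (n - 1)) * g2) ≤ 4 * √(g2 / v ^ 2) := by
    rw [four_sqrt]
    have : N = √(N ^ 2) := (Real.sqrt_sq hN0.le).symm
    conv_lhs => rw [this]
    rw [← Real.sqrt_mul (by positivity)]
    refine Real.sqrt_le_sqrt ?_
    have h5 : N ^ 2 * (2 * (n * (n - 1))) ≤ 2 * (N * n) ^ 2 := by nlinarith [sq_nonneg N]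
    have h6 : (N * n) ^ 2 * v ^ 2 = 4 := by rw [← mul_pow, hv]; norm_num
    have h7 : (N * n) ^ 2 = 4 / v ^ 2 := by field_simp; linarith
    calc N ^ 2 * (2 * (n * (n - 1)) * g2) = N ^ 2 * (2 * (n * (n - 1))) * g2 := by ring
      _ ≤ 2 * (N * n) ^ 2 * g2 := by gcongr
      _ = 8 * (g2 / v ^ 2) := by rw [h7]; ring
      _ ≤ _ := by gcongr; norm_num
  have t4 : N * (n * v * √(n * v)) ≤ 4 * √(1 / N) := by
    have e : N * (n * v * √(n * v)) = 2 * √(2 / N) := by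
      rw [hnv]; field_simp
    rw [e, show 2 / N = 2 * (1 / N) by ring, Real.sqrt_mul (by norm_num)]
    have : √2 ≤ 2 := by
      rw [Real.sqrt_le_left (by norm_num)]; norm_num
    calc 2 * (√2 * √(1 / N)) ≤ 2 * (2 * √(1 / N)) := by gcongr
      _ = _ := by ring
  have ep : (1 : ℝ) - (1 + τ) = -τ := by ring
  rw [ep] at h2
  have h1' := mul_le_mul_of_nonneg_left h1 hN0.le
  have h2' := mul_le_mul_of_nonneg_left h2 hN0.le
  linarith

lemma DegenKernel.const_mul {H : α → α → ℝ} (hH : DegenKernel π H) (c : ℝ) :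
    DegenKernel π (fun z w => c * H z w) where
  meas := hH.meas.const_mul c
  symm z w := by rw [hH.symm]
  slice z := (hH.slice z).const_mul c
  mean z := by rw [integral_const_mul, hH.mean, mul_zero]
  memLp := hH.memLp.const_mul c

lemma momRatio_const_mul (H : α → α → ℝ) {τ c : ℝ} (hc : 0 < c) :
    momRatio π (fun z w => c * H z w) τ = momRatio π H τ := by
  unfold momRatio
  simp_rw [abs_mul, mul_pow, Real.mul_rpow (abs_nonneg _) (abs_nonneg _)]
  rw [integral_const_mul, integral_const_mul, Real.mul_rpow (by positivity)
    (integral_nonneg fun p => sq_nonneg _), abs_of_pos hc, ← Real.rpow_natCast,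
    ← Real.rpow_mul hc.le]
  have e : ((2 : ℕ) : ℝ) * (1 + τ) = 2 + 2 * τ := by push_cast; ring
  rw [e, mul_div_mul_left _ _ (by positivity)]

lemma specRatio_const_mul (H : α → α → ℝ) {c : ℝ} (hc : 0 < c) :
    specRatio π (fun z w => c * H z w) = specRatio π H := by
  unfold specRatio
  have e : ∀ z w, iterKernel π (fun z w => c * H z w) z w = c ^ 2 * iterKernel π H z w :=
    fun z w => by
      unfold iterKernel
      rw [← integral_const_mul]
      congr 1 with u; ring
  simp_rw [e, mul_pow]
  rw [integral_const_mul, integral_const_mul, mul_pow, mul_div_mul_left _ _ (by positivity)]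

/-- Non-asymptotic central limit theorem for degenerate `U`-statistics of order two. -/
theorem norm_charFun_offSum_sub_gaussian_le {H : α → α → ℝ} (hH : DegenKernel π H) {τ : ℝ}
    (hτ : 0 < τ) (hτ2 : τ ≤ 1 / 2)
    (hr : MemLp (fun p : α × α => H p.1 p.2) (ENNReal.ofReal (2 + 2 * τ)) (π.prod π)) {n : ℕ}
    (hn : 2 ≤ n) (hv : 0 < ∫ p, H p.1 p.2 ^ 2 ∂(π.prod π)) (t : ℝ) :
    ‖∫ w, Complex.exp ((t * ((offSum fun k l => H (w k) (w l))
          / √(2 * (n * (n - 1)) * ∫ p, H p.1 p.2 ^ 2 ∂(π.prod π))) : ℝ) * Complex.I)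
        ∂(Measure.pi fun _ : Fin n => π) - Real.exp (-t ^ 2 / 2)‖
      ≤ |t| * (1 + t ^ 2) * (92 * ((n : ℝ) ^ (-τ) * momRatio π H τ)
      + 2 * √((n : ℝ) ^ (-τ) * momRatio π H τ) + 2 * √(specRatio π H) + 2 * √(1 / (n : ℝ))) := by
  obtain ⟨m, rfl⟩ : ∃ m, n = m + 1 := ⟨n - 1, by omega⟩
  have hm1 : 1 ≤ m := by omega
  have hm : (1 : ℝ) ≤ m := by exact_mod_cast hm1
  set v := ∫ p, H p.1 p.2 ^ 2 ∂(π.prod π) with hvdef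
  have hpos : 0 < 2 * (((m + 1 : ℕ) : ℝ) * (((m + 1 : ℕ) : ℝ) - 1)) * v := by
    push_cast
    have : (0 : ℝ) < (m + 1) * (m + 1 - 1) := by nlinarith
    positivity
  set a := √(2 * (((m + 1 : ℕ) : ℝ) * (((m + 1 : ℕ) : ℝ) - 1)) * v) with ha
  have ha0 : 0 < a := Real.sqrt_pos.2 hpos
  have ha2 : a ^ 2 = 2 * (((m + 1 : ℕ) : ℝ) * (((m + 1 : ℕ) : ℝ) - 1)) * v :=
    Real.sq_sqrt hpos.le
  have hc : 0 < 2 * a⁻¹ := by positivity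
  -- The factor `2` compensates the `1/2` in the statistic of the previous theorem; both ratios are
  -- invariant under scaling.
  have hK := hH.const_mul (2 * a⁻¹)
  have hvK : ((m : ℝ) + 1) * m * ∫ p, (2 * a⁻¹ * H p.1 p.2) ^ 2 ∂(π.prod π) = 2 := by
    simp_rw [mul_pow]
    rw [integral_const_mul, ← hvdef, inv_pow, ha2]
    push_cast
    have : (m : ℝ) ≠ 0 := by linarith
    field_simp
    ring_nf
    exact mul_inv_cancel₀ this
  have h := norm_charFun_sub_gaussian_le hK (r := 2 + 2 * τ) (by linarith) (by linarith)
    (hr.const_mul _) hvK t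
  have h2 := cltError_le hK hτ hτ2 (hr.const_mul _) hm1 hvK
  rw [momRatio_const_mul H hc, specRatio_const_mul H hc] at h2
  have e : ∀ w : Fin (m + 1) → α, (offSum fun k l => H (w k) (w l)) / a
      = 1 / 2 * offSum fun k l => 2 * a⁻¹ * H (w k) (w l) := fun w => by
    rw [offSum_mul_left]; ring
  simp_rw [e]
  exact h.trans (by gcongr)

end CLTBound

/-! ### Moments of the centred distance kernel -/

/-- The iterated kernel of `A + R` has four terms. Only the one built from `A` alone keeps its
spectral form; those involving `R` are bounded by Cauchy–Schwarz, since the second moment of `R`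
will be small. -/
lemma sq_iterKernel_add_le {α : Type*} [MeasurableSpace α] {π : Measure α} [IsProbabilityMeasure π]
    {H A R : α → α → ℝ} (hH : DegenKernel π H) (hA : DegenKernel π A) (hR : DegenKernel π R)
    (h : ∀ z w, H z w = -(A z w + R z w)) :
    ∫ p, iterKernel π H p.1 p.2 ^ 2 ∂(π.prod π) ≤ 4 * (∫ p, iterKernel π A p.1 p.2 ^ 2 ∂(π.prod π)
      + 2 * ((∫ p, A p.1 p.2 ^ 2 ∂(π.prod π)) * ∫ p, R p.1 p.2 ^ 2 ∂(π.prod π))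
      + (∫ p, R p.1 p.2 ^ 2 ∂(π.prod π)) ^ 2) := by
  set a : α → ℝ := fun z => ∫ u, A z u ^ 2 ∂π with ha
  set b : α → ℝ := fun z => ∫ u, R z u ^ 2 ∂π with hb
  have hae : ∫ z, a z ∂π = ∫ p, A p.1 p.2 ^ 2 ∂(π.prod π) :=
    (integral_prod _ hA.memLp.integrable_sq).symm
  have hbe : ∫ z, b z ∂π = ∫ p, R p.1 p.2 ^ 2 ∂(π.prod π) :=
    (integral_prod _ hR.memLp.integrable_sq).symm
  have hai : Integrable a π := hA.integrable_sq_slice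
  have hbi : Integrable b π := hR.integrable_sq_slice
  have key : ∀ p : α × α, iterKernel π H p.1 p.2 ^ 2 ≤ 4 * (iterKernel π A p.1 p.2 ^ 2
      + a p.1 * b p.2 + b p.1 * a p.2 + b p.1 * b p.2) := by
    intro p
    have i1 := (hA.slice p.1).integrable_mul (hA.slice p.2)
    have i2 := (hA.slice p.1).integrable_mul (hR.slice p.2)
    have i3 := (hR.slice p.1).integrable_mul (hA.slice p.2)
    have i4 := (hR.slice p.1).integrable_mul (hR.slice p.2)
    have e : iterKernel π H p.1 p.2 = iterKernel π A p.1 p.2 + ∫ u, A p.1 u * R p.2 u ∂π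
        + ∫ u, R p.1 u * A p.2 u ∂π + iterKernel π R p.1 p.2 := by
      unfold iterKernel
      have := integral_add₄ i1 i2 i3 i4
      simp only [Pi.mul_apply] at this
      rw [← this]
      congr 1 with u
      rw [h, h]; ring
    have h2 := sq_integral_mul_le (hA.slice p.1) (hR.slice p.2)
    have h3 := sq_integral_mul_le (hR.slice p.1) (hA.slice p.2)
    have h4 := sq_iterKernel_le hR p.1 p.2
    rw [e]
    set x1 := iterKernel π A p.1 p.2
    set x2 := ∫ u, A p.1 u * R p.2 u ∂π
    set x3 := ∫ u, R p.1 u * A p.2 u ∂π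
    set x4 := iterKernel π R p.1 p.2
    have : (x1 + x2 + x3 + x4) ^ 2 ≤ 4 * (x1 ^ 2 + x2 ^ 2 + x3 ^ 2 + x4 ^ 2) := by
      nlinarith [sq_nonneg (x1 - x2), sq_nonneg (x1 - x3), sq_nonneg (x1 - x4),
        sq_nonneg (x2 - x3), sq_nonneg (x2 - x4), sq_nonneg (x3 - x4)]
    linarith
  have j1 := hA.iter.memLp.integrable_sq
  have j2 := hai.mul_prod hbi
  have j3 := hbi.mul_prod hai
  have j4 := hbi.mul_prod hbi
  refine (integral_mono hH.iter.memLp.integrable_sq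
    ((((j1.add j2).add j3).add j4).const_mul 4) key).trans_eq ?_
  rw [integral_const_mul]
  have e := integral_add₄ j1 j2 j3 j4
  simp only [Pi.add_apply]
  rw [e, integral_prod_mul a b, integral_prod_mul b a, integral_prod_mul b b, hae, hbe]
  ring

section DistKernel

variable {d : ℕ} {μ : Measure (EuclideanSpace ℝ (Fin d))} [IsProbabilityMeasure μ] {τ : ℝ}

/-- The doubly centred distance kernel. -/
noncomputable def distKernel (μ : Measure (EuclideanSpace ℝ (Fin d)))
    (x y : EuclideanSpace ℝ (Fin d)) : ℝ :=
  dblCenter μ (fun x y => ‖x - y‖) x y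

lemma memLp_norm_of_moment {r : ℝ} (hτ : 0 < τ) (h : Integrable (fun x => ‖x‖ ^ (4 + 4 * τ)) μ)
    (hr : r ≤ 4 + 4 * τ) : MemLp (fun x : EuclideanSpace ℝ (Fin d) => x) (ENNReal.ofReal r) μ := by
  have h1 : MemLp (fun x : EuclideanSpace ℝ (Fin d) => x) (ENNReal.ofReal (4 + 4 * τ)) μ := by
    have h4 : 0 < 4 + 4 * τ := by linarith
    rw [← integrable_norm_rpow_iff (by fun_prop) (by simpa using h4) (by simp)]
    simpa [ENNReal.toReal_ofReal h4.le] using h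
  exact h1.mono_exponent (ENNReal.ofReal_le_ofReal hr)

lemma memLp_dist {s : ENNReal} (h : MemLp (fun x : EuclideanSpace ℝ (Fin d) => x) s μ) :
    MemLp (fun p : EuclideanSpace ℝ (Fin d) × EuclideanSpace ℝ (Fin d) => ‖p.1 - p.2‖) s
      (μ.prod μ) :=
  ((h.comp_fst μ).sub (h.comp_snd μ)).norm

lemma memLp_dist_slice {s : ENNReal} (h : MemLp (fun x : EuclideanSpace ℝ (Fin d) => x) s μ)
    (x : EuclideanSpace ℝ (Fin d)) : MemLp (fun y => ‖x - y‖) s μ :=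
  ((memLp_const x).sub h).norm

lemma measurable_dist_kernel :
    Measurable (fun p : EuclideanSpace ℝ (Fin d) × EuclideanSpace ℝ (Fin d) => ‖p.1 - p.2‖) := by
  fun_prop

lemma degenKernel_distKernel (h : MemLp (fun x : EuclideanSpace ℝ (Fin d) => x) 2 μ) :
    DegenKernel μ (distKernel μ) :=
  degenKernel_dblCenter (K := fun x y => ‖x - y‖) measurable_dist_kernel
    (fun z w => norm_sub_rev z w) (memLp_dist_slice h) (memLp_dist h)

lemma memLp_distKernel {r : ℝ} (h1 : 1 ≤ r) (h3 : r ≤ 3)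
    (h : MemLp (fun x : EuclideanSpace ℝ (Fin d) => x) (ENNReal.ofReal r) μ) :
    MemLp (fun p : EuclideanSpace ℝ (Fin d) × EuclideanSpace ℝ (Fin d) => distKernel μ p.1 p.2)
      (ENNReal.ofReal r) (μ.prod μ) ∧
    ∫ p, |distKernel μ p.1 p.2| ^ r ∂(μ.prod μ) ≤ 256 * ∫ p, ‖p.1 - p.2‖ ^ r ∂(μ.prod μ) := by
  have := memLp_dblCenter (K := fun x y => ‖x - y‖) h1 h3 measurable_dist_kernel
    (memLp_dist_slice h) (memLp_dist h)
  simp only [abs_norm] at this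
  exact this

lemma memLp_inner {r : ℝ} (hr : 0 < r)
    (h : MemLp (fun x : EuclideanSpace ℝ (Fin d) => x) (ENNReal.ofReal r) μ) :
    MemLp (fun p : EuclideanSpace ℝ (Fin d) × EuclideanSpace ℝ (Fin d) => inner ℝ p.1 p.2)
      (ENNReal.ofReal r) (μ.prod μ) := by
  have hm : Measurable (fun p : EuclideanSpace ℝ (Fin d) × EuclideanSpace ℝ (Fin d) =>
    (inner ℝ p.1 p.2 : ℝ)) := by fun_prop
  have hi := integrable_abs_rpow hr h.norm
  simp only [abs_norm] at hi
  refine memLp_of_integrable_abs_rpow hr hm.aestronglyMeasurable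
    ((hi.mul_prod hi).mono' ?_ (Eventually.of_forall fun p => ?_))
  · exact ((Real.continuous_rpow_const hr.le).measurable.comp hm.abs).aestronglyMeasurable
  · rw [Real.norm_of_nonneg (by positivity), ← Real.mul_rpow (norm_nonneg _) (norm_nonneg _)]
    exact Real.rpow_le_rpow (abs_nonneg _) (abs_real_inner_le_norm _ _) hr.le

lemma degenKernel_inner (h : MemLp (fun x : EuclideanSpace ℝ (Fin d) => x) 2 μ)
    (h0 : ∫ x, x ∂μ = 0) :
    DegenKernel μ (fun x y : EuclideanSpace ℝ (Fin d) => (inner ℝ x y : ℝ)) where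
  meas := by fun_prop
  symm z w := real_inner_comm _ _
  slice z := h.const_inner z
  mean z := by rw [integral_inner (h.integrable (by norm_num)), h0, inner_zero_right]
  memLp := by
    have h' : MemLp (fun x : EuclideanSpace ℝ (Fin d) => x) (ENNReal.ofReal 2) μ := by
      simpa using h
    simpa using memLp_inner (by norm_num) h'

lemma momB_eq (h : MemLp (fun x : EuclideanSpace ℝ (Fin d) => x) 2 μ) (h0 : ∫ x, x ∂μ = 0) :
    momB μ = 2 * ∫ x, ‖x‖ ^ 2 ∂μ := by
  have hi := h.norm.integrable_sq
  have hK := degenKernel_inner h h0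
  have hin := hK.memLp.integrable (by norm_num)
  have e : ∀ p : EuclideanSpace ℝ (Fin d) × EuclideanSpace ℝ (Fin d),
      ‖p.1 - p.2‖ ^ 2 = ‖p.1‖ ^ 2 + ‖p.2‖ ^ 2 + (-2) * inner ℝ p.1 p.2 := fun p => by
    rw [norm_sub_sq_real]; ring
  unfold momB
  simp_rw [e]
  rw [integral_add₃ (hi.comp_fst μ) (hi.comp_snd μ) (hin.const_mul _), integral_const_mul,
    integral_prod _ hin, integral_fun_fst (fun x => ‖x‖ ^ 2), integral_fun_snd (fun x => ‖x‖ ^ 2)]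
  simp_rw [hK.mean]
  simp; ring

lemma momSq_le (h : MemLp (fun x : EuclideanSpace ℝ (Fin d) => x) 2 μ) :
    momSq μ ≤ (∫ x, ‖x‖ ^ 2 ∂μ) ^ 2 := by
  have hi := h.norm.integrable_sq
  unfold momSq
  rw [sq (∫ x, ‖x‖ ^ 2 ∂μ), ← integral_prod_mul (fun x => ‖x‖ ^ 2) (fun x => ‖x‖ ^ 2)]
  refine integral_mono_of_nonneg (Eventually.of_forall fun p => sq_nonneg _) (hi.mul_prod hi)
    (Eventually.of_forall fun p => ?_)
  show (inner ℝ p.1 p.2 : ℝ) ^ 2 ≤ ‖p.1‖ ^ 2 * ‖p.2‖ ^ 2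
  rw [← sq_abs, ← mul_pow]
  exact pow_le_pow_left₀ (abs_nonneg _) (abs_real_inner_le_norm _ _) 2

lemma momB_pos (h : MemLp (fun x : EuclideanSpace ℝ (Fin d) => x) 2 μ) (h0 : ∫ x, x ∂μ = 0)
    (hS : 0 < momSq μ) : 0 < momB μ := by
  have h1 := momSq_le h
  have h2 : 0 ≤ ∫ x, ‖x‖ ^ 2 ∂μ := integral_nonneg fun x => by positivity
  rw [momB_eq h h0]
  rcases h2.eq_or_lt with h3 | h3
  · rw [← h3] at h1; norm_num at h1; linarith
  · linarith

/-- The remainder in the first order expansion of the distance around `√B`. -/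
noncomputable def distRem (B : ℝ) (x y : EuclideanSpace ℝ (Fin d)) : ℝ :=
  (‖x - y‖ - √B) ^ 2 / (2 * √B)

lemma distRem_nonneg (B : ℝ) (x y : EuclideanSpace ℝ (Fin d)) : 0 ≤ distRem B x y := by
  unfold distRem; positivity

lemma measurable_distRem (B : ℝ) : Measurable (fun p : EuclideanSpace ℝ (Fin d) ×
    EuclideanSpace ℝ (Fin d) => distRem B p.1 p.2) := by
  unfold distRem; fun_prop

/-- Factor `a² - B = (a - √B)(a + √B)`; the second factor is at least both `|a - √B|` and `√B`. -/
lemma sq_sub_sqrt_le {a B : ℝ} (ha : 0 ≤ a) (hB : 0 < B) :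
    (a - √B) ^ 2 ≤ |a ^ 2 - B| ∧ (a - √B) ^ 2 ≤ |a ^ 2 - B| ^ 2 / B := by
  have hb : 0 < √B := Real.sqrt_pos.2 hB
  have hb2 : √B ^ 2 = B := Real.sq_sqrt hB.le
  set b := √B
  have e : |a ^ 2 - B| = |a - b| * (a + b) := by
    rw [← hb2, show a ^ 2 - b ^ 2 = (a - b) * (a + b) by ring, abs_mul,
      abs_of_nonneg (by linarith : 0 ≤ a + b)]
  have h1 : |a - b| ≤ a + b := by rw [abs_le]; constructor <;> linarith
  have h0 := abs_nonneg (a - b)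
  rw [e, ← sq_abs (a - b)]
  refine ⟨by nlinarith, ?_⟩
  rw [le_div_iff₀ hB, ← hb2, mul_pow]
  gcongr
  linarith

lemma distRem_le {B : ℝ} (hB : 0 < B) (x y : EuclideanSpace ℝ (Fin d)) :
    distRem B x y ≤ |‖x - y‖ ^ 2 - B| / (2 * √B) := by
  unfold distRem
  gcongr
  exact (sq_sub_sqrt_le (norm_nonneg _) hB).1

/-- Interpolation: with `c = (‖x - y‖ - √B)²`, the two bounds `c ≤ W` and `c ≤ W²/B` are used in `c²
= c^(2-2τ) c^(2τ)`. Only the moment of order `2 + 2τ` of `W` is needed, and this is the origin of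
`B^(-2τ)` in `E_x`. -/
lemma sq_distRem_le {B : ℝ} (hB : 0 < B) (hτ : 0 < τ) (hτ1 : τ ≤ 1)
    (x y : EuclideanSpace ℝ (Fin d)) :
    distRem B x y ^ 2 ≤ |‖x - y‖ ^ 2 - B| ^ (2 + 2 * τ) * (B ^ (-2 * τ) / (4 * B)) := by
  obtain ⟨h1, h2⟩ := sq_sub_sqrt_le (norm_nonneg (x - y)) hB
  set c := (‖x - y‖ - √B) ^ 2 with hc
  set W := |‖x - y‖ ^ 2 - B| with hW
  have hc0 : 0 ≤ c := sq_nonneg _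
  have hW0 : 0 ≤ W := abs_nonneg _
  have h3 : c ^ 2 ≤ W ^ (2 + 2 * τ) * B ^ (-2 * τ) := by
    have e1 : c ^ 2 = c ^ (2 - 2 * τ) * c ^ (2 * τ) := by
      rw [← Real.rpow_add_of_nonneg hc0 (by linarith) (by linarith)]; norm_num
    have e2 : W ^ (2 + 2 * τ) * B ^ (-2 * τ) = W ^ (2 - 2 * τ) * (W ^ 2 / B) ^ (2 * τ) := by
      rw [Real.div_rpow (sq_nonneg _) hB.le, ← Real.rpow_natCast, ← Real.rpow_mul hW0,
        show -2 * τ = -(2 * τ) by ring, Real.rpow_neg hB.le, mul_div_assoc', div_eq_mul_inv,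
        ← Real.rpow_add_of_nonneg hW0 (by linarith) (by push_cast; linarith)]
      congr 2; push_cast; ring
    rw [e1, e2]
    gcongr
    linarith
  unfold distRem
  rw [div_pow, mul_pow, Real.sq_sqrt hB.le, ← hc]
  calc c ^ 2 / (2 ^ 2 * B) ≤ W ^ (2 + 2 * τ) * B ^ (-2 * τ) / (2 ^ 2 * B) := by gcongr
    _ = _ := by ring

/-- As `B = 2 E‖X‖²`, the deviation `‖x - y‖² - B` is the sum of the two deviations of squared norms
and `-2 xᵀy`, whose moments make up `L`. -/
lemma integral_abs_normSq_sub_rpow_le (hτ : 0 < τ) (hτ2 : τ ≤ 1 / 2)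
    (h : Integrable (fun x => ‖x‖ ^ (4 + 4 * τ)) μ) (h0 : ∫ x, x ∂μ = 0) :
    Integrable (fun p : EuclideanSpace ℝ (Fin d) × EuclideanSpace ℝ (Fin d) =>
      |‖p.1 - p.2‖ ^ 2 - momB μ| ^ (2 + 2 * τ)) (μ.prod μ) ∧
    ∫ p, |‖p.1 - p.2‖ ^ 2 - momB μ| ^ (2 + 2 * τ) ∂(μ.prod μ) ≤ 512 * momL μ τ := by
  set r := 2 + 2 * τ with hr
  have hr0 : 0 < r := by linarith
  have h2 : MemLp (fun x : EuclideanSpace ℝ (Fin d) => x) 2 μ := by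
    have := memLp_norm_of_moment (r := 2) hτ h (by linarith)
    simpa using this
  have hr' := memLp_norm_of_moment (r := r) hτ h (by linarith)
  set s := ∫ x, ‖x‖ ^ 2 ∂μ with hs
  have hB : momB μ = 2 * s := momB_eq h2 h0
  have hsq : MemLp (fun x : EuclideanSpace ℝ (Fin d) => ‖x‖ ^ 2 - s) (ENNReal.ofReal r) μ := by
    refine MemLp.sub ?_ (memLp_const _)
    refine memLp_of_integrable_abs_rpow hr0 (by fun_prop) ?_
    convert h using 2 with x
    rw [abs_of_nonneg (by positivity), ← Real.rpow_natCast, ← Real.rpow_mul (norm_nonneg _)]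
    congr 1; rw [hr]; push_cast; ring
  have i1 := integrable_abs_rpow hr0 hsq
  have i2 := integrable_abs_rpow hr0 (memLp_inner hr0 hr')
  have key : ∀ p : EuclideanSpace ℝ (Fin d) × EuclideanSpace ℝ (Fin d),
      |‖p.1 - p.2‖ ^ 2 - momB μ| ^ r ≤ 64 * (|‖p.1‖ ^ 2 - s| ^ r + |‖p.2‖ ^ 2 - s| ^ r
        + 8 * |inner ℝ p.1 p.2| ^ r) := fun p => by
    have h4 := abs_add₄_rpow_le (r := r) (by linarith) (by linarith) (‖p.1‖ ^ 2 - s)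
      (‖p.2‖ ^ 2 - s) (-2 * inner ℝ p.1 p.2) 0
    have e : ‖p.1‖ ^ 2 - s + (‖p.2‖ ^ 2 - s) + -2 * inner ℝ p.1 p.2 + 0
        = ‖p.1 - p.2‖ ^ 2 - momB μ := by rw [norm_sub_sq_real, hB]; ring
    have e8 : |-2 * inner ℝ p.1 p.2| ^ r ≤ 8 * |inner ℝ p.1 p.2| ^ r := by
      rw [abs_mul, Real.mul_rpow (abs_nonneg _) (abs_nonneg _)]
      gcongr
      calc |(-2 : ℝ)| ^ r = 2 ^ r := by norm_num
        _ ≤ 2 ^ (3 : ℝ) := Real.rpow_le_rpow_of_exponent_le (by norm_num) (by linarith)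
        _ = 8 := by norm_num
    rw [e, abs_zero, Real.zero_rpow hr0.ne'] at h4
    linarith
  have j := (((i1.comp_fst μ).add (i1.comp_snd μ)).add (i2.const_mul 8)).const_mul 64
  have hm : Measurable (fun p : EuclideanSpace ℝ (Fin d) × EuclideanSpace ℝ (Fin d) =>
      |‖p.1 - p.2‖ ^ 2 - momB μ| ^ r) :=
    (Real.continuous_rpow_const hr0.le).measurable.comp (by fun_prop)
  have hi : Integrable (fun p : EuclideanSpace ℝ (Fin d) × EuclideanSpace ℝ (Fin d) =>
      |‖p.1 - p.2‖ ^ 2 - momB μ| ^ r) (μ.prod μ) :=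
    j.mono' hm.aestronglyMeasurable (Eventually.of_forall fun p => by
      rw [Real.norm_of_nonneg (by positivity)]; exact key p)
  refine ⟨hi, (integral_mono hi j key).trans ?_⟩
  rw [integral_const_mul]
  have e := integral_add₃ (i1.comp_fst μ) (i1.comp_snd μ) (i2.const_mul 8)
  simp only [Pi.add_apply]
  rw [e, integral_const_mul, integral_fun_fst (fun x => |‖x‖ ^ 2 - s| ^ r),
    integral_fun_snd (fun x => |‖x‖ ^ 2 - s| ^ r)]
  simp only [probReal_univ, one_smul, momL, ← hs, ← hr]
  have : 0 ≤ ∫ x, |‖x‖ ^ 2 - s| ^ r ∂μ := integral_nonneg fun x => by positivity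
  linarith

lemma momL_nonneg : 0 ≤ momL μ τ :=
  add_nonneg (integral_nonneg fun x => by positivity) (integral_nonneg fun x => by positivity)

lemma momSq_rpow_le (hτ : 0 < τ) (h : Integrable (fun x => ‖x‖ ^ (4 + 4 * τ)) μ) :
    momSq μ ^ (1 + τ) ≤ momL μ τ := by
  have hr := memLp_inner (by linarith) (memLp_norm_of_moment (r := 2 + 2 * τ) hτ h (by linarith))
  have h2 : MemLp (fun p : EuclideanSpace ℝ (Fin d) × EuclideanSpace ℝ (Fin d) =>
      (inner ℝ p.1 p.2 : ℝ)) 2 (μ.prod μ) := by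
    simpa using memLp_inner (by norm_num) (memLp_norm_of_moment (r := 2) hτ h (by linarith))
  have i := integrable_abs_rpow (by linarith : 0 < 2 + 2 * τ) hr
  have e : ∀ p : EuclideanSpace ℝ (Fin d) × EuclideanSpace ℝ (Fin d),
      ((inner ℝ p.1 p.2 : ℝ) ^ 2) ^ (1 + τ) = |inner ℝ p.1 p.2| ^ (2 + 2 * τ) := fun p => by
    rw [← sq_abs, ← Real.rpow_natCast, ← Real.rpow_mul (abs_nonneg _)]
    congr 1; push_cast; ring
  have := rpow_integral_le (μ := μ.prod μ) (s := 1 + τ) (by linarith)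
    (f := fun p : EuclideanSpace ℝ (Fin d) × EuclideanSpace ℝ (Fin d) => (inner ℝ p.1 p.2 : ℝ) ^ 2)
    (fun p => sq_nonneg _) h2.integrable_sq (by simp_rw [e]; exact i)
  simp_rw [e] at this
  refine this.trans ?_
  unfold momL
  have : 0 ≤ ∫ x, |‖x‖ ^ 2 - ∫ x', ‖x'‖ ^ 2 ∂μ| ^ (2 + 2 * τ) ∂μ :=
    integral_nonneg fun x => by positivity
  linarith

end DistKernel

/-! ### First order expansion of the distance around `√B` -/

section DistKernel

variable {d : ℕ} {μ : Measure (EuclideanSpace ℝ (Fin d))} [IsProbabilityMeasure μ] {τ : ℝ}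

lemma memLp_sq_of_memLp {β : Type*} [MeasurableSpace β] {ρ : Measure β} {g : β → ℝ} {r : ℝ}
    (hr : 0 < r) (hg : MemLp g (ENNReal.ofReal (2 * r)) ρ) :
    MemLp (fun x => g x ^ 2) (ENNReal.ofReal r) ρ := by
  refine memLp_of_integrable_abs_rpow hr (hg.1.pow 2) ?_
  convert integrable_abs_rpow (by linarith) hg using 2 with x
  rw [abs_pow, ← Real.rpow_natCast, ← Real.rpow_mul (abs_nonneg _)]
  congr 1

lemma distRem_eq (B : ℝ) (hB : 0 < B) (x y : EuclideanSpace ℝ (Fin d)) :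
    distRem B x y = (2 * √B)⁻¹ * ‖x - y‖ ^ 2 + (-1) * ‖x - y‖ + √B / 2 := by
  have hb : 0 < √B := Real.sqrt_pos.2 hB
  unfold distRem
  field_simp
  ring

lemma memLp_distRem {B r : ℝ} (hB : 0 < B) (hr : 0 < r)
    (h : MemLp (fun x : EuclideanSpace ℝ (Fin d) => x) (ENNReal.ofReal (2 * r)) μ) :
    (∀ x, MemLp (distRem B x) (ENNReal.ofReal r) μ) ∧
    MemLp (fun p : EuclideanSpace ℝ (Fin d) × EuclideanSpace ℝ (Fin d) => distRem B p.1 p.2)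
      (ENNReal.ofReal r) (μ.prod μ) := by
  have h1 : MemLp (fun x : EuclideanSpace ℝ (Fin d) => x) (ENNReal.ofReal r) μ :=
    h.mono_exponent (ENNReal.ofReal_le_ofReal (by linarith))
  constructor
  · intro x
    have : distRem B x = fun y => (2 * √B)⁻¹ * ‖x - y‖ ^ 2 + (-1) * ‖x - y‖ + √B / 2 := by
      ext y; exact distRem_eq B hB x y
    rw [this]
    exact (((memLp_sq_of_memLp hr (memLp_dist_slice h x)).const_mul _).add
      ((memLp_dist_slice h1 x).const_mul _)).add (memLp_const _)
  · simp_rw [distRem_eq B hB]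
    exact (((memLp_sq_of_memLp hr (memLp_dist h)).const_mul _).add
      ((memLp_dist h1).const_mul _)).add (memLp_const _)

lemma integral_normSq_sub (h : MemLp (fun x : EuclideanSpace ℝ (Fin d) => x) 2 μ)
    (h0 : ∫ x, x ∂μ = 0) (x : EuclideanSpace ℝ (Fin d)) :
    ∫ u, ‖x - u‖ ^ 2 ∂μ = ‖x‖ ^ 2 + ∫ u, ‖u‖ ^ 2 ∂μ := by
  have hK := degenKernel_inner h h0
  have e : ∀ u, ‖x - u‖ ^ 2 = ‖x‖ ^ 2 + ‖u‖ ^ 2 + (-2) * inner ℝ x u := fun u => by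
    rw [norm_sub_sq_real]; ring
  simp_rw [e]
  rw [integral_add₃ (integrable_const _) h.norm.integrable_sq
    (((hK.slice x).integrable (by norm_num)).const_mul _), integral_const_mul, hK.mean]
  simp

/-- Write `‖x - y‖ = √B/2 + ‖x - y‖²/(2√B) - distRem`. Double centring kills constants and functions
of one variable, and `E X = 0`, so the squared distance contributes only its cross term `-2 xᵀy`. -/
lemma distKernel_eq (h : MemLp (fun x : EuclideanSpace ℝ (Fin d) => x) (ENNReal.ofReal 4) μ)
    (h0 : ∫ x, x ∂μ = 0) (hB : 0 < momB μ) (x y : EuclideanSpace ℝ (Fin d)) :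
    distKernel μ x y = -((√(momB μ))⁻¹ * inner ℝ x y + dblCenter μ (distRem (momB μ)) x y) := by
  have h2 : MemLp (fun x : EuclideanSpace ℝ (Fin d) => x) 2 μ := by
    have : MemLp (fun x : EuclideanSpace ℝ (Fin d) => x) (ENNReal.ofReal 2) μ :=
      h.mono_exponent (ENNReal.ofReal_le_ofReal (by norm_num))
    simpa using this
  have h4 : MemLp (fun x : EuclideanSpace ℝ (Fin d) => x) (ENNReal.ofReal (2 * 2)) μ := by
    norm_num at h ⊢; exact h
  set B := momB μ with hBdef
  have hBs : B = 2 * ∫ x, ‖x‖ ^ 2 ∂μ := momB_eq h2 h0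
  set s := ∫ x, ‖x‖ ^ 2 ∂μ with hs
  have hb : 0 < √B := Real.sqrt_pos.2 hB
  have hbb : √B * √B = B := Real.mul_self_sqrt hB.le
  have hsl : ∀ x : EuclideanSpace ℝ (Fin d), Integrable (fun u => ‖x - u‖) μ := fun x =>
    (memLp_dist_slice h2 x).integrable (by norm_num)
  have hsl2 : ∀ x : EuclideanSpace ℝ (Fin d), Integrable (fun u => ‖x - u‖ ^ 2) μ := fun x =>
    (memLp_dist_slice h2 x).integrable_sq
  have hrow : ∀ x : EuclideanSpace ℝ (Fin d), ∫ u, distRem B x u ∂μ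
      = (2 * √B)⁻¹ * (‖x‖ ^ 2 + s) + (-1) * ∫ u, ‖x - u‖ ∂μ + √B / 2 := fun x => by
    simp_rw [distRem_eq B hB]
    rw [integral_add₃ ((hsl2 x).const_mul _) ((hsl x).const_mul _) (integrable_const _),
      integral_const_mul, integral_const_mul, integral_normSq_sub h2 h0]
    simp [hs]
  have hd2 := memLp_dist h2
  have htot : ∫ p, distRem B p.1 p.2 ∂(μ.prod μ)
      = (2 * √B)⁻¹ * B + (-1) * ∫ p, ‖p.1 - p.2‖ ∂(μ.prod μ) + √B / 2 := by
    simp_rw [distRem_eq B hB]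
    rw [integral_add₃ (hd2.integrable_sq.const_mul _) ((hd2.integrable (by norm_num)).const_mul _)
      (integrable_const _), integral_const_mul, integral_const_mul]
    simp [hBdef, momB]
  unfold distKernel dblCenter
  rw [hrow, hrow, htot, distRem_eq B hB, norm_sub_sq_real]
  linear_combination (2 * √B)⁻¹ * hBs

/-- Two bounds with different roles: the interpolated `L²` bound makes the remainder negligible
against `xᵀy/√B` when `E_x` is small, and the crude one of order `2 + 2τ` serves the Lyapunov ratio.
In both, `32768 = 256 · 512 / 4`. -/
lemma distRem_moments (hτ : 0 < τ) (hτ2 : τ ≤ 1 / 2)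
    (h : Integrable (fun x => ‖x‖ ^ (4 + 4 * τ)) μ) (h0 : ∫ x, x ∂μ = 0) (hB : 0 < momB μ) :
    DegenKernel μ (dblCenter μ (distRem (momB μ))) ∧
    ∫ p, dblCenter μ (distRem (momB μ)) p.1 p.2 ^ 2 ∂(μ.prod μ)
      ≤ 32768 * (momB μ ^ (-2 * τ) * momL μ τ / momB μ) ∧
    MemLp (fun p : EuclideanSpace ℝ (Fin d) × EuclideanSpace ℝ (Fin d) =>
      dblCenter μ (distRem (momB μ)) p.1 p.2) (ENNReal.ofReal (2 + 2 * τ)) (μ.prod μ) ∧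
    ∫ p, |dblCenter μ (distRem (momB μ)) p.1 p.2| ^ (2 + 2 * τ) ∂(μ.prod μ)
      ≤ 32768 * (momL μ τ / momB μ ^ (1 + τ)) := by
  set B := momB μ with hBdef
  set r := 2 + 2 * τ with hr
  have hr0 : 0 < r := by linarith
  have hb : 0 < √B := Real.sqrt_pos.2 hB
  have hL : 0 ≤ momL μ τ := momL_nonneg
  have h2r := memLp_norm_of_moment (r := 2 * r) hτ h (by linarith)
  obtain ⟨hqs, hq⟩ := memLp_distRem hB hr0 h2r
  have h22 : ENNReal.ofReal 2 ≤ ENNReal.ofReal r := ENNReal.ofReal_le_ofReal (by linarith)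
  have hqs2 : ∀ x, MemLp (distRem B x) (ENNReal.ofReal 2) μ := fun x => (hqs x).mono_exponent h22
  have hq2 := hq.mono_exponent h22
  obtain ⟨iW, hW⟩ := integral_abs_normSq_sub_rpow_le hτ hτ2 h h0
  have hsymm : ∀ x y : EuclideanSpace ℝ (Fin d), distRem B x y = distRem B y x := fun x y => by
    simp only [distRem, norm_sub_rev x y]
  obtain ⟨-, h5⟩ := memLp_dblCenter (r := 2) (by norm_num) (by norm_num) (measurable_distRem B)
    hqs2 hq2
  obtain ⟨h6, h7⟩ := memLp_dblCenter (r := r) (by linarith) (by linarith) (measurable_distRem B)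
    hqs hq
  refine ⟨degenKernel_dblCenter (measurable_distRem B) hsymm (by simpa using hqs2)
    (by simpa using hq2), ?_, h6, ?_⟩
  · simp only [Real.rpow_two, sq_abs] at h5
    have h8 : ∫ p, distRem B p.1 p.2 ^ 2 ∂(μ.prod μ)
        ≤ 512 * momL μ τ * (B ^ (-2 * τ) / (4 * B)) := by
      calc _ ≤ ∫ p, |‖p.1 - p.2‖ ^ 2 - B| ^ r * (B ^ (-2 * τ) / (4 * B)) ∂(μ.prod μ) :=
            integral_mono_of_nonneg (Eventually.of_forall fun p => sq_nonneg _)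
              (iW.mul_const _) (Eventually.of_forall fun p =>
                sq_distRem_le hB hτ (by linarith) p.1 p.2)
        _ ≤ _ := by
            rw [integral_mul_const]
            gcongr
    calc _ ≤ 256 * (512 * momL μ τ * (B ^ (-2 * τ) / (4 * B))) := by linarith
      _ = _ := by field_simp; ring
  · have hBr : (2 * √B) ^ r = 2 ^ r * B ^ (1 + τ) := by
      rw [Real.mul_rpow (by norm_num) hb.le, Real.sqrt_eq_rpow, ← Real.rpow_mul hB.le]
      congr 2; rw [hr]; ring
    have h2r : (4 : ℝ) ≤ 2 ^ r := by
      calc (4 : ℝ) = 2 ^ (2 : ℝ) := by norm_num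
        _ ≤ 2 ^ r := Real.rpow_le_rpow_of_exponent_le (by norm_num) (by linarith)
    have hBp : 0 < B ^ (1 + τ) := by positivity
    have h8 : ∫ p, |distRem B p.1 p.2| ^ r ∂(μ.prod μ)
        ≤ 512 * momL μ τ * ((2 * √B) ^ r)⁻¹ := by
      calc _ ≤ ∫ p, |‖p.1 - p.2‖ ^ 2 - B| ^ r * ((2 * √B) ^ r)⁻¹ ∂(μ.prod μ) := by
            refine integral_mono_of_nonneg (Eventually.of_forall fun p => by positivity)
              (iW.mul_const _) (Eventually.of_forall fun p => ?_)
            show |distRem B p.1 p.2| ^ r ≤ |‖p.1 - p.2‖ ^ 2 - B| ^ r * ((2 * √B) ^ r)⁻¹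
            rw [abs_of_nonneg (distRem_nonneg B _ _), ← div_eq_mul_inv,
              ← Real.div_rpow (abs_nonneg _) (by positivity)]
            exact Real.rpow_le_rpow (distRem_nonneg _ _ _) (distRem_le hB _ _) hr0.le
        _ ≤ _ := by
            rw [integral_mul_const]
            gcongr
    have h9 : ((2 * √B) ^ r)⁻¹ ≤ (4 * B ^ (1 + τ))⁻¹ := by
      rw [hBr]; gcongr
    calc _ ≤ 256 * (512 * momL μ τ * (4 * B ^ (1 + τ))⁻¹) := by
          refine h7.trans ?_
          gcongr
          exact h8.trans (by gcongr)
      _ = _ := by field_simp; ring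

lemma integral_abs_distKernel_rpow_le (hτ : 0 < τ) (hτ2 : τ ≤ 1 / 2)
    (h : Integrable (fun x => ‖x‖ ^ (4 + 4 * τ)) μ) (h0 : ∫ x, x ∂μ = 0) (hB : 0 < momB μ) :
    ∫ p, |distKernel μ p.1 p.2| ^ (2 + 2 * τ) ∂(μ.prod μ)
      ≤ 2097216 * (momL μ τ / momB μ ^ (1 + τ)) := by
  have h4 := memLp_norm_of_moment (r := 4) hτ h (by linarith)
  have hr := memLp_norm_of_moment (r := 2 + 2 * τ) hτ h (by linarith)
  obtain ⟨-, -, hR, hRm⟩ := distRem_moments hτ hτ2 h h0 hB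
  set B := momB μ with hBdef
  set r := 2 + 2 * τ with hrdef
  have hr0 : 0 < r := by linarith
  have hb : 0 < √B := Real.sqrt_pos.2 hB
  have i1 := integrable_abs_rpow hr0 (memLp_inner hr0 hr)
  have i2 := integrable_abs_rpow hr0 hR
  have hBr : (√B) ^ r = B ^ (1 + τ) := by
    rw [Real.sqrt_eq_rpow, ← Real.rpow_mul hB.le]
    congr 1; rw [hrdef]; ring
  have key : ∀ p : EuclideanSpace ℝ (Fin d) × EuclideanSpace ℝ (Fin d),
      |distKernel μ p.1 p.2| ^ r ≤ 64 * ((B ^ (1 + τ))⁻¹ * |inner ℝ p.1 p.2| ^ r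
        + |dblCenter μ (distRem B) p.1 p.2| ^ r) := fun p => by
    have := abs_add₄_rpow_le (r := r) (by linarith) (by linarith) ((√B)⁻¹ * inner ℝ p.1 p.2)
      (dblCenter μ (distRem B) p.1 p.2) 0 0
    rw [abs_zero, Real.zero_rpow hr0.ne', abs_mul, Real.mul_rpow (abs_nonneg _) (abs_nonneg _),
      abs_of_pos (inv_pos.2 hb), Real.inv_rpow hb.le, hBr] at this
    rw [distKernel_eq h4 h0 hB, abs_neg]
    simpa using this
  have hD := (memLp_distKernel (by linarith) (by linarith) hr).1
  refine (integral_mono (integrable_abs_rpow hr0 hD) (((i1.const_mul _).add i2).const_mul 64)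
    key).trans ?_
  rw [integral_const_mul]
  have e := integral_add (i1.const_mul (B ^ (1 + τ))⁻¹) i2
  simp only [Pi.add_apply]
  rw [e, integral_const_mul]
  have h5 : ∫ p, |inner ℝ p.1 p.2| ^ r ∂(μ.prod μ) ≤ momL μ τ := by
    unfold momL
    have : 0 ≤ ∫ x, |‖x‖ ^ 2 - ∫ x', ‖x'‖ ^ 2 ∂μ| ^ (2 + 2 * τ) ∂μ :=
      integral_nonneg fun x => by positivity
    linarith
  have h6 : (B ^ (1 + τ))⁻¹ * ∫ p, |inner ℝ p.1 p.2| ^ r ∂(μ.prod μ)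
      ≤ momL μ τ / B ^ (1 + τ) := by
    rw [div_eq_inv_mul]; gcongr
  linarith

/-- From `S^(1+τ) ≤ L`, with `S = momSq μ`, one gets `S ≤ L^(1/(1+τ))`, hence `L^((2+τ)/(1+τ)) ≥ L
S`. Thus `E_x` dominates the ratio `B^(-2τ) L / S` that measures the remainder relative to the
linear term. -/
lemma momE_bounds (hτ : 0 < τ) (h : Integrable (fun x => ‖x‖ ^ (4 + 4 * τ)) μ)
    (hS : 0 < momSq μ) (hB : 0 < momB μ) :
    momCov μ / momSq μ ^ 2 ≤ momE μ τ ∧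
      momB μ ^ (-2 * τ) * momL μ τ / momSq μ ≤ momE μ τ := by
  have hL : 0 ≤ momL μ τ := momL_nonneg
  have hC : 0 ≤ momCov μ := integral_nonneg fun p => sq_nonneg _
  have h1 := momSq_rpow_le hτ h
  have hLpos : 0 < momL μ τ := lt_of_lt_of_le (by positivity) h1
  have h2 : momSq μ ≤ momL μ τ ^ (1 / (1 + τ)) := by
    have := Real.rpow_le_rpow (by positivity) h1 (show 0 ≤ 1 / (1 + τ) by positivity)
    rwa [← Real.rpow_mul hS.le, mul_one_div_cancel (by linarith), Real.rpow_one] at this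
  have h3 : momL μ τ ^ ((2 + τ) / (1 + τ)) = momL μ τ * momL μ τ ^ (1 / (1 + τ)) := by
    rw [← Real.rpow_one_add' hL (by positivity)]
    congr 1; field_simp; ring
  have hBp : 0 < momB μ ^ (-2 * τ) := by positivity
  unfold momE
  constructor
  · gcongr
    have : 0 ≤ momB μ ^ (-2 * τ) * momL μ τ ^ ((2 + τ) / (1 + τ)) := by positivity
    linarith
  · rw [h3, div_le_div_iff₀ hS (by positivity)]
    have h5 : momB μ ^ (-2 * τ) * momL μ τ * momSq μ
        ≤ momB μ ^ (-2 * τ) * (momL μ τ * momL μ τ ^ (1 / (1 + τ))) := by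
      rw [mul_assoc]; gcongr
    nlinarith

lemma iterKernel_inner (h : MemLp (fun x : EuclideanSpace ℝ (Fin d) => x) 2 μ)
    (x y : EuclideanSpace ℝ (Fin d)) :
    iterKernel μ (fun x y : EuclideanSpace ℝ (Fin d) => (inner ℝ x y : ℝ)) x y
      = ∑ i, ∑ j, x i * covMat μ i j * y j := by
  unfold iterKernel
  have hc : ∀ i, MemLp (fun u : EuclideanSpace ℝ (Fin d) => u i) 2 μ := fun i => by
    refine h.norm.mono (by fun_prop) (Eventually.of_forall fun u => ?_)
    rw [norm_norm]
    exact PiLp.norm_apply_le u i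
  have e : ∀ u : EuclideanSpace ℝ (Fin d), (inner ℝ x u : ℝ) * inner ℝ y u
      = ∑ i, ∑ j, (x i * y j) * (u i * u j) := fun u => by
    simp only [PiLp.inner_apply, RCLike.inner_apply, conj_trivial, Finset.sum_mul_sum]
    exact Finset.sum_congr rfl fun i _ => Finset.sum_congr rfl fun j _ => by ring
  simp_rw [e]
  have hi : ∀ i j, Integrable (fun u : EuclideanSpace ℝ (Fin d) => (x i * y j) * (u i * u j)) μ :=
    fun i j => ((hc i).integrable_mul (hc j)).const_mul _
  rw [integral_finsetSum _ fun i _ => integrable_finsetSum _ fun j _ => hi i j]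
  refine Finset.sum_congr rfl fun i _ => ?_
  rw [integral_finsetSum _ fun j _ => hi i j]
  refine Finset.sum_congr rfl fun j _ => ?_
  rw [integral_const_mul, covMat, Matrix.of_apply]
  ring

/-- Control of the distance kernel when `E_x` is small. -/
theorem distKernel_bounds_of_momE_le (hτ : 0 < τ) (hτ2 : τ ≤ 1 / 2)
    (h : Integrable (fun x => ‖x‖ ^ (4 + 4 * τ)) μ) (h0 : ∫ x, x ∂μ = 0) (hS : 0 < momSq μ)
    (hE : momE μ τ ≤ 1 / 131072) :
    0 < ∫ p, distKernel μ p.1 p.2 ^ 2 ∂(μ.prod μ) ∧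
    momRatio μ (distKernel μ) τ ≤ 16777728 * (momL μ τ / momSq μ ^ (1 + τ)) ∧
    specRatio μ (distKernel μ) ≤ 8388608 * momE μ τ := by
  have h2 : MemLp (fun x : EuclideanSpace ℝ (Fin d) => x) 2 μ := by
    have := memLp_norm_of_moment (r := 2) hτ h (by linarith)
    simpa using this
  have h4 := memLp_norm_of_moment (r := 4) hτ h (by linarith)
  have hB := momB_pos h2 h0 hS
  have hL : 0 ≤ momL μ τ := momL_nonneg
  have hD := degenKernel_distKernel h2
  have hDm := integral_abs_distKernel_rpow_le hτ hτ2 h h0 hB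
  obtain ⟨hR, hR2, -, -⟩ := distRem_moments hτ hτ2 h h0 hB
  obtain ⟨hE1, hE2⟩ := momE_bounds hτ h hS hB
  have hK := degenKernel_inner h2 h0
  have hA := hK.const_mul (√(momB μ))⁻¹
  have heq := distKernel_eq h4 h0 hB
  have hb : 0 < √(momB μ) := Real.sqrt_pos.2 hB
  have hAsq : ∫ p, ((√(momB μ))⁻¹ * (inner ℝ p.1 p.2 : ℝ)) ^ 2 ∂(μ.prod μ)
      = momSq μ / momB μ := by
    simp_rw [mul_pow]
    rw [integral_const_mul, inv_pow, Real.sq_sqrt hB.le, ← div_eq_inv_mul]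
    rfl
  have hspec := sq_iterKernel_add_le hD hA hR heq
  rw [hAsq] at hspec
  have hAiter : ∫ p, iterKernel μ (fun x y => (√(momB μ))⁻¹ * (inner ℝ x y : ℝ)) p.1 p.2 ^ 2
      ∂(μ.prod μ) = momCov μ / momB μ ^ 2 := by
    have e : ∀ x y, iterKernel μ (fun x y => (√(momB μ))⁻¹ * (inner ℝ x y : ℝ)) x y
        = (momB μ)⁻¹ * ∑ i, ∑ j, x i * covMat μ i j * y j := fun x y => by
      rw [← iterKernel_inner h2 x y]
      unfold iterKernel
      rw [← integral_const_mul]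
      congr 1 with u
      have hinv : (momB μ)⁻¹ = (√(momB μ))⁻¹ * (√(momB μ))⁻¹ := by
        rw [← mul_inv, Real.mul_self_sqrt hB.le]
      rw [hinv]
      ring
    simp_rw [e, mul_pow]
    rw [integral_const_mul, inv_pow, ← div_eq_inv_mul]
    rfl
  rw [hAiter] at hspec
  set B := momB μ with hBdef
  set S := momSq μ with hSdef
  set L := momL μ τ with hLdef
  set v := ∫ p, distKernel μ p.1 p.2 ^ 2 ∂(μ.prod μ) with hv
  set ρ := ∫ p, dblCenter μ (distRem B) p.1 p.2 ^ 2 ∂(μ.prod μ) with hρ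
  set e := momE μ τ with he
  have hρ0 : 0 ≤ ρ := integral_nonneg fun p => sq_nonneg _
  have hSB : 0 < S / B := by positivity
  have hρe : ρ ≤ 32768 * e * (S / B) := by
    calc ρ ≤ 32768 * (B ^ (-2 * τ) * L / B) := hR2
      _ = 32768 * (B ^ (-2 * τ) * L / S) * (S / B) := by field_simp
      _ ≤ _ := by gcongr
  have hlow : S / B ≤ 2 * v + 2 * ρ := by
    rw [← hAsq]
    have i1 := hD.memLp.integrable_sq
    have i2 := hR.memLp.integrable_sq
    have := integral_mono hA.memLp.integrable_sq ((i1.const_mul 2).add (i2.const_mul 2)) (fun p => by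
      show ((√B)⁻¹ * (inner ℝ p.1 p.2 : ℝ)) ^ 2 ≤ 2 * distKernel μ p.1 p.2 ^ 2
        + 2 * dblCenter μ (distRem B) p.1 p.2 ^ 2
      rw [heq]
      nlinarith [sq_nonneg ((√B)⁻¹ * (inner ℝ p.1 p.2 : ℝ)
        + 2 * dblCenter μ (distRem B) p.1 p.2)])
    simp only [Pi.add_apply] at this
    rw [integral_add (i1.const_mul 2) (i2.const_mul 2), integral_const_mul,
      integral_const_mul] at this
    exact this
  have he0 : 0 ≤ e := le_trans (by positivity) hE2
  -- The threshold is `1/131072 = 1/(4 · 32768)`: it forces `ρ ≤ S/(4B)`, and then `v ≥ S/(2B) - ρ ≥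
  -- S/(4B)`.
  have hv4 : S / B / 4 ≤ v := by nlinarith
  have hvpos : 0 < v := by linarith
  refine ⟨hvpos, ?_, ?_⟩
  · unfold momRatio
    rw [← hv]
    have h5 : (S / B / 4) ^ (1 + τ) ≤ v ^ (1 + τ) := by gcongr
    have h6 : (S / B / 4) ^ (1 + τ) = S ^ (1 + τ) / B ^ (1 + τ) / 4 ^ (1 + τ) := by
      rw [Real.div_rpow (by positivity) (by norm_num), Real.div_rpow hS.le hB.le]
    have h7 : (4 : ℝ) ^ (1 + τ) ≤ 8 := by
      calc (4 : ℝ) ^ (1 + τ) ≤ 4 ^ (3 / 2 : ℝ) :=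
            Real.rpow_le_rpow_of_exponent_le (by norm_num) (by linarith)
        _ = (4 ^ (1 / 2 : ℝ)) ^ (3 : ℝ) := by rw [← Real.rpow_mul (by norm_num)]; norm_num
        _ = 8 := by
          rw [← Real.sqrt_eq_rpow, show (4 : ℝ) = 2 ^ 2 by norm_num, Real.sqrt_sq (by norm_num)]
          norm_num
    have hBp : 0 < B ^ (1 + τ) := by positivity
    have hSp : 0 < S ^ (1 + τ) := by positivity
    have h4p : 0 < (4 : ℝ) ^ (1 + τ) := by positivity
    calc _ ≤ 2097216 * (L / B ^ (1 + τ)) / (S / B / 4) ^ (1 + τ) := by gcongr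
      _ = 2097216 * 4 ^ (1 + τ) * (L / S ^ (1 + τ)) := by rw [h6]; field_simp
      _ ≤ 2097216 * 8 * (L / S ^ (1 + τ)) := by gcongr
      _ = _ := by ring
  · unfold specRatio
    rw [← hv]
    have hcov : momCov μ / B ^ 2 ≤ e * (S / B) ^ 2 := by
      calc momCov μ / B ^ 2 = momCov μ / S ^ 2 * (S / B) ^ 2 := by field_simp
        _ ≤ _ := by gcongr
    have h8 : ρ ^ 2 ≤ 32768 * e * (S / B) * (S / B) := by
      have : ρ ≤ S / B := by nlinarith
      nlinarith
    have h9 : S / B * ρ ≤ S / B * (32768 * e * (S / B)) := by gcongr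
    have h10 : ∫ p, iterKernel μ (distKernel μ) p.1 p.2 ^ 2 ∂(μ.prod μ)
        ≤ 524288 * e * (S / B) ^ 2 := by
      nlinarith [mul_nonneg he0 (sq_nonneg (S / B))]
    have h11 : (S / B / 4) ^ 2 ≤ v ^ 2 := by gcongr
    calc _ ≤ 524288 * e * (S / B) ^ 2 / (S / B / 4) ^ 2 := by gcongr
      _ = 8388608 * e := by field_simp; ring

end DistKernel

/-! ### Lower bound for the second moment of the distance kernel in bounded dimension -/

section BoundedDim

variable {d : ℕ} {μ : Measure (EuclideanSpace ℝ (Fin d))} [IsProbabilityMeasure μ] {τ : ℝ}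

lemma abs_prod_coord_le {m : ℕ} (x : EuclideanSpace ℝ (Fin d)) (f : Fin m → Fin d) :
    |∏ i, x (f i)| ≤ ‖x‖ ^ m := by
  rw [Finset.abs_prod]
  calc ∏ i, |x (f i)| ≤ ∏ _i : Fin m, ‖x‖ :=
        Finset.prod_le_prod (fun i _ => abs_nonneg _) fun i _ => PiLp.norm_apply_le x (f i)
    _ = ‖x‖ ^ m := by simp

/-- Powers of the inner product are inner products of tensor powers. Consequently their weighted
double integrals are sums of squares. -/
lemma inner_pow_eq (m : ℕ) (x y : EuclideanSpace ℝ (Fin d)) :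
    (inner ℝ x y : ℝ) ^ m = ∑ f : Fin m → Fin d, (∏ i, x (f i)) * ∏ i, y (f i) := by
  have e : (inner ℝ x y : ℝ) = ∑ i, x i * y i := by
    simp [PiLp.inner_apply, mul_comm]
  rw [e, Fintype.sum_pow]
  simp_rw [Finset.prod_mul_distrib]

lemma integrable_weight_prod {w : EuclideanSpace ℝ (Fin d) → ℝ} (hw : Measurable w) {m : ℕ}
    (hi : Integrable (fun x => w x * ‖x‖ ^ m) μ) (f : Fin m → Fin d) :
    Integrable (fun x => w x * ∏ i, x (f i)) μ := by
  refine hi.mono (by fun_prop) (Eventually.of_forall fun x => ?_)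
  rw [norm_mul, norm_mul, Real.norm_eq_abs (∏ i, x (f i)), Real.norm_of_nonneg (by positivity :
    0 ≤ ‖x‖ ^ m)]
  gcongr
  exact abs_prod_coord_le x f

lemma integral_weight_inner_pow {w : EuclideanSpace ℝ (Fin d) → ℝ} (hw : Measurable w) {m : ℕ}
    (hi : Integrable (fun x => w x * ‖x‖ ^ m) μ) :
    Integrable (fun p : EuclideanSpace ℝ (Fin d) × EuclideanSpace ℝ (Fin d) =>
      w p.1 * w p.2 * (inner ℝ p.1 p.2) ^ m) (μ.prod μ) ∧
    ∫ p, w p.1 * w p.2 * (inner ℝ p.1 p.2) ^ m ∂(μ.prod μ)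
      = ∑ f : Fin m → Fin d, (∫ x, w x * ∏ i, x (f i) ∂μ) ^ 2 := by
  have e : ∀ p : EuclideanSpace ℝ (Fin d) × EuclideanSpace ℝ (Fin d),
      w p.1 * w p.2 * (inner ℝ p.1 p.2) ^ m
        = ∑ f : Fin m → Fin d, (w p.1 * ∏ i, p.1 (f i)) * (w p.2 * ∏ i, p.2 (f i)) := fun p => by
    rw [inner_pow_eq, Finset.mul_sum]
    exact Finset.sum_congr rfl fun f _ => by ring
  have hf := fun f : Fin m → Fin d => integrable_weight_prod hw hi f
  simp_rw [e]
  refine ⟨integrable_finsetSum _ fun f _ => (hf f).mul_prod (hf f), ?_⟩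
  rw [integral_finsetSum _ fun f _ => (hf f).mul_prod (hf f)]
  refine Finset.sum_congr rfl fun f _ => ?_
  rw [integral_prod_mul (fun x => w x * ∏ i, x (f i)) (fun x => w x * ∏ i, x (f i)), sq]

/-- The left side is the squared trace of the weighted second moment matrix and the right side `d`
times its squared Frobenius norm; Cauchy–Schwarz on the diagonal compares them. -/
lemma sq_integral_weight_normSq_le {w : EuclideanSpace ℝ (Fin d) → ℝ} (hw : Measurable w)
    (hi : Integrable (fun x => w x * ‖x‖ ^ 2) μ) :
    (∫ x, w x * ‖x‖ ^ 2 ∂μ) ^ 2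
      ≤ d * ∫ p, w p.1 * w p.2 * (inner ℝ p.1 p.2) ^ 2 ∂(μ.prod μ) := by
  rw [(integral_weight_inner_pow hw hi).2]
  have hf := fun f : Fin 2 → Fin d => integrable_weight_prod hw hi f
  set g : (Fin 2 → Fin d) → ℝ := fun f => ∫ x, w x * ∏ i, x (f i) ∂μ with hg
  have e : ∫ x, w x * ‖x‖ ^ 2 ∂μ = ∑ j : Fin d, g (fun _ => j) := by
    rw [hg, ← integral_finsetSum _ fun j _ => hf _]
    congr 1 with x
    rw [← Finset.mul_sum, EuclideanSpace.norm_sq_eq]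
    simp
  rw [e]
  refine (sq_sum_le_card_mul_sum_sq).trans ?_
  rw [Finset.card_univ, Fintype.card_fin]
  gcongr
  rw [← Finset.sum_image (s := Finset.univ) (g := fun j : Fin d => (fun _ : Fin 2 => j))
    (f := fun f => g f ^ 2) fun a _ b _ h => congrFun h 0]
  exact Finset.sum_le_sum_of_subset_of_nonneg (Finset.subset_univ _) fun _ _ _ => sq_nonneg _

lemma sq_integral_normSq_le (h : MemLp (fun x : EuclideanSpace ℝ (Fin d) => x) 2 μ) :
    (∫ x, ‖x‖ ^ 2 ∂μ) ^ 2 ≤ d * momSq μ := by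
  have := sq_integral_weight_normSq_le (μ := μ) (w := fun _ => 1) measurable_const
    (by simpa using h.norm.integrable_sq)
  simpa [momSq] using this

lemma exp_weight_mul_exp_le {t : ℝ} (ht : 0 ≤ t) (x y : EuclideanSpace ℝ (Fin d)) :
    Real.exp (-t * ‖x‖ ^ 2) * Real.exp (-t * ‖y‖ ^ 2) * Real.exp (2 * t * |inner ℝ x y|) ≤ 1 := by
  rw [← Real.exp_add, ← Real.exp_add, Real.exp_le_one_iff]
  have h1 : |inner ℝ x y| ≤ ‖x‖ * ‖y‖ := abs_real_inner_le_norm _ _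
  have h2 : 2 * |inner ℝ x y| ≤ ‖x‖ ^ 2 + ‖y‖ ^ 2 := by nlinarith [sq_nonneg (‖x‖ - ‖y‖)]
  nlinarith

lemma integrable_exp_weight_norm_pow {t : ℝ} (ht : 0 < t) (m : ℕ) :
    Integrable (fun x : EuclideanSpace ℝ (Fin d) => Real.exp (-t * ‖x‖ ^ 2) * ‖x‖ ^ m) μ := by
  refine Integrable.of_bound (by fun_prop) (1 + (m.factorial : ℝ) / t ^ m)
    (Eventually.of_forall fun x => ?_)
  rw [Real.norm_of_nonneg (by positivity)]
  have h1 := Real.pow_div_factorial_le_exp (x := t * ‖x‖ ^ 2) (by positivity) m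
  have hm : (0 : ℝ) < m.factorial := by positivity
  have h2 : ‖x‖ ^ m ≤ 1 + (‖x‖ ^ 2) ^ m := by
    rw [← pow_mul, mul_comm, pow_mul]
    nlinarith [sq_nonneg (‖x‖ ^ m - 1)]
  have h3 : (‖x‖ ^ 2) ^ m ≤ (m.factorial : ℝ) / t ^ m * Real.exp (t * ‖x‖ ^ 2) := by
    rw [mul_pow, div_le_iff₀ hm] at h1
    rw [div_mul_eq_mul_div, le_div_iff₀ (by positivity)]
    linarith
  have h4 : Real.exp (-t * ‖x‖ ^ 2) * Real.exp (t * ‖x‖ ^ 2) = 1 := by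
    rw [← Real.exp_add]; simp
  have h5 : Real.exp (-t * ‖x‖ ^ 2) ≤ 1 := Real.exp_le_one_iff.2 (by nlinarith [sq_nonneg ‖x‖])
  calc Real.exp (-t * ‖x‖ ^ 2) * ‖x‖ ^ m
      ≤ Real.exp (-t * ‖x‖ ^ 2) * (1 + (m.factorial : ℝ) / t ^ m * Real.exp (t * ‖x‖ ^ 2)) := by
        gcongr; linarith
    _ = Real.exp (-t * ‖x‖ ^ 2)
          + (m.factorial : ℝ) / t ^ m * (Real.exp (-t * ‖x‖ ^ 2) * Real.exp (t * ‖x‖ ^ 2)) := by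
        ring
    _ ≤ _ := by rw [h4]; linarith

/-- The Gaussian kernel integrates the inner product to a nonnegative quantity, bounded below by
the first term of its power series. -/
lemma integral_gaussian_inner_ge (h : MemLp (fun x : EuclideanSpace ℝ (Fin d) => x) 2 μ) {t : ℝ}
    (ht : 0 < t) :
    2 * t * ∫ p, Real.exp (-t * ‖p.1‖ ^ 2) * Real.exp (-t * ‖p.2‖ ^ 2) * (inner ℝ p.1 p.2) ^ 2
        ∂(μ.prod μ)
      ≤ ∫ p, Real.exp (-t * ‖p.1 - p.2‖ ^ 2) * inner ℝ p.1 p.2 ∂(μ.prod μ) := by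
  set w : EuclideanSpace ℝ (Fin d) → ℝ := fun x => Real.exp (-t * ‖x‖ ^ 2) with hw
  have hwm : Measurable w := by fun_prop
  have hp := fun m => integral_weight_inner_pow hwm (m := m)
    (integrable_exp_weight_norm_pow (μ := μ) ht m)
  have hin : Integrable (fun p : EuclideanSpace ℝ (Fin d) × EuclideanSpace ℝ (Fin d) =>
      |(inner ℝ p.1 p.2 : ℝ)|) (μ.prod μ) := by
    have h' : MemLp (fun x : EuclideanSpace ℝ (Fin d) => x) (ENNReal.ofReal 2) μ := by
      simpa using h
    exact ((memLp_inner (by norm_num) h').integrable (by simp)).abs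
  -- Since `exp (-t‖x - y‖²) = w(x) w(y) exp (2t xᵀy)`, the exponential series is truncated at `N`
  -- terms. The weights absorb `exp (2t|xᵀy|)`, which leaves the integrable dominating function
  -- `|xᵀy|`.
  set F : ℕ → EuclideanSpace ℝ (Fin d) × EuclideanSpace ℝ (Fin d) → ℝ := fun N p =>
    ∑ m ∈ Finset.range N, (2 * t) ^ m / m.factorial * (w p.1 * w p.2 * (inner ℝ p.1 p.2) ^ (m + 1))
    with hF
  have hFe : ∀ N p, F N p = w p.1 * w p.2 * inner ℝ p.1 p.2
      * ∑ m ∈ Finset.range N, (2 * t * inner ℝ p.1 p.2) ^ m / m.factorial := fun N p => by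
    rw [hF, Finset.mul_sum]
    refine Finset.sum_congr rfl fun m _ => ?_
    rw [mul_pow (2 * t)]; ring
  have hlim : Tendsto (fun N => ∫ p, F N p ∂(μ.prod μ)) atTop
      (𝓝 (∫ p, Real.exp (-t * ‖p.1 - p.2‖ ^ 2) * inner ℝ p.1 p.2 ∂(μ.prod μ))) := by
    refine tendsto_integral_of_dominated_convergence _ (fun N => ?_) hin (fun N => ?_) ?_
    · rw [hF]; exact (by fun_prop : Measurable _).aestronglyMeasurable
    · refine Eventually.of_forall fun p => ?_
      rw [hFe]
      set u : ℝ := inner ℝ p.1 p.2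
      have h1 : |∑ m ∈ Finset.range N, (2 * t * u) ^ m / m.factorial|
          ≤ Real.exp (2 * t * |u|) := by
        refine (Finset.abs_sum_le_sum_abs _ _).trans ?_
        refine (Finset.sum_congr rfl fun m _ => ?_).trans_le
          (Real.sum_le_exp_of_nonneg (by positivity : 0 ≤ 2 * t * |u|) N)
        rw [abs_div, abs_pow, abs_mul, abs_of_pos (by positivity : 0 < 2 * t), Nat.abs_cast]
      have h2 := exp_weight_mul_exp_le ht.le p.1 p.2
      have hw0 : 0 ≤ w p.1 * w p.2 := by positivity
      rw [Real.norm_eq_abs, abs_mul, abs_mul, abs_of_nonneg hw0]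
      calc w p.1 * w p.2 * |u| * |∑ m ∈ Finset.range N, (2 * t * u) ^ m / m.factorial|
          ≤ w p.1 * w p.2 * |u| * Real.exp (2 * t * |u|) := by gcongr
        _ = w p.1 * w p.2 * Real.exp (2 * t * |u|) * |u| := by ring
        _ ≤ 1 * |u| := by gcongr
        _ = |u| := one_mul _
    · refine Eventually.of_forall fun p => ?_
      simp_rw [hFe]
      have h1 := (NormedSpace.expSeries_div_hasSum_exp
        (2 * t * inner ℝ p.1 p.2 : ℝ)).tendsto_sum_nat
      rw [← Real.exp_eq_exp_ℝ] at h1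
      have h2 := h1.const_mul (w p.1 * w p.2 * inner ℝ p.1 p.2)
      convert h2 using 2
      simp only [hw]
      rw [mul_right_comm, ← Real.exp_add, ← Real.exp_add, norm_sub_sq_real]
      congr 2; ring
  refine ge_of_tendsto hlim (eventually_atTop.2 ⟨2, fun N hN => ?_⟩)
  rw [hF, integral_finsetSum _ fun m _ => (hp (m + 1)).1.const_mul _]
  simp_rw [integral_const_mul]
  have h0 : ∀ m, 0 ≤ (2 * t) ^ m / m.factorial * ∫ p, w p.1 * w p.2 * (inner ℝ p.1 p.2) ^ (m + 1)
      ∂(μ.prod μ) := fun m => by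
    rw [(hp (m + 1)).2]
    exact mul_nonneg (by positivity) (Finset.sum_nonneg fun _ _ => sq_nonneg _)
  -- Every term of the series is nonnegative; the one kept has index `m = 1`, which lies in the
  -- range because `N ≥ 2`.
  refine le_trans (by simp [hw]) (Finset.single_le_sum (fun m _ => h0 m) (Finset.mem_range.2 hN))

/-- The integrand is at most `2/(1 + r²)`, because `1 - exp (-r²) ≤ min 1 r²`; and `2π < 7`. -/
lemma integrable_one_sub_exp_div_sq :
    Integrable (fun r : ℝ => (1 - Real.exp (-r ^ 2)) / r ^ 2) ∧
    0 ≤ ∫ r : ℝ, (1 - Real.exp (-r ^ 2)) / r ^ 2 ∧ ∫ r : ℝ, (1 - Real.exp (-r ^ 2)) / r ^ 2 ≤ 7 := by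
  have h0 : ∀ r : ℝ, 0 ≤ (1 - Real.exp (-r ^ 2)) / r ^ 2 := fun r =>
    div_nonneg (sub_nonneg.2 (Real.exp_le_one_iff.2 (by nlinarith [sq_nonneg r]))) (sq_nonneg r)
  have hle : ∀ r : ℝ, (1 - Real.exp (-r ^ 2)) / r ^ 2 ≤ 2 * (1 + r ^ 2)⁻¹ := fun r => by
    rcases eq_or_ne r 0 with rfl | hr
    · norm_num
    have hr2 : 0 < r ^ 2 := by positivity
    have h1 := Real.add_one_le_exp (-r ^ 2)
    have h2 := Real.exp_pos (-r ^ 2)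
    rw [← div_eq_mul_inv, div_le_div_iff₀ hr2 (by positivity)]
    nlinarith
  have hi : Integrable (fun r : ℝ => (1 - Real.exp (-r ^ 2)) / r ^ 2) :=
    (integrable_inv_one_add_sq.const_mul 2).mono'
      (Measurable.div (by fun_prop) (by fun_prop)).aestronglyMeasurable
      (Eventually.of_forall fun r => by rw [Real.norm_of_nonneg (h0 r)]; exact hle r)
  refine ⟨hi, integral_nonneg h0,
    (integral_mono hi (integrable_inv_one_add_sq.const_mul 2) hle).trans ?_⟩
  rw [integral_const_mul, integral_univ_inv_one_add_sq]
  linarith [Real.pi_lt_d2]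

/-- The substitution `r ↦ a r`. It represents a distance `a` as a mixture of the functions `1 - exp
(-r² a²)`. At `r = 0` both quotients are `0` by convention. -/
lemma integral_one_sub_exp_mul_div_sq {a : ℝ} (ha : 0 ≤ a) :
    Integrable (fun r : ℝ => (1 - Real.exp (-r ^ 2 * a ^ 2)) / r ^ 2) ∧
    ∫ r : ℝ, (1 - Real.exp (-r ^ 2 * a ^ 2)) / r ^ 2
      = a * ∫ r : ℝ, (1 - Real.exp (-r ^ 2)) / r ^ 2 := by
  rcases ha.eq_or_lt with rfl | ha
  · simp
  have e : (fun r : ℝ => (1 - Real.exp (-r ^ 2 * a ^ 2)) / r ^ 2)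
      = fun r => a ^ 2 * ((1 - Real.exp (-(a * r) ^ 2)) / (a * r) ^ 2) := by
    ext r
    rcases eq_or_ne r 0 with rfl | hr
    · simp
    rw [show -(a * r) ^ 2 = -r ^ 2 * a ^ 2 by ring]
    field_simp
  rw [e]
  refine ⟨(integrable_one_sub_exp_div_sq.1.comp_mul_left' ha.ne').const_mul _, ?_⟩
  rw [integral_const_mul, Measure.integral_comp_mul_left
    (fun r : ℝ => (1 - Real.exp (-r ^ 2)) / r ^ 2), abs_of_pos (by positivity)]
  simp only [smul_eq_mul]
  field_simp

end BoundedDim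

/-! ### Pairing the distance with the inner product through Gaussian kernels -/

section BoundedDim

variable {d : ℕ} {μ : Measure (EuclideanSpace ℝ (Fin d))} [IsProbabilityMeasure μ] {τ : ℝ}

/-- The centring terms depend on at most one variable, hence are orthogonal to the degenerate kernel
`xᵀy`. So Cauchy–Schwarz bounds `E D²` from below by a pairing that involves the bare distance only.
-/
lemma integral_distKernel_mul_inner (h : MemLp (fun x : EuclideanSpace ℝ (Fin d) => x) 2 μ)
    (h0 : ∫ x, x ∂μ = 0) :
    ∫ p, distKernel μ p.1 p.2 * inner ℝ p.1 p.2 ∂(μ.prod μ)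
      = ∫ p, ‖p.1 - p.2‖ * inner ℝ p.1 p.2 ∂(μ.prod μ) := by
  have hK := degenKernel_inner h h0
  have hd := memLp_dist h
  set a : EuclideanSpace ℝ (Fin d) → ℝ := fun x => ∫ u, ‖x - u‖ ∂μ with ha
  set c := ∫ p, ‖p.1 - p.2‖ ∂(μ.prod μ) with hc
  have ha2 : MemLp a 2 μ := by
    have := (memLp_integral_slice (π := μ) (K := fun x y : EuclideanSpace ℝ (Fin d) => ‖x - y‖)
      (r := 2) (by norm_num) measurable_dist_kernel
      (by simpa using memLp_dist_slice h) (by simpa using hd)).1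
    simpa using this
  have i1 : Integrable (fun p : EuclideanSpace ℝ (Fin d) × EuclideanSpace ℝ (Fin d) =>
      ‖p.1 - p.2‖ * (inner ℝ p.1 p.2 : ℝ)) (μ.prod μ) := hd.integrable_mul hK.memLp
  have i2 : Integrable (fun p : EuclideanSpace ℝ (Fin d) × EuclideanSpace ℝ (Fin d) =>
      -a p.1 * (inner ℝ p.1 p.2 : ℝ)) (μ.prod μ) := (ha2.comp_fst μ).neg.integrable_mul hK.memLp
  have i3 : Integrable (fun p : EuclideanSpace ℝ (Fin d) × EuclideanSpace ℝ (Fin d) =>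
      -a p.2 * (inner ℝ p.1 p.2 : ℝ)) (μ.prod μ) := (ha2.comp_snd μ).neg.integrable_mul hK.memLp
  have i4 := (hK.memLp.integrable (by norm_num)).const_mul c
  have e : ∀ p : EuclideanSpace ℝ (Fin d) × EuclideanSpace ℝ (Fin d),
      distKernel μ p.1 p.2 * inner ℝ p.1 p.2 = ‖p.1 - p.2‖ * inner ℝ p.1 p.2
        + -a p.1 * inner ℝ p.1 p.2 + -a p.2 * inner ℝ p.1 p.2 + c * inner ℝ p.1 p.2 := fun p => by
    simp only [distKernel, dblCenter, ha, hc]; ring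
  have z2 : ∫ p, -a p.1 * inner ℝ p.1 p.2 ∂(μ.prod μ) = 0 := by
    rw [integral_prod _ i2]
    simp_rw [integral_const_mul, hK.mean]
    simp
  have z3 : ∫ p, -a p.2 * inner ℝ p.1 p.2 ∂(μ.prod μ) = 0 := by
    rw [integral_prod_symm _ i3]
    have : ∀ y : EuclideanSpace ℝ (Fin d), ∫ x, -a y * (inner ℝ x y : ℝ) ∂μ = 0 := fun y => by
      rw [integral_const_mul]
      simp_rw [fun x => hK.symm x y]
      rw [hK.mean, mul_zero]
    exact (integral_congr_ae (Eventually.of_forall this)).trans (integral_zero _ _)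
  have z4 : ∫ p, c * inner ℝ p.1 p.2 ∂(μ.prod μ) = 0 := by
    rw [integral_prod _ i4]
    simp_rw [integral_const_mul, hK.mean]
    simp
  simp_rw [e]
  rw [integral_add₄ i1 i2 i3 i4, z2, z3, z4]
  ring

/-- The condition on `R` leaves at least half of the second moment inside the ball of radius `R`,
where the weight is at least `exp (-1)`. Outside, `‖x‖²` is at most `R^(-(2+4τ)) ‖x‖^(4+4τ)`. -/
lemma integral_weight_normSq_ge {R t : ℝ} (hτ : 0 < τ)
    (h : Integrable (fun x => ‖x‖ ^ (4 + 4 * τ)) μ)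
    (hR : 0 < R) (hRM : 2 * ∫ x, ‖x‖ ^ (4 + 4 * τ) ∂μ ≤ R ^ (2 + 4 * τ) * ∫ x, ‖x‖ ^ 2 ∂μ)
    (ht : 0 < t) (htR : t * R ^ 2 ≤ 1) :
    Real.exp (-1) * ((∫ x, ‖x‖ ^ 2 ∂μ) / 2) ≤ ∫ x, Real.exp (-t * ‖x‖ ^ 2) * ‖x‖ ^ 2 ∂μ := by
  have h2 : MemLp (fun x : EuclideanSpace ℝ (Fin d) => x) 2 μ := by
    simpa using memLp_norm_of_moment (r := 2) hτ h (by linarith)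
  have hRp : 0 < R ^ (2 + 4 * τ) := Real.rpow_pos_of_pos hR _
  have key : ∀ x : EuclideanSpace ℝ (Fin d), Real.exp (-1) * (‖x‖ ^ 2
      - (R ^ (2 + 4 * τ))⁻¹ * ‖x‖ ^ (4 + 4 * τ)) ≤ Real.exp (-t * ‖x‖ ^ 2) * ‖x‖ ^ 2 := fun x => by
    rcases le_total ‖x‖ R with hx | hx
    · have h1 : Real.exp (-1) ≤ Real.exp (-t * ‖x‖ ^ 2) := Real.exp_le_exp.2 (by
        have : ‖x‖ ^ 2 ≤ R ^ 2 := by gcongr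
        nlinarith)
      have h3 : 0 ≤ (R ^ (2 + 4 * τ))⁻¹ * ‖x‖ ^ (4 + 4 * τ) := by positivity
      have h4 := Real.exp_pos (-1)
      nlinarith [sq_nonneg ‖x‖]
    · have h1 : ‖x‖ ^ 2 ≤ (R ^ (2 + 4 * τ))⁻¹ * ‖x‖ ^ (4 + 4 * τ) := by
        rw [inv_mul_eq_div, le_div_iff₀ hRp,
          show (4 + 4 * τ) = ((2 : ℕ) : ℝ) + (2 + 4 * τ) by push_cast; ring,
          Real.rpow_add (hR.trans_le hx), Real.rpow_natCast]
        gcongr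
      have h4 := Real.exp_pos (-1)
      have : 0 ≤ Real.exp (-t * ‖x‖ ^ 2) * ‖x‖ ^ 2 := by positivity
      nlinarith
  have i1 := (h2.norm.integrable_sq.sub (h.const_mul (R ^ (2 + 4 * τ))⁻¹)).const_mul (Real.exp (-1))
  refine le_trans ?_ (integral_mono i1 (integrable_exp_weight_norm_pow ht 2) key)
  simp only [Pi.sub_apply]
  rw [integral_const_mul, integral_sub h2.norm.integrable_sq (h.const_mul _), integral_const_mul]
  have : (R ^ (2 + 4 * τ))⁻¹ * ∫ x, ‖x‖ ^ (4 + 4 * τ) ∂μ ≤ (∫ x, ‖x‖ ^ 2 ∂μ) / 2 := by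
    rw [inv_mul_le_iff₀ hRp]; linarith
  gcongr
  linarith

/-- As `E X₁ᵀX₂ = 0`, the mixture formula turns `-c W` into the integral over `r` of `G(r) = r⁻²
E[exp(-r²‖X₁ - X₂‖²) X₁ᵀX₂]`, which is nonnegative. For `r` between `1/(2R)` and `1/R` it is at
least `s²/(16d)`, and elsewhere its sign suffices. -/
lemma sq_integral_normSq_le_dist_inner {R : ℝ} (hτ : 0 < τ)
    (h : Integrable (fun x => ‖x‖ ^ (4 + 4 * τ)) μ) (h0 : ∫ x, x ∂μ = 0)
    (hR : 0 < R) (hRM : 2 * ∫ x, ‖x‖ ^ (4 + 4 * τ) ∂μ ≤ R ^ (2 + 4 * τ) * ∫ x, ‖x‖ ^ 2 ∂μ) :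
    (∫ x, ‖x‖ ^ 2 ∂μ) ^ 2
      ≤ 224 * d * R * |∫ p, ‖p.1 - p.2‖ * inner ℝ p.1 p.2 ∂(μ.prod μ)| := by
  have h2 : MemLp (fun x : EuclideanSpace ℝ (Fin d) => x) 2 μ := by
    simpa using memLp_norm_of_moment (r := 2) hτ h (by linarith)
  have hK := degenKernel_inner h2 h0
  have hKi := hK.memLp.integrable (by norm_num)
  have hK0 : ∫ p, (inner ℝ p.1 p.2 : ℝ) ∂(μ.prod μ) = 0 := by
    rw [integral_prod _ hKi]; simp_rw [hK.mean]; simp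
  have hd := memLp_dist h2
  set s := ∫ x, ‖x‖ ^ 2 ∂μ with hs
  set W := ∫ p, ‖p.1 - p.2‖ * inner ℝ p.1 p.2 ∂(μ.prod μ) with hW
  obtain ⟨-, c0, c7⟩ := integrable_one_sub_exp_div_sq
  have hcs := fun a ha => integral_one_sub_exp_mul_div_sq (a := a) ha
  set c := ∫ r : ℝ, (1 - Real.exp (-r ^ 2)) / r ^ 2 with hc
  set f : ℝ → EuclideanSpace ℝ (Fin d) × EuclideanSpace ℝ (Fin d) → ℝ := fun r p =>
    (1 - Real.exp (-r ^ 2 * ‖p.1 - p.2‖ ^ 2)) / r ^ 2 * inner ℝ p.1 p.2 with hf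
  have hfm : Measurable (Function.uncurry f) := by
    simp only [hf, Function.uncurry_def]
    exact (Measurable.div (by fun_prop) (by fun_prop)).mul (by fun_prop)
  have hfn : ∀ r p, ‖f r p‖ = (1 - Real.exp (-r ^ 2 * ‖p.1 - p.2‖ ^ 2)) / r ^ 2
      * |(inner ℝ p.1 p.2 : ℝ)| := fun r p => by
    rw [hf, norm_mul, Real.norm_eq_abs (inner ℝ p.1 p.2), Real.norm_of_nonneg]
    exact div_nonneg (sub_nonneg.2 (Real.exp_le_one_iff.2 (by
      nlinarith [mul_nonneg (sq_nonneg r) (sq_nonneg ‖p.1 - p.2‖)]))) (sq_nonneg r)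
  have hfi : Integrable (Function.uncurry f) (volume.prod (μ.prod μ)) := by
    rw [integrable_prod_iff' hfm.aestronglyMeasurable]
    constructor
    · refine Eventually.of_forall fun p => ?_
      exact (hcs ‖p.1 - p.2‖ (norm_nonneg _)).1.mul_const (inner ℝ p.1 p.2)
    simp only [Function.uncurry_apply_pair, hfn]
    simp_rw [integral_mul_const, fun p : EuclideanSpace ℝ (Fin d) × EuclideanSpace ℝ (Fin d) =>
      (hcs ‖p.1 - p.2‖ (norm_nonneg _)).2]
    have := (hd.integrable_mul hK.memLp.abs).const_mul c
    refine this.congr (Eventually.of_forall fun p => ?_)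
    simp only [Pi.mul_apply, Pi.abs_apply]; ring
  have hswap : ∫ r, ∫ p, f r p ∂(μ.prod μ) = c * W := by
    rw [integral_integral_swap hfi, hW, ← integral_const_mul]
    congr 1 with p
    simp only [hf]
    rw [integral_mul_const, (hcs ‖p.1 - p.2‖ (norm_nonneg _)).2]
    ring
  set G : ℝ → ℝ := fun r => -∫ p, f r p ∂(μ.prod μ) with hG
  have hGi : Integrable G := hfi.integral_prod_left.neg
  have hGint : ∫ r, G r = -(c * W) := by rw [hG, integral_neg, hswap]
  have hGe : ∀ r : ℝ, r ≠ 0 → 2 * ∫ p, Real.exp (-r ^ 2 * ‖p.1‖ ^ 2)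
      * Real.exp (-r ^ 2 * ‖p.2‖ ^ 2) * (inner ℝ p.1 p.2) ^ 2 ∂(μ.prod μ) ≤ G r := fun r hr => by
    have hr2 : 0 < r ^ 2 := by positivity
    have h3 := integral_gaussian_inner_ge h2 hr2
    have h4 : Integrable (fun p : EuclideanSpace ℝ (Fin d) × EuclideanSpace ℝ (Fin d) =>
        Real.exp (-r ^ 2 * ‖p.1 - p.2‖ ^ 2) * (inner ℝ p.1 p.2 : ℝ)) (μ.prod μ) := by
      refine hKi.bdd_mul (c := 1) (by fun_prop) (Eventually.of_forall fun p => ?_)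
      rw [Real.norm_of_nonneg (Real.exp_pos _).le, Real.exp_le_one_iff]
      nlinarith [mul_nonneg (sq_nonneg r) (sq_nonneg ‖p.1 - p.2‖)]
    have e : G r = (r ^ 2)⁻¹ * ∫ p, Real.exp (-r ^ 2 * ‖p.1 - p.2‖ ^ 2) * (inner ℝ p.1 p.2)
        ∂(μ.prod μ) := by
      rw [hG]
      have : ∀ p, f r p = (r ^ 2)⁻¹ * ((inner ℝ p.1 p.2 : ℝ)
          - Real.exp (-r ^ 2 * ‖p.1 - p.2‖ ^ 2) * (inner ℝ p.1 p.2)) := fun p => by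
        rw [hf]; field_simp
      simp_rw [this]
      rw [integral_const_mul, integral_sub hKi h4, hK0]; ring
    rw [e, inv_mul_eq_div, le_div_iff₀ hr2]
    linarith
  have hG0 : ∀ r, 0 ≤ G r := fun r => by
    rcases eq_or_ne r 0 with rfl | hr
    · simp [hG, hf]
    · refine le_trans ?_ (hGe r hr)
      exact mul_nonneg zero_le_two (integral_nonneg fun p => by positivity)
  have hs0 : 0 ≤ s := integral_nonneg fun x => by positivity
  have hGl : ∀ r ∈ Set.Icc (1 / (2 * R)) (1 / R), s ^ 2 / 16 ≤ d * G r := fun r hr => by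
    have hr0 : 0 < r := lt_of_lt_of_le (by positivity) hr.1
    have hrR : r * R ≤ 1 := by rw [← le_div_iff₀ hR]; exact hr.2
    have h5 := integral_weight_normSq_ge hτ h hR hRM (t := r ^ 2) (by positivity) (by
      rw [← mul_pow]; exact pow_le_one₀ (by positivity) hrR)
    have h6 := sq_integral_weight_normSq_le (μ := μ) (w := fun x => Real.exp (-r ^ 2 * ‖x‖ ^ 2))
      (by fun_prop) (integrable_exp_weight_norm_pow (by positivity) 2)
    have h7 := hGe r hr0.ne'
    have h8 : (Real.exp (-1) * (s / 2)) ^ 2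
        ≤ (∫ x, Real.exp (-r ^ 2 * ‖x‖ ^ 2) * ‖x‖ ^ 2 ∂μ) ^ 2 := by gcongr
    have h9 : 1 / 8 ≤ Real.exp (-1) ^ 2 := by
      rw [Real.exp_neg, inv_pow, one_div]
      have := Real.exp_one_lt_d9
      gcongr
      nlinarith [Real.exp_pos 1]
    have h10 : (d : ℝ) * (2 * ∫ p, Real.exp (-r ^ 2 * ‖p.1‖ ^ 2)
      * Real.exp (-r ^ 2 * ‖p.2‖ ^ 2) * (inner ℝ p.1 p.2) ^ 2 ∂(μ.prod μ)) ≤ d * G r := by gcongr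
    have h11 : 1 / 8 * (s ^ 2 / 4) ≤ (Real.exp (-1) * (s / 2)) ^ 2 := by
      rw [mul_pow, show (s / 2) ^ 2 = s ^ 2 / 4 by ring]; gcongr
    linarith
  have hfin : s ^ 2 / 16 * (1 / R - 1 / (2 * R)) ≤ d * -(c * W) := by
    rw [← hGint, ← integral_const_mul]
    calc s ^ 2 / 16 * (1 / R - 1 / (2 * R))
        = ∫ r in Set.Icc (1 / (2 * R)) (1 / R), s ^ 2 / 16 := by
          rw [setIntegral_const, smul_eq_mul, Real.volume_real_Icc_of_le (by
            gcongr; linarith), mul_comm]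
      _ ≤ ∫ r in Set.Icc (1 / (2 * R)) (1 / R), d * G r :=
          setIntegral_mono_on (by simp) (hGi.const_mul _).integrableOn measurableSet_Icc hGl
      _ ≤ ∫ r, d * G r := setIntegral_le_integral (hGi.const_mul _)
          (Eventually.of_forall fun r => mul_nonneg (Nat.cast_nonneg d) (hG0 r))
  -- The interval has length `1/(2R)`; together with `c ≤ 7` this yields `224 = 32 · 7`.
  have e2 : s ^ 2 / 16 * (1 / R - 1 / (2 * R)) = s ^ 2 / (32 * R) := by field_simp; ring
  rw [e2, div_le_iff₀ (by positivity)] at hfin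
  have h12 : -(c * W) ≤ 7 * |W| := by
    have := neg_abs_le W
    nlinarith [abs_nonneg W]
  calc s ^ 2 ≤ d * -(c * W) * (32 * R) := hfin
    _ ≤ d * (7 * |W|) * (32 * R) := by gcongr
    _ = _ := by ring

end BoundedDim

/-! ### The Lyapunov ratio in terms of the dimension -/

section BoundedDim

variable {d : ℕ} {μ : Measure (EuclideanSpace ℝ (Fin d))} [IsProbabilityMeasure μ] {τ : ℝ}

/-- Split `‖x‖² = (‖x‖² - s) + s`. The deviation is part of `L`, while `s² ≤ d · momSq` and Jensen
bound the constant by `d^(1+τ) L ≤ d² L`. -/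
lemma integral_norm_rpow_le_momL (hτ : 0 < τ) (hτ2 : τ ≤ 1 / 2)
    (h : Integrable (fun x => ‖x‖ ^ (4 + 4 * τ)) μ) (hd : 1 ≤ d) :
    ∫ x, ‖x‖ ^ (4 + 4 * τ) ∂μ ≤ 128 * d ^ 2 * momL μ τ := by
  have h2 : MemLp (fun x : EuclideanSpace ℝ (Fin d) => x) 2 μ := by
    simpa using memLp_norm_of_moment (r := 2) hτ h (by linarith)
  have hr0 : 0 < 2 + 2 * τ := by linarith
  set s := ∫ x, ‖x‖ ^ 2 ∂μ with hs
  have hs0 : 0 ≤ s := integral_nonneg fun x => by positivity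
  have e : ∀ x : EuclideanSpace ℝ (Fin d), |‖x‖ ^ 2| ^ (2 + 2 * τ) = ‖x‖ ^ (4 + 4 * τ) := fun x => by
    rw [abs_of_nonneg (by positivity), ← Real.rpow_natCast, ← Real.rpow_mul (norm_nonneg _)]
    congr 1; push_cast; ring
  have hsq : MemLp (fun x : EuclideanSpace ℝ (Fin d) => ‖x‖ ^ 2) (ENNReal.ofReal (2 + 2 * τ)) μ :=
    memLp_of_integrable_abs_rpow hr0 (by fun_prop) (by simp_rw [e]; exact h)
  have i1 := integrable_abs_rpow hr0 (hsq.sub (memLp_const s))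
  simp only [Pi.sub_apply] at i1
  have key : ∀ x : EuclideanSpace ℝ (Fin d), ‖x‖ ^ (4 + 4 * τ)
      ≤ 64 * (|‖x‖ ^ 2 - s| ^ (2 + 2 * τ) + s ^ (2 + 2 * τ)) := fun x => by
    have := abs_add₄_rpow_le (r := 2 + 2 * τ) (by linarith) (by linarith) (‖x‖ ^ 2 - s) s 0 0
    rw [abs_zero, Real.zero_rpow hr0.ne', abs_of_nonneg hs0, sub_add_cancel, add_zero, add_zero,
      add_zero, add_zero, e] at this
    exact this
  have h3 := integral_mono h ((i1.add (integrable_const (s ^ (2 + 2 * τ)))).const_mul 64) key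
  simp only [Pi.add_apply] at h3
  rw [integral_const_mul, integral_add i1 (integrable_const _)] at h3
  simp only [integral_const, probReal_univ, one_smul] at h3
  have h4 : s ^ (2 + 2 * τ) ≤ d ^ 2 * momL μ τ := by
    have h5 := sq_integral_normSq_le h2
    rw [← hs] at h5
    have hS0 : 0 ≤ momSq μ := integral_nonneg fun p => sq_nonneg _
    have hd1 : (1 : ℝ) ≤ d := by exact_mod_cast hd
    calc s ^ (2 + 2 * τ) = (s ^ 2) ^ (1 + τ) := by
          rw [← Real.rpow_natCast, ← Real.rpow_mul hs0]; congr 1; push_cast; ring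
      _ ≤ (d * momSq μ) ^ (1 + τ) := by gcongr
      _ = (d : ℝ) ^ (1 + τ) * momSq μ ^ (1 + τ) := Real.mul_rpow (by positivity) hS0
      _ ≤ (d : ℝ) ^ (2 : ℝ) * momL μ τ := by
          gcongr
          · linarith
          · exact momSq_rpow_le hτ h
      _ = _ := by norm_cast
  have h5 : ∫ x, |‖x‖ ^ 2 - s| ^ (2 + 2 * τ) ∂μ ≤ momL μ τ := by
    unfold momL
    have : 0 ≤ ∫ z, |inner ℝ z.1 z.2| ^ (2 + 2 * τ) ∂(μ.prod μ) :=
      integral_nonneg fun x => by positivity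
    rw [← hs]; linarith
  have h6 : momL μ τ ≤ d ^ 2 * momL μ τ :=
    le_mul_of_one_le_left momL_nonneg (one_le_pow₀ (by exact_mod_cast hd))
  linarith

lemma rpow_le_rpow_add_rpow {a R u v : ℝ} (ha : 0 ≤ a) (hR : 0 < R) (hu : 2 ≤ u) (huv : u ≤ v) :
    a ^ u ≤ R ^ (u - v) * a ^ v + R ^ (u - 2) * a ^ 2 := by
  rcases le_total a R with h | h
  · have : a ^ u ≤ R ^ (u - 2) * a ^ 2 := by
      rw [← Real.rpow_natCast a 2, show a ^ u = a ^ ((u - 2) + ((2 : ℕ) : ℝ)) by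
        congr 1; push_cast; ring, Real.rpow_add_of_nonneg ha (by linarith) (by positivity)]
      gcongr
    have : 0 ≤ R ^ (u - v) * a ^ v := by positivity
    linarith
  · have ha' := hR.trans_le h
    have : a ^ u ≤ R ^ (u - v) * a ^ v := by
      rw [show a ^ u = a ^ (u - v) * a ^ v by rw [← Real.rpow_add ha']; congr 1; ring]
      exact mul_le_mul_of_nonneg_right
        (Real.rpow_le_rpow_of_nonpos hR h (by linarith)) (by positivity)
    have : 0 ≤ R ^ (u - 2) * a ^ 2 := by positivity
    linarith

/-- The pairing bound gives `s² ≤ (224 d R)² v`, so `S^(1+τ)` is at most a multiple of `d³ R^(2+2τ)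
v^(1+τ)`. The moment of `D` of order `2 + 2τ` is at most a multiple of `M / R^(2+2τ)`. The powers of
`R` cancel, and `M ≤ 128 d² L` accounts for the remaining factor `d²`. -/
theorem distKernel_bounds_of_dim (hτ : 0 < τ) (hτ2 : τ ≤ 1 / 2)
    (h : Integrable (fun x => ‖x‖ ^ (4 + 4 * τ)) μ) (h0 : ∫ x, x ∂μ = 0) (hS : 0 < momSq μ) :
    0 < ∫ p, distKernel μ p.1 p.2 ^ 2 ∂(μ.prod μ) ∧
      momRatio μ (distKernel μ) τ ≤ 2 ^ 48 * d ^ 5 * (momL μ τ / momSq μ ^ (1 + τ)) := by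
  have h2 : MemLp (fun x : EuclideanSpace ℝ (Fin d) => x) 2 μ := by
    simpa using memLp_norm_of_moment (r := 2) hτ h (by linarith)
  set s := ∫ x, ‖x‖ ^ 2 ∂μ with hs
  set M := ∫ x, ‖x‖ ^ (4 + 4 * τ) ∂μ with hM
  set S := momSq μ with hSdef
  set v := ∫ p, distKernel μ p.1 p.2 ^ 2 ∂(μ.prod μ) with hv
  have hs0 : 0 ≤ s := integral_nonneg fun x => by positivity
  have hSs : S ≤ s ^ 2 := momSq_le h2
  have hsp : 0 < s := by
    rcases hs0.eq_or_lt with h3 | h3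
    · rw [← h3] at hSs; norm_num at hSs; linarith
    · exact h3
  have hd : 1 ≤ d := by
    rcases Nat.eq_zero_or_pos d with rfl | hd
    · have := sq_integral_normSq_le h2
      rw [← hs] at this
      norm_num at this
      linarith
    · exact hd
  have hd1 : (1 : ℝ) ≤ d := by exact_mod_cast hd
  have hML : M ≤ 128 * d ^ 2 * momL μ τ := integral_norm_rpow_le_momL hτ hτ2 h hd
  have hMp : 0 < M := by
    have e : ∀ x : EuclideanSpace ℝ (Fin d), (‖x‖ ^ 2) ^ (2 + 2 * τ) = ‖x‖ ^ (4 + 4 * τ) :=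
      fun x => by
        rw [← Real.rpow_natCast, ← Real.rpow_mul (norm_nonneg _)]
        congr 1; push_cast; ring
    have := rpow_integral_le (μ := μ) (s := 2 + 2 * τ) (f := fun x => ‖x‖ ^ 2) (by linarith)
      (fun x => sq_nonneg _) h2.norm.integrable_sq (by simp_rw [e]; exact h)
    simp_rw [e] at this
    exact lt_of_lt_of_le (Real.rpow_pos_of_pos hsp _) this
  -- The radius making the ball condition an equality. It also balances the two terms of `b3`: they
  -- are `M` and `2M` over `R^(2+2τ)`, hence the factor `3`.
  set R := (2 * M / s) ^ (2 + 4 * τ)⁻¹ with hRdef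
  have hR : 0 < R := by positivity
  have hRp : R ^ (2 + 4 * τ) = 2 * M / s := Real.rpow_inv_rpow (by positivity) (by linarith)
  have hW := sq_integral_normSq_le_dist_inner hτ h h0 hR (by
    rw [hRp, ← hs, ← hM, div_mul_cancel₀ _ hsp.ne'])
  have hWv := sq_integral_mul_le (degenKernel_distKernel h2).memLp (degenKernel_inner h2 h0).memLp
  rw [integral_distKernel_mul_inner h2 h0] at hWv
  set W := ∫ p, ‖p.1 - p.2‖ * inner ℝ p.1 p.2 ∂(μ.prod μ) with hWdef
  change W ^ 2 ≤ v * S at hWv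
  rw [← hs] at hW
  have hvl : s ^ 2 ≤ (224 * d * R) ^ 2 * v := by
    have h3 : (s ^ 2) ^ 2 ≤ (224 * d * R) ^ 2 * W ^ 2 := by
      rw [← sq_abs W, ← mul_pow]; gcongr
    have h4 : W ^ 2 ≤ v * s ^ 2 :=
      hWv.trans (mul_le_mul_of_nonneg_left hSs (integral_nonneg fun p => sq_nonneg _))
    have h5 : (s ^ 2) * s ^ 2 ≤ ((224 * d * R) ^ 2 * v) * s ^ 2 := by
      calc s ^ 2 * s ^ 2 = (s ^ 2) ^ 2 := by ring
        _ ≤ (224 * d * R) ^ 2 * W ^ 2 := h3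
        _ ≤ (224 * d * R) ^ 2 * (v * s ^ 2) := by gcongr
        _ = _ := by ring
    exact le_of_mul_le_mul_right h5 (by positivity)
  have hvp : 0 < v := by
    by_contra hneg
    have : (224 * d * R) ^ 2 * v ≤ 0 := mul_nonpos_of_nonneg_of_nonpos (sq_nonneg _) (not_lt.1 hneg)
    nlinarith
  refine ⟨hvp, ?_⟩
  have hSp : 0 < S ^ (1 + τ) := by positivity
  unfold momRatio
  rw [← hv, div_le_iff₀ (by positivity)]
  have hr' := memLp_norm_of_moment (r := 2 + 2 * τ) hτ h (by linarith)
  have hri := integrable_abs_rpow (by linarith) hr'.norm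
  simp only [abs_norm] at hri
  have b1 := (memLp_distKernel (r := 2 + 2 * τ) (by linarith) (by linarith) hr').2
  have b2 : ∫ p, ‖p.1 - p.2‖ ^ (2 + 2 * τ) ∂(μ.prod μ) ≤ 128 * ∫ x, ‖x‖ ^ (2 + 2 * τ) ∂μ := by
    have key : ∀ p : EuclideanSpace ℝ (Fin d) × EuclideanSpace ℝ (Fin d),
        ‖p.1 - p.2‖ ^ (2 + 2 * τ) ≤ 64 * (‖p.1‖ ^ (2 + 2 * τ) + ‖p.2‖ ^ (2 + 2 * τ)) := fun p => by
      have := abs_add₄_rpow_le (r := 2 + 2 * τ) (by linarith) (by linarith) ‖p.1‖ ‖p.2‖ 0 0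
      rw [abs_zero, Real.zero_rpow (by linarith), abs_norm, abs_norm, add_zero, add_zero, add_zero,
        add_zero, abs_of_nonneg (by positivity)] at this
      refine le_trans ?_ this
      gcongr
      exact norm_sub_le _ _
    refine (integral_mono_of_nonneg (Eventually.of_forall fun p => by positivity)
      (((hri.comp_fst μ).add (hri.comp_snd μ)).const_mul 64) (Eventually.of_forall key)).trans_eq ?_
    simp only [Pi.add_apply]
    rw [integral_const_mul, integral_add (hri.comp_fst μ) (hri.comp_snd μ),
      integral_fun_fst (fun x : EuclideanSpace ℝ (Fin d) => ‖x‖ ^ (2 + 2 * τ)),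
      integral_fun_snd (fun x : EuclideanSpace ℝ (Fin d) => ‖x‖ ^ (2 + 2 * τ))]
    simp only [probReal_univ, one_smul]
    ring
  have b3 : ∫ x, ‖x‖ ^ (2 + 2 * τ) ∂μ ≤ 3 * M / R ^ (2 + 2 * τ) := by
    have i1 := (h.const_mul (R ^ ((2 + 2 * τ) - (4 + 4 * τ)))).add
      (h2.norm.integrable_sq.const_mul (R ^ (2 + 2 * τ - 2)))
    refine (integral_mono hri i1 fun x => rpow_le_rpow_add_rpow (norm_nonneg x) hR (by linarith)
      (by linarith)).trans_eq ?_
    simp only [Pi.add_apply]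
    rw [integral_add (h.const_mul _) (h2.norm.integrable_sq.const_mul _), integral_const_mul,
      integral_const_mul, ← hs, ← hM]
    have e1 : R ^ (2 + 2 * τ - 2) = R ^ (2 + 4 * τ) / R ^ (2 + 2 * τ) := by
      rw [← Real.rpow_sub hR]; congr 1; ring
    have e2 : R ^ (2 + 2 * τ - (4 + 4 * τ)) = (R ^ (2 + 2 * τ))⁻¹ := by
      rw [← Real.rpow_neg hR.le]; congr 1; ring
    rw [e1, e2, hRp]
    field_simp
    ring
  have b4 : S ^ (1 + τ) ≤ 224 ^ 3 * d ^ 3 * R ^ (2 + 2 * τ) * v ^ (1 + τ) := by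
    have hRr : (R ^ 2) ^ (1 + τ) = R ^ (2 + 2 * τ) := by
      rw [← Real.rpow_natCast, ← Real.rpow_mul hR.le]; congr 1; push_cast; ring
    have hx : (((224 : ℝ) * d) ^ 2) ^ (1 + τ) ≤ (224 * d) ^ 3 := by
      rw [← Real.rpow_natCast, ← Real.rpow_natCast, ← Real.rpow_mul (by positivity)]
      exact Real.rpow_le_rpow_of_exponent_le (by nlinarith) (by push_cast; linarith)
    calc S ^ (1 + τ) ≤ ((224 * d * R) ^ 2 * v) ^ (1 + τ) := by gcongr; exact hSs.trans hvl
      _ = ((224 * d) ^ 2) ^ (1 + τ) * (R ^ 2) ^ (1 + τ) * v ^ (1 + τ) := by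
          rw [mul_pow, Real.mul_rpow (by positivity) hvp.le,
            Real.mul_rpow (by positivity) (by positivity)]
      _ ≤ (224 * d) ^ 3 * (R ^ 2) ^ (1 + τ) * v ^ (1 + τ) := by gcongr
      _ = _ := by rw [hRr]; ring
  calc ∫ p, |distKernel μ p.1 p.2| ^ (2 + 2 * τ) ∂(μ.prod μ)
      ≤ 256 * (128 * (3 * M / R ^ (2 + 2 * τ))) := by linarith
    _ = 98304 * M / R ^ (2 + 2 * τ) * S ^ (1 + τ) / S ^ (1 + τ) := by field_simp; ring
    _ ≤ 98304 * (128 * d ^ 2 * momL μ τ) / R ^ (2 + 2 * τ)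
          * (224 ^ 3 * d ^ 3 * R ^ (2 + 2 * τ) * v ^ (1 + τ)) / S ^ (1 + τ) := by
        have := momL_nonneg (μ := μ) (τ := τ)
        gcongr
    _ = (98304 * 128 * 224 ^ 3) * (d ^ 5 * (momL μ τ / S ^ (1 + τ)) * v ^ (1 + τ)) := by
        field_simp
    _ ≤ 2 ^ 48 * (d ^ 5 * (momL μ τ / S ^ (1 + τ)) * v ^ (1 + τ)) := by
        have := momL_nonneg (μ := μ) (τ := τ)
        gcongr
        norm_num
    _ = _ := by ring

end BoundedDim

/-! ### Algebra of `U`-centring -/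

section UCentering

variable {n : ℕ}

/-- The off-diagonal row sums of a matrix. -/
noncomputable def rowSum (A : Fin n → Fin n → ℝ) (k : Fin n) : ℝ := ∑ l, if k = l then 0 else A k l

lemma sum_rowSum (A : Fin n → Fin n → ℝ) : ∑ k, rowSum A k = offSum A := rfl

lemma offSum_mul_row (A : Fin n → Fin n → ℝ) (c : Fin n → ℝ) :
    offSum (fun k l => A k l * c k) = ∑ k, rowSum A k * c k := by
  simp only [offSum, rowSum, Finset.sum_mul, ite_mul, zero_mul]

lemma offSum_mul_col {A : Fin n → Fin n → ℝ} (hA : ∀ k l, A k l = A l k) (c : Fin n → ℝ) :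
    offSum (fun k l => A k l * c l) = ∑ k, rowSum A k * c k := by
  rw [← offSum_mul_row]
  unfold offSum
  rw [Finset.sum_comm]
  refine Finset.sum_congr rfl fun k _ => Finset.sum_congr rfl fun l _ => ?_
  simp only [hA l k, eq_comm (a := l)]

lemma rowSum_const (a : ℝ) (k : Fin n) : rowSum (fun _ _ => a) k = (n - 1) * a := by
  have h : ∀ l, (if k = l then 0 else a) = a - if k = l then a else 0 := fun l => by
    split_ifs <;> simp
  simp only [rowSum, h, Finset.sum_sub_distrib]
  simp; ring

lemma rowSum_add (A B : Fin n → Fin n → ℝ) (k : Fin n) :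
    rowSum (fun k l => A k l + B k l) k = rowSum A k + rowSum B k := by
  simp only [rowSum, ← Finset.sum_add_distrib]
  refine Finset.sum_congr rfl fun l _ => ?_
  split_ifs <;> simp

lemma rowSum_col (c : Fin n → ℝ) (k : Fin n) : rowSum (fun _ l => c l) k = ∑ l, c l - c k := by
  have h : ∀ l, (if k = l then 0 else c l) = c l - if k = l then c k else 0 := fun l => by
    split_ifs with h <;> simp [h]
  simp only [rowSum, h, Finset.sum_sub_distrib]
  simp

lemma rowSum_row (c : Fin n → ℝ) (k : Fin n) : rowSum (fun k _ => c k) k = (n - 1) * c k :=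
  rowSum_const (c k) k

/-- The `U`-centred entries of a symmetric matrix, in terms of its off-diagonal sums. -/
noncomputable def uMat (A : Fin n → Fin n → ℝ) (k l : Fin n) : ℝ :=
  A k l + -(rowSum A k / (n - 2)) + -(rowSum A l / (n - 2)) + offSum A / ((n - 1) * (n - 2))

lemma uMat_symm {A : Fin n → Fin n → ℝ} (hA : ∀ k l, A k l = A l k) (k l : Fin n) :
    uMat A k l = uMat A l k := by
  unfold uMat
  rw [hA k l]; ring

lemma rowSum_uMat (hn : 3 ≤ n) (A : Fin n → Fin n → ℝ) (k : Fin n) : rowSum (uMat A) k = 0 := by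
  have h3 : (3 : ℝ) ≤ n := by exact_mod_cast hn
  have e : rowSum (uMat A) k = rowSum A k + (n - 1) * -(rowSum A k / (n - 2))
      + (∑ l, -(rowSum A l / (n - 2)) - -(rowSum A k / (n - 2)))
      + (n - 1) * (offSum A / ((n - 1) * (n - 2))) := by
    unfold uMat
    rw [rowSum_add, rowSum_add, rowSum_add, rowSum_const, rowSum_row, rowSum_col]
  rw [e, Finset.sum_neg_distrib, ← Finset.sum_div, sum_rowSum]
  have h1 : (n : ℝ) - 1 ≠ 0 := by linarith
  have h2 : (n : ℝ) - 2 ≠ 0 := by linarith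
  field_simp
  ring

/-- A U-centred matrix has zero off-diagonal row sums, so it is orthogonal to constants and to
functions of one index. Hence only one of the two factors needs to be expanded. -/
lemma offSum_uMat_mul_uMat (hn : 3 ≤ n) {A E : Fin n → Fin n → ℝ} (hA : ∀ k l, A k l = A l k)
    (hE : ∀ k l, E k l = E l k) :
    offSum (fun k l => uMat A k l * uMat E k l) = offSum (fun k l => A k l * E k l)
      - 2 / (n - 2) * ∑ k, rowSum A k * rowSum E k
      + offSum A * offSum E / ((n - 1) * (n - 2)) := by
  have hz : ∀ c : Fin n → ℝ, ∑ k, rowSum (uMat A) k * c k = 0 := fun c =>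
    Finset.sum_eq_zero fun k _ => by rw [rowSum_uMat hn, zero_mul]
  have e1 : offSum (fun k l => uMat A k l * uMat E k l) = offSum (fun k l => uMat A k l * E k l) := by
    have : (fun k l => uMat A k l * uMat E k l) = fun k l => uMat A k l * E k l
        + uMat A k l * -(rowSum E k / (n - 2)) + uMat A k l * -(rowSum E l / (n - 2))
        + uMat A k l * (offSum E / ((n - 1) * (n - 2))) := by
      ext k l
      rw [← mul_add, ← mul_add, ← mul_add]
      rfl
    rw [this, offSum_add, offSum_add, offSum_add, offSum_mul_row _ fun k => -(rowSum E k / (n - 2)),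
      offSum_mul_col (uMat_symm hA) fun k => -(rowSum E k / (n - 2)),
      offSum_mul_row _ fun _ => offSum E / ((n - 1) * (n - 2)), hz, add_zero, add_zero,
      hz fun _ => offSum E / ((n - 1) * (n - 2)), add_zero]
  have e2 : (fun k l => uMat A k l * E k l) = fun k l => A k l * E k l
      + E k l * -(rowSum A k / (n - 2)) + E k l * -(rowSum A l / (n - 2))
      + E k l * (offSum A / ((n - 1) * (n - 2))) := by
    ext k l
    unfold uMat; ring
  rw [e1, e2, offSum_add, offSum_add, offSum_add, offSum_mul_row _ fun k => -(rowSum A k / (n - 2)),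
    offSum_mul_col hE fun k => -(rowSum A k / (n - 2)),
    offSum_mul_row _ fun _ => offSum A / ((n - 1) * (n - 2)), ← Finset.sum_mul, sum_rowSum]
  have e3 : ∑ k, rowSum E k * -(rowSum A k / (n - 2))
      = -(1 / (n - 2)) * ∑ k, rowSum A k * rowSum E k := by
    rw [Finset.mul_sum]
    exact Finset.sum_congr rfl fun k _ => by ring
  rw [e3]
  ring

/-- U-centring annihilates `β k + β l`: the divisors `n - 2` and `(n - 1)(n - 2)` are exactly those
suited to a matrix `a` with zero diagonal. The diagonal of `A` is irrelevant, which matters because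
the centred kernel does not vanish there. -/
lemma uCenter_eq_uMat (hn : 3 ≤ n) {a A : Fin n → Fin n → ℝ} {β : Fin n → ℝ}
    (hA : ∀ k l, A k l = A l k) (h0 : ∀ k, a k k = 0)
    (ha : ∀ k l, k ≠ l → a k l = A k l + β k + β l) {k l : Fin n} (hkl : k ≠ l) :
    uCenter a k l = uMat A k l := by
  have h3 : (3 : ℝ) ≤ n := by exact_mod_cast hn
  have hs : ∀ k l, a k l = a l k := fun k l => by
    rcases eq_or_ne k l with rfl | h
    · rfl
    · rw [ha k l h, ha l k h.symm, hA k l]; ring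
  have hrow : ∀ k, ∑ j, a k j = rowSum A k + (n - 1) * β k + (∑ l, β l - β k) := fun k => by
    rw [← rowSum_row β k, ← rowSum_col β k, ← rowSum_add, ← rowSum_add]
    refine Finset.sum_congr rfl fun l _ => ?_
    split_ifs with h
    · rw [← h, h0]
    · exact ha k l h
  have htot : ∑ i, ∑ j, a i j = offSum A + (2 * n - 2) * ∑ l, β l := by
    simp_rw [hrow]
    rw [Finset.sum_add_distrib, Finset.sum_add_distrib, sum_rowSum, ← Finset.mul_sum,
      Finset.sum_sub_distrib]
    simp
    ring
  unfold uCenter uMat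
  simp_rw [fun i => hs i l]
  rw [hrow, hrow, htot, hs l k, ha k l hkl]
  have h1 : (n : ℝ) - 1 ≠ 0 := by linarith
  have h2 : (n : ℝ) - 2 ≠ 0 := by linarith
  field_simp
  ring

lemma distKernel_symm {d : ℕ} (ρ : Measure (EuclideanSpace ℝ (Fin d)))
    (x y : EuclideanSpace ℝ (Fin d)) : distKernel ρ x y = distKernel ρ y x := by
  simp only [distKernel, dblCenter, norm_sub_rev x y]; ring

lemma uCenter_pairDist (hn : 3 ≤ n) {d : ℕ} (ρ : Measure (EuclideanSpace ℝ (Fin d)))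
    (z : Fin n → EuclideanSpace ℝ (Fin d)) {k l : Fin n} (hkl : k ≠ l) :
    uCenter (pairDist z) k l = uMat (fun k l => distKernel ρ (z k) (z l)) k l := by
  refine uCenter_eq_uMat hn (fun k l => distKernel_symm ρ (z k) (z l)) (fun k => by simp [pairDist])
    (β := fun k => (∫ u, ‖z k - u‖ ∂ρ) - (∫ p, ‖p.1 - p.2‖ ∂(ρ.prod ρ)) / 2) (fun k l _ => ?_) hkl
  unfold distKernel dblCenter pairDist
  ring

/-- The unbiased estimator of the distance covariance in terms of the centred distance kernels. -/
lemma sampleDCov_eq {p q : ℕ} (hn : 3 ≤ n) {μ : Measure (EuclideanSpace ℝ (Fin p))}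
    {ν : Measure (EuclideanSpace ℝ (Fin q))} (x : Fin n → EuclideanSpace ℝ (Fin p))
    (y : Fin n → EuclideanSpace ℝ (Fin q)) :
    sampleDCov x y = 1 / ((n : ℝ) * ((n : ℝ) - 3))
      * (offSum (fun k l => distKernel μ (x k) (x l) * distKernel ν (y k) (y l))
      - 2 / (n - 2) * ∑ k, rowSum (fun k l => distKernel μ (x k) (x l)) k
        * rowSum (fun k l => distKernel ν (y k) (y l)) k
      + offSum (fun k l => distKernel μ (x k) (x l)) * offSum (fun k l => distKernel ν (y k) (y l))
        / ((n - 1) * (n - 2))) := by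
  rw [← offSum_uMat_mul_uMat hn (fun k l => distKernel_symm μ (x k) (x l))
    (fun k l => distKernel_symm ν (y k) (y l))]
  unfold sampleDCov offSum
  congr 1
  refine Finset.sum_congr rfl fun k _ => Finset.sum_congr rfl fun l _ => ?_
  by_cases h : k = l
  · simp [h]
  · rw [if_pos h, if_neg h, uCenter_pairDist hn μ x h, uCenter_pairDist hn ν y h]

end UCentering

/-! ### Remainder terms of the sample statistics -/

section Remainders

variable {α β : Type*} [MeasurableSpace α] [MeasurableSpace β] {π : Measure α} {ρ : Measure β}
  [IsProbabilityMeasure π] [IsProbabilityMeasure ρ] {H : α → α → ℝ} {G : β → β → ℝ} {n : ℕ}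

/-- A row sum is a weighted degenerate sum with weights supported on that row, so the general
variance bound covers it. -/
lemma rowSum_eq_offSum (A : Fin n → Fin n → ℝ) (k : Fin n) :
    rowSum A k = offSum fun i j => (if i = k then 1 else 0) * A i j := by
  unfold offSum
  rw [Finset.sum_eq_single k (fun i _ hi => by simp [hi]) (by simp)]
  simp [rowSum]

lemma offSum_indicator_row (k : Fin n) :
    offSum (fun i _ : Fin n => (if i = k then (1 : ℝ) else 0) ^ 2) = n - 1 := by
  have h := rowSum_eq_offSum (fun _ _ : Fin n => (1 : ℝ)) k
  rw [rowSum_const] at h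
  simp only [mul_one] at h
  rw [h]
  congr 1 with i j
  split_ifs <;> simp

lemma integrable_offSum {K : α → α → ℝ} (hK : Integrable (fun p : α × α => K p.1 p.2) (π.prod π)) :
    Integrable (fun w : Fin n → α => offSum fun k l => K (w k) (w l)) (Measure.pi fun _ => π) := by
  have h := memLp_offSum (memLp_one_iff_integrable.2 hK) fun _ _ : Fin n => (1 : ℝ)
  simp only [one_mul] at h
  exact memLp_one_iff_integrable.1 h

lemma DegenKernel.memLp_rowSum (hH : DegenKernel π H) (k : Fin n) :
    MemLp (fun w : Fin n → α => rowSum (fun k l => H (w k) (w l)) k) 2 (Measure.pi fun _ => π) := by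
  simp_rw [rowSum_eq_offSum]
  exact memLp_offSum hH.memLp _

lemma DegenKernel.memLp_offSum_one (hH : DegenKernel π H) :
    MemLp (fun w : Fin n → α => offSum fun k l => H (w k) (w l)) 2 (Measure.pi fun _ => π) := by
  simpa using memLp_offSum hH.memLp fun _ _ : Fin n => 1

lemma DegenKernel.integral_sq_rowSum_le (hH : DegenKernel π H) (k : Fin n) :
    ∫ w, rowSum (fun k l => H (w k) (w l)) k ^ 2 ∂(Measure.pi fun _ : Fin n => π)
      ≤ 2 * (n - 1) * ∫ p, H p.1 p.2 ^ 2 ∂(π.prod π) := by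
  simp_rw [rowSum_eq_offSum]
  have := hH.integral_sq_offSum_le fun i _ : Fin n => if i = k then (1 : ℝ) else 0
  rwa [offSum_indicator_row] at this

lemma DegenKernel.integral_sum_sq_rowSum_le (hH : DegenKernel π H) :
    ∫ w, ∑ k, rowSum (fun k l => H (w k) (w l)) k ^ 2 ∂(Measure.pi fun _ : Fin n => π)
      ≤ 2 * (n * (n - 1)) * ∫ p, H p.1 p.2 ^ 2 ∂(π.prod π) := by
  rw [integral_finsetSum _ fun k _ => (hH.memLp_rowSum k).integrable_sq]
  refine (Finset.sum_le_sum fun k _ => hH.integral_sq_rowSum_le k).trans_eq ?_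
  simp; ring

lemma DegenKernel.integral_sq_offSum_one_le (hH : DegenKernel π H) :
    ∫ w, (offSum fun k l => H (w k) (w l)) ^ 2 ∂(Measure.pi fun _ : Fin n => π)
      ≤ 2 * (n * (n - 1)) * ∫ p, H p.1 p.2 ^ 2 ∂(π.prod π) := by
  have := hH.integral_sq_offSum_le fun _ _ : Fin n => (1 : ℝ)
  simpa [offSum_const] using this

lemma memLp_two_mul_prod {α β : Type*} [MeasurableSpace α] [MeasurableSpace β] {π : Measure α}
    {ρ : Measure β} [SFinite π] [SFinite ρ] {f : α → ℝ} {g : β → ℝ} (hf : MemLp f 2 π)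
    (hg : MemLp g 2 ρ) : MemLp (fun p : α × β => f p.1 * g p.2) 2 (π.prod ρ) := by
  have hm : AEStronglyMeasurable (fun p : α × β => f p.1 * g p.2) (π.prod ρ) :=
    hf.aestronglyMeasurable.comp_fst.mul hg.aestronglyMeasurable.comp_snd
  rw [memLp_two_iff_integrable_sq hm]
  simp_rw [mul_pow]
  exact hf.integrable_sq.mul_prod hg.integrable_sq

/-- For a fixed first sample, this is a weighted degenerate sum in the second one whose weights are
the row sums of `H`. The weighted variance bound is applied there, and then integrated over the
first sample. -/
lemma integral_sq_sum_rowSum_mul_le (hH : DegenKernel π H) (hG : DegenKernel ρ G) (hn : 1 ≤ n) :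
    MemLp (fun z : (Fin n → α) × (Fin n → β) => ∑ k, rowSum (fun k l => H (z.1 k) (z.1 l)) k
      * rowSum (fun k l => G (z.2 k) (z.2 l)) k) 2
      ((Measure.pi fun _ => π).prod (Measure.pi fun _ => ρ)) ∧
    ∫ z, (∑ k, rowSum (fun k l => H (z.1 k) (z.1 l)) k * rowSum (fun k l => G (z.2 k) (z.2 l)) k) ^ 2
        ∂((Measure.pi fun _ : Fin n => π).prod (Measure.pi fun _ : Fin n => ρ))
      ≤ 4 * (n * (n - 1) ^ 2) * ((∫ p, H p.1 p.2 ^ 2 ∂(π.prod π)) * ∫ p, G p.1 p.2 ^ 2 ∂(ρ.prod ρ)) := by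
  have hn1 : (1 : ℝ) ≤ n := by exact_mod_cast hn
  have hm : MemLp (fun z : (Fin n → α) × (Fin n → β) => ∑ k, rowSum (fun k l => H (z.1 k) (z.1 l)) k
      * rowSum (fun k l => G (z.2 k) (z.2 l)) k) 2
      ((Measure.pi fun _ => π).prod (Measure.pi fun _ => ρ)) :=
    memLp_finsetSum _ fun k _ => memLp_two_mul_prod (hH.memLp_rowSum k) (hG.memLp_rowSum k)
  refine ⟨hm, ?_⟩
  rw [integral_prod _ hm.integrable_sq]
  set w := ∫ p, G p.1 p.2 ^ 2 ∂(ρ.prod ρ) with hw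
  have hw0 : 0 ≤ w := integral_nonneg fun p => sq_nonneg _
  have hin : ∀ x : Fin n → α, ∫ y, (∑ k, rowSum (fun k l => H (x k) (x l)) k
      * rowSum (fun k l => G (y k) (y l)) k) ^ 2 ∂(Measure.pi fun _ : Fin n => ρ)
      ≤ (2 * (n - 1) * w) * ∑ k, rowSum (fun k l => H (x k) (x l)) k ^ 2 := fun x => by
    have h1 := hG.integral_sq_offSum_le fun i _ : Fin n => rowSum (fun k l => H (x k) (x l)) i
    have e1 : ∀ y : Fin n → β, (offSum fun k l => rowSum (fun k l => H (x k) (x l)) k * G (y k) (y l))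
        = ∑ k, rowSum (fun k l => H (x k) (x l)) k * rowSum (fun k l => G (y k) (y l)) k := fun y => by
      have := offSum_mul_row (fun k l => G (y k) (y l)) (rowSum (fun k l => H (x k) (x l)))
      simp_rw [mul_comm (G _ _)] at this
      rw [this]
      simp_rw [mul_comm]
    have e2 : (offSum fun i _ : Fin n => rowSum (fun k l => H (x k) (x l)) i ^ 2)
        = (n - 1) * ∑ k, rowSum (fun k l => H (x k) (x l)) k ^ 2 := by
      rw [← sum_rowSum, Finset.mul_sum]
      exact Finset.sum_congr rfl fun k _ => rowSum_row _ k
    simp_rw [e1] at h1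
    rw [e2] at h1
    refine h1.trans_eq ?_
    ring
  have hr := integrable_finsetSum (μ := Measure.pi fun _ : Fin n => π) Finset.univ
    fun k _ => (hH.memLp_rowSum k).integrable_sq
  refine (integral_mono hm.integrable_sq.integral_prod_left (hr.const_mul (2 * (n - 1) * w))
    hin).trans ?_
  rw [integral_const_mul]
  have h2 := hH.integral_sum_sq_rowSum_le (n := n)
  calc _ ≤ 2 * (n - 1) * w * (2 * (n * (n - 1)) * ∫ p, H p.1 p.2 ^ 2 ∂(π.prod π)) := by
        gcongr
    _ = _ := by ring

/-- The part of `n (n - 3) V_n^*` that is not the leading `U`-statistic. -/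
noncomputable def covRem (A E : Fin n → Fin n → ℝ) : ℝ :=
  -(2 / (n - 2)) * ∑ k, rowSum A k * rowSum E k + (((n - 1) * (n - 2) : ℝ))⁻¹ * (offSum A * offSum E)

/-- The second moment is of order `n`, against order `n²` for the leading sum. The sample size `6`
is large enough for `n ≤ 2(n - 2)`, and `160 = 128 + 32` adds the two terms. -/
lemma integral_sq_covRem_le (hH : DegenKernel π H) (hG : DegenKernel ρ G) (hn : 6 ≤ n) :
    MemLp (fun z : (Fin n → α) × (Fin n → β) => covRem (fun k l => H (z.1 k) (z.1 l))
      fun k l => G (z.2 k) (z.2 l)) 2 ((Measure.pi fun _ => π).prod (Measure.pi fun _ => ρ)) ∧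
    ∫ z, covRem (fun k l => H (z.1 k) (z.1 l)) (fun k l => G (z.2 k) (z.2 l)) ^ 2
        ∂((Measure.pi fun _ : Fin n => π).prod (Measure.pi fun _ : Fin n => ρ))
      ≤ 160 * (n - 1) * ((∫ p, H p.1 p.2 ^ 2 ∂(π.prod π)) * ∫ p, G p.1 p.2 ^ 2 ∂(ρ.prod ρ)) := by
  have hn6 : (6 : ℝ) ≤ n := by exact_mod_cast hn
  obtain ⟨m1, b1⟩ := integral_sq_sum_rowSum_mul_le hH hG (n := n) (by omega)
  have m2 := memLp_two_mul_prod (hH.memLp_offSum_one (n := n)) (hG.memLp_offSum_one (n := n))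
  have b2 : ∫ z, ((offSum fun k l => H (z.1 k) (z.1 l)) * offSum fun k l => G (z.2 k) (z.2 l)) ^ 2
      ∂((Measure.pi fun _ : Fin n => π).prod (Measure.pi fun _ : Fin n => ρ))
      ≤ 4 * (n * (n - 1)) ^ 2
        * ((∫ p, H p.1 p.2 ^ 2 ∂(π.prod π)) * ∫ p, G p.1 p.2 ^ 2 ∂(ρ.prod ρ)) := by
    simp_rw [mul_pow]
    rw [integral_prod_mul (fun x : Fin n → α => (offSum fun k l => H (x k) (x l)) ^ 2)
      (fun y : Fin n → β => (offSum fun k l => G (y k) (y l)) ^ 2)]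
    refine (mul_le_mul hH.integral_sq_offSum_one_le hG.integral_sq_offSum_one_le
      (integral_nonneg fun y => sq_nonneg _) ?_).trans_eq ?_
    · have : (0 : ℝ) ≤ n - 1 := by linarith
      exact mul_nonneg (by positivity) (integral_nonneg fun p => sq_nonneg _)
    · ring
  set V := (∫ p, H p.1 p.2 ^ 2 ∂(π.prod π)) * ∫ p, G p.1 p.2 ^ 2 ∂(ρ.prod ρ) with hV
  have hV0 : 0 ≤ V :=
    mul_nonneg (integral_nonneg fun p => sq_nonneg _) (integral_nonneg fun p => sq_nonneg _)
  have hm := (m1.const_mul (-(2 / ((n : ℝ) - 2)))).add (m2.const_mul (((n - 1) * (n - 2) : ℝ))⁻¹)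
  refine ⟨hm, ?_⟩
  have i1 := (m1.integrable_sq.const_mul (2 * (2 / ((n : ℝ) - 2)) ^ 2)).add
    (m2.integrable_sq.const_mul (2 * ((((n - 1) * (n - 2) : ℝ))⁻¹) ^ 2))
  refine (integral_mono hm.integrable_sq i1 fun z => ?_).trans ?_
  · simp only [Pi.add_apply]
    set a := ∑ k, rowSum (fun k l => H (z.1 k) (z.1 l)) k * rowSum (fun k l => G (z.2 k) (z.2 l)) k
    set b := (offSum fun k l => H (z.1 k) (z.1 l)) * offSum fun k l => G (z.2 k) (z.2 l)
    nlinarith [sq_nonneg (-(2 / ((n : ℝ) - 2)) * a - (((n - 1) * (n - 2) : ℝ))⁻¹ * b)]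
  simp only [Pi.add_apply]
  rw [integral_add (m1.integrable_sq.const_mul _) (m2.integrable_sq.const_mul _),
    integral_const_mul, integral_const_mul]
  have hA : 2 * (2 / ((n : ℝ) - 2)) ^ 2 * (4 * (n * (n - 1) ^ 2)) ≤ 128 * (n - 1) := by
    rw [div_pow, mul_div_assoc', div_mul_eq_mul_div, div_le_iff₀ (by nlinarith)]
    have h1 : (n : ℝ) * (n - 1) ≤ 4 * (n - 2) ^ 2 := by nlinarith
    nlinarith
  have hB : 2 * ((((n - 1) * (n - 2) : ℝ))⁻¹) ^ 2 * (4 * (n * (n - 1)) ^ 2) ≤ 32 * (n - 1) := by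
    have h1 : (n : ℝ) - 1 ≠ 0 := by linarith
    have h2 : (0 : ℝ) < n - 2 := by linarith
    have e : 2 * ((((n - 1) * (n - 2) : ℝ))⁻¹) ^ 2 * (4 * (n * (n - 1)) ^ 2)
        = 8 * n ^ 2 / (n - 2) ^ 2 := by field_simp; ring
    rw [e, div_le_iff₀ (by positivity)]
    have h3 : (n : ℝ) ^ 2 ≤ 4 * (n - 2) ^ 2 := by nlinarith
    nlinarith
  calc _ ≤ 2 * (2 / ((n : ℝ) - 2)) ^ 2 * (4 * (n * (n - 1) ^ 2) * V)
        + 2 * ((((n - 1) * (n - 2) : ℝ))⁻¹) ^ 2 * (4 * (n * (n - 1)) ^ 2 * V) := by gcongr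
    _ = (2 * (2 / ((n : ℝ) - 2)) ^ 2 * (4 * (n * (n - 1) ^ 2))
        + 2 * ((((n - 1) * (n - 2) : ℝ))⁻¹) ^ 2 * (4 * (n * (n - 1)) ^ 2)) * V := by ring
    _ ≤ (128 * (n - 1) + 32 * (n - 1)) * V := by gcongr
    _ = _ := by ring

lemma abs_normalized_sub_one_le {N O T U v : ℝ} (hN : 3 < N) (hT : 0 ≤ T) (hU : 0 ≤ U)
    (hv : 0 < v) :
    |1 / (N * (N - 3)) * (O + (-(2 / (N - 2)) * T + ((N - 1) * (N - 2))⁻¹ * U)) / v - 1|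
      ≤ (N * (N - 3) * v)⁻¹ * (|O - N * (N - 1) * v| + 2 / (N - 2) * T
        + ((N - 1) * (N - 2))⁻¹ * U + 2 * N * v) := by
  have h3 : N - 3 ≠ 0 := by linarith
  have hN0 : 0 < N := by linarith
  have hD : 0 < N * (N - 3) * v := mul_pos (mul_pos hN0 (by linarith)) hv
  have hc1 : 0 ≤ 2 / (N - 2) := div_nonneg zero_le_two (by linarith)
  have hc2 : 0 ≤ ((N - 1) * (N - 2))⁻¹ := inv_nonneg.2 (by nlinarith)
  have e : 1 / (N * (N - 3)) * (O + (-(2 / (N - 2)) * T + ((N - 1) * (N - 2))⁻¹ * U)) / v - 1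
      = (N * (N - 3) * v)⁻¹ * ((O - N * (N - 1) * v) + -(2 / (N - 2)) * T
        + ((N - 1) * (N - 2))⁻¹ * U + 2 * N * v) := by
    have : (N * (N - 3) * v)⁻¹ * (N * (N - 3) * v) = 1 := inv_mul_cancel₀ hD.ne'
    have e4 : 1 / (N * (N - 3)) = (N * (N - 3) * v)⁻¹ * v := by field_simp
    rw [e4, mul_right_comm, mul_div_assoc, div_self hv.ne']
    linear_combination this
  rw [e, abs_mul, abs_of_pos (inv_pos.2 hD)]
  gcongr
  refine (abs_add_le _ _).trans (add_le_add ((abs_add_le _ _).trans (add_le_add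
    ((abs_add_le _ _).trans (add_le_add le_rfl ?_)) ?_)) ?_)
  · rw [neg_mul, abs_neg, abs_of_nonneg (mul_nonneg hc1 hT)]
  · rw [abs_of_nonneg (mul_nonneg hc2 hU)]
  · rw [abs_of_nonneg (by positivity)]

/-- Weak law for the unbiased estimator of the second moment of a degenerate kernel. -/
lemma integral_abs_offSum_sq_add_covRem_sub_le (hH : DegenKernel π H) {τ : ℝ} (hτ : 0 < τ)
    (hτ2 : τ ≤ 1 / 2)
    (hr : MemLp (fun p : α × α => H p.1 p.2) (ENNReal.ofReal (2 + 2 * τ)) (π.prod π))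
    (hv : 0 < ∫ p, H p.1 p.2 ^ 2 ∂(π.prod π)) (hn : 6 ≤ n) :
    Integrable (fun w : Fin n → α => (offSum fun k l => H (w k) (w l) * H (w k) (w l))
      + covRem (fun k l => H (w k) (w l)) fun k l => H (w k) (w l)) (Measure.pi fun _ => π) ∧
    ∫ w, |1 / ((n : ℝ) * ((n : ℝ) - 3)) * ((offSum fun k l => H (w k) (w l) * H (w k) (w l))
        + covRem (fun k l => H (w k) (w l)) fun k l => H (w k) (w l))
        / (∫ p, H p.1 p.2 ^ 2 ∂(π.prod π)) - 1| ∂(Measure.pi fun _ : Fin n => π)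
      ≤ 4 * ((n : ℝ) ^ (-τ) * momRatio π H τ) + 2 * √(1032 * ((n : ℝ) ^ (-τ) * momRatio π H τ))
        + 24 / n := by
  have hn6 : (6 : ℝ) ≤ n := by exact_mod_cast hn
  have hn0 : (0 : ℝ) < n := by linarith
  set v := ∫ p, H p.1 p.2 ^ 2 ∂(π.prod π) with hvdef
  set κ := momRatio π H τ with hκ
  have hκ0 : 0 ≤ κ := div_nonneg (integral_nonneg fun p => by positivity) (by positivity)
  have e1 : ∀ p : α × α, (H p.1 p.2 * H p.1 p.2) ^ (1 + τ) = |H p.1 p.2| ^ (2 + 2 * τ) := fun p => by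
    rw [← abs_mul_abs_self, ← sq, ← Real.rpow_natCast, ← Real.rpow_mul (abs_nonneg _)]
    congr 1; push_cast; ring
  have hm : ∫ p, (H p.1 p.2 * H p.1 p.2) ^ (1 + τ) ∂(π.prod π) = κ * v ^ (1 + τ) := by
    simp_rw [e1]
    rw [hκ, momRatio, div_mul_cancel₀ _ (by positivity)]
  have hi1 : Integrable (fun p : α × α => (H p.1 p.2 * H p.1 p.2) ^ (1 + τ)) (π.prod π) := by
    simp_rw [e1]; exact integrable_abs_rpow (by linarith) hr
  have hv2 : ∫ p, H p.1 p.2 * H p.1 p.2 ∂(π.prod π) = v := by simp_rw [hvdef, sq]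
  -- The level `n v` makes both the truncation bias and the truncated variance multiples of `n^(-τ)`
  -- times the Lyapunov ratio, as `e2` and `e3` show.
  have h1 := integral_abs_offSum_sub_le (π := π) (K := fun z w => H z w * H z w) (s := 1 + τ)
    (M := n * v) (n := n) (by linarith) (by linarith) (by positivity) (hH.meas.mul hH.meas)
    (fun z w => mul_self_nonneg _) (fun z w => by rw [hH.symm]) hi1 (by omega)
  rw [hv2, hm] at h1
  set a := (n : ℝ) ^ (-τ) * κ with ha
  have ha0 : 0 ≤ a := by positivity
  have e2 : ((n : ℝ) * v) ^ (1 - (1 + τ)) * (κ * v ^ (1 + τ)) = v * a := by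
    rw [show 1 - (1 + τ) = -τ by ring, Real.mul_rpow hn0.le hv.le, Real.rpow_add hv,
      Real.rpow_neg hv.le, Real.rpow_one, ha]
    field_simp
  have e3 : ((n : ℝ) * v) ^ (2 - (1 + τ)) * (κ * v ^ (1 + τ)) = n * v ^ 2 * a := by
    rw [show 2 - (1 + τ) = 1 + -τ by ring, Real.mul_rpow hn0.le hv.le, Real.rpow_add hv,
      Real.rpow_add hv, Real.rpow_add hn0, Real.rpow_neg hv.le, Real.rpow_one, Real.rpow_one, ha]
    field_simp
  rw [e2, e3, show 1032 * (n : ℝ) ^ 3 * (n * v ^ 2 * a) = (n ^ 2 * v) ^ 2 * (1032 * a) by ring,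
    Real.sqrt_mul (by positivity), Real.sqrt_sq (by positivity)] at h1
  have hK : Integrable (fun w : Fin n → α => offSum fun k l => H (w k) (w l) * H (w k) (w l))
      (Measure.pi fun _ => π) := by
    exact integrable_offSum (K := fun z w => H z w * H z w) (hH.memLp.integrable_mul hH.memLp)
  have hR : Integrable (fun w : Fin n → α => ∑ k, rowSum (fun k l => H (w k) (w l)) k ^ 2)
      (Measure.pi fun _ => π) := integrable_finsetSum _ fun k _ => (hH.memLp_rowSum k).integrable_sq
  have hS := (hH.memLp_offSum_one (n := n)).integrable_sq
  have hcov : ∀ w : Fin n → α, covRem (fun k l => H (w k) (w l)) (fun k l => H (w k) (w l))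
      = -(2 / (n - 2)) * ∑ k, rowSum (fun k l => H (w k) (w l)) k ^ 2
        + (((n - 1) * (n - 2) : ℝ))⁻¹ * (offSum fun k l => H (w k) (w l)) ^ 2 := fun w => by
    simp only [covRem, sq]
  have hint : Integrable (fun w : Fin n → α => (offSum fun k l => H (w k) (w l) * H (w k) (w l))
      + covRem (fun k l => H (w k) (w l)) fun k l => H (w k) (w l)) (Measure.pi fun _ => π) := by
    simp_rw [hcov]
    exact hK.add ((hR.const_mul _).add (hS.const_mul _))
  refine ⟨hint, ?_⟩
  have hc1 : (0 : ℝ) ≤ 2 / (n - 2) := div_nonneg zero_le_two (by linarith)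
  have hc2 : (0 : ℝ) ≤ ((n - 1) * (n - 2) : ℝ)⁻¹ := inv_nonneg.2 (by nlinarith)
  have hD : (0 : ℝ) < n * (n - 3) * v := mul_pos (mul_pos hn0 (by linarith)) hv
  have key : ∀ w : Fin n → α, |1 / ((n : ℝ) * ((n : ℝ) - 3))
      * ((offSum fun k l => H (w k) (w l) * H (w k) (w l))
        + covRem (fun k l => H (w k) (w l)) fun k l => H (w k) (w l)) / v - 1|
      ≤ (n * (n - 3) * v)⁻¹ * (|(offSum fun k l => H (w k) (w l) * H (w k) (w l)) - n * (n - 1) * v|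
        + 2 / (n - 2) * (∑ k, rowSum (fun k l => H (w k) (w l)) k ^ 2)
        + (((n - 1) * (n - 2) : ℝ))⁻¹ * (offSum fun k l => H (w k) (w l)) ^ 2 + 2 * n * v) := by
    intro w
    rw [hcov]
    exact abs_normalized_sub_one_le (by linarith) (Finset.sum_nonneg fun k _ => sq_nonneg _)
      (sq_nonneg _) hv
  have i0 := (hK.sub (integrable_const (n * (n - 1) * v))).abs
  have i := (((i0.add (hR.const_mul (2 / ((n : ℝ) - 2)))).add
    (hS.const_mul (((n - 1) * (n - 2) : ℝ))⁻¹)).add (integrable_const (2 * n * v))).const_mul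
      (n * (n - 3) * v)⁻¹
  refine (integral_mono_of_nonneg (Eventually.of_forall fun w => abs_nonneg _) i
    (Eventually.of_forall key)).trans ?_
  simp only [Pi.add_apply, Pi.sub_apply]
  simp only [Pi.sub_apply] at i0
  rw [integral_const_mul, integral_add₄ i0 (hR.const_mul _) (hS.const_mul _) (integrable_const _),
    integral_const_mul, integral_const_mul, integral_const, probReal_univ, one_smul]
  have b1 := hH.integral_sum_sq_rowSum_le (n := n)
  have b2 := hH.integral_sq_offSum_one_le (n := n)
  rw [← hvdef] at b1 b2
  have c1 : 2 / ((n : ℝ) - 2) * (2 * (n * (n - 1)) * v) ≤ 6 * n * v := by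
    rw [div_mul_eq_mul_div, div_le_iff₀ (by linarith)]
    have : (0 : ℝ) ≤ n * v := by positivity
    nlinarith
  have c2 : (((n - 1) * (n - 2) : ℝ))⁻¹ * (2 * (n * (n - 1)) * v) ≤ 4 * n * v := by
    rw [inv_mul_le_iff₀ (by nlinarith)]
    have : (0 : ℝ) ≤ n * v * (n - 1) := mul_nonneg (by positivity) (by linarith)
    nlinarith
  have d1 := mul_le_mul_of_nonneg_left b1 hc1
  have d2 := mul_le_mul_of_nonneg_left b2 hc2
  have hfin : (n : ℝ) ^ 2 * v / 2 ≤ n * (n - 3) * v := by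
    have : (0 : ℝ) ≤ n * v := by positivity
    nlinarith
  rw [inv_mul_le_iff₀ hD]
  have hsq0 := Real.sqrt_nonneg (1032 * a)
  calc _ ≤ 2 * (n * (n - 1) * (v * a)) + n ^ 2 * v * √(1032 * a) + 6 * n * v + 4 * n * v
        + 2 * n * v := by linarith
    _ ≤ (n : ℝ) ^ 2 * v / 2 * (4 * a + 2 * √(1032 * a) + 24 / n) := by
        have e5 : (n : ℝ) ^ 2 * v / 2 * (24 / n) = 12 * n * v := by field_simp; ring
        have : 0 ≤ n * (v * a) := by positivity
        rw [mul_add, mul_add, e5]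
        nlinarith
    _ ≤ _ := by gcongr

end Remainders

/-! ### Products of degenerate kernels -/

section ProductKernel

variable {α β : Type*} [MeasurableSpace α] [MeasurableSpace β] {π : Measure α} {ρ : Measure β}
  [IsProbabilityMeasure π] [IsProbabilityMeasure ρ] {H : α → α → ℝ} {G : β → β → ℝ}

lemma measurePreserving_prod_prod_comm (π : Measure α) (ρ : Measure β) [IsProbabilityMeasure π]
    [IsProbabilityMeasure ρ] :
    MeasurePreserving (fun p : (α × β) × (α × β) => ((p.1.1, p.2.1), (p.1.2, p.2.2)))
      ((π.prod ρ).prod (π.prod ρ)) ((π.prod π).prod (ρ.prod ρ)) := by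
  have hm : Measurable (fun p : (α × β) × (α × β) => ((p.1.1, p.2.1), (p.1.2, p.2.2))) := by
    fun_prop
  refine ⟨hm, (Measure.prod_eq fun s t hs ht => ?_).symm⟩
  rw [Measure.map_apply hm (hs.prod ht), Measure.prod_apply (hm (hs.prod ht)),
    Measure.prod_apply hs, Measure.prod_apply ht,
    ← lintegral_prod_mul (measurable_measure_prodMk_left hs).aemeasurable
      (measurable_measure_prodMk_left ht).aemeasurable]
  refine lintegral_congr fun z => ?_
  rw [← Measure.prod_prod]
  rfl

lemma integral_prod_pair_mul {F : α × α → ℝ} {E : β × β → ℝ}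
    (hF : AEStronglyMeasurable F (π.prod π)) (hE : AEStronglyMeasurable E (ρ.prod ρ)) :
    ∫ p, F (p.1.1, p.2.1) * E (p.1.2, p.2.2) ∂((π.prod ρ).prod (π.prod ρ))
      = (∫ p, F p ∂(π.prod π)) * ∫ p, E p ∂(ρ.prod ρ) := by
  have h := measurePreserving_prod_prod_comm π ρ
  rw [← integral_prod_mul F E, ← h.map_eq, integral_map h.measurable.aemeasurable]
  rw [h.map_eq]
  exact hF.comp_fst.mul hE.comp_snd

/-- The product of two kernels. -/
def prodKernel (H : α → α → ℝ) (G : β → β → ℝ) (z w : α × β) : ℝ := H z.1 w.1 * G z.2 w.2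

lemma DegenKernel.prod (hH : DegenKernel π H) (hG : DegenKernel ρ G) :
    DegenKernel (π.prod ρ) (prodKernel H G) where
  meas := by
    have h1 : Measurable (fun p : (α × β) × (α × β) => H p.1.1 p.2.1) :=
      hH.meas.comp (by fun_prop : Measurable fun p : (α × β) × (α × β) => (p.1.1, p.2.1))
    have h2 : Measurable (fun p : (α × β) × (α × β) => G p.1.2 p.2.2) :=
      hG.meas.comp (by fun_prop : Measurable fun p : (α × β) × (α × β) => (p.1.2, p.2.2))
    exact h1.mul h2
  symm z w := by simp only [prodKernel, hH.symm z.1, hG.symm z.2]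
  slice z := memLp_two_mul_prod (hH.slice z.1) (hG.slice z.2)
  mean z := by
    unfold prodKernel
    rw [integral_prod_mul (fun x => H z.1 x) (fun y => G z.2 y), hH.mean, zero_mul]
  memLp := (memLp_two_mul_prod hH.memLp hG.memLp).comp_measurePreserving
    (measurePreserving_prod_prod_comm π ρ)

lemma integral_sq_prodKernel (hH : DegenKernel π H) (hG : DegenKernel ρ G) :
    ∫ p, prodKernel H G p.1 p.2 ^ 2 ∂((π.prod ρ).prod (π.prod ρ))
      = (∫ p, H p.1 p.2 ^ 2 ∂(π.prod π)) * ∫ p, G p.1 p.2 ^ 2 ∂(ρ.prod ρ) := by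
  simp_rw [prodKernel, mul_pow]
  exact integral_prod_pair_mul (F := fun p => H p.1 p.2 ^ 2) (E := fun p => G p.1 p.2 ^ 2)
    hH.memLp.integrable_sq.aestronglyMeasurable hG.memLp.integrable_sq.aestronglyMeasurable

lemma iterKernel_prodKernel (z w : α × β) :
    iterKernel (π.prod ρ) (prodKernel H G) z w
      = iterKernel π H z.1 w.1 * iterKernel ρ G z.2 w.2 := by
  unfold iterKernel prodKernel
  rw [← integral_prod_mul (fun u => H z.1 u * H w.1 u) (fun u => G z.2 u * G w.2 u)]
  congr 1 with u
  ring

/-- The iterated kernel of a product is the product of the iterated kernels. So one small factor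
suffices, the other being at most one. -/
lemma specRatio_prodKernel (hH : DegenKernel π H) (hG : DegenKernel ρ G) :
    specRatio (π.prod ρ) (prodKernel H G) = specRatio π H * specRatio ρ G := by
  unfold specRatio
  rw [integral_sq_prodKernel hH hG]
  simp_rw [iterKernel_prodKernel]
  have := integral_sq_prodKernel hH.iter hG.iter
  simp only [prodKernel] at this
  rw [this, mul_pow, mul_div_mul_comm]

lemma memLp_prodKernel {r : ℝ} (hr : 0 < r)
    (hH : MemLp (fun p : α × α => H p.1 p.2) (ENNReal.ofReal r) (π.prod π))
    (hG : MemLp (fun p : β × β => G p.1 p.2) (ENNReal.ofReal r) (ρ.prod ρ)) :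
    MemLp (fun p : (α × β) × (α × β) => prodKernel H G p.1 p.2) (ENNReal.ofReal r)
      ((π.prod ρ).prod (π.prod ρ)) := by
  have h : MemLp (fun q : (α × α) × (β × β) => H q.1.1 q.1.2 * G q.2.1 q.2.2) (ENNReal.ofReal r)
      ((π.prod π).prod (ρ.prod ρ)) := by
    refine memLp_of_integrable_abs_rpow hr
      (hH.aestronglyMeasurable.comp_fst.mul hG.aestronglyMeasurable.comp_snd) ?_
    simp_rw [abs_mul, Real.mul_rpow (abs_nonneg _) (abs_nonneg _)]
    exact (integrable_abs_rpow hr hH).mul_prod (integrable_abs_rpow hr hG)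
  exact h.comp_measurePreserving (measurePreserving_prod_prod_comm π ρ)

lemma momRatio_prodKernel {τ : ℝ} (hτ : 0 < τ) (hH : DegenKernel π H) (hG : DegenKernel ρ G) :
    momRatio (π.prod ρ) (prodKernel H G) τ = momRatio π H τ * momRatio ρ G τ := by
  have hm : Continuous fun x : ℝ => |x| ^ (2 + 2 * τ) :=
    continuous_abs.rpow_const fun x => Or.inr (by linarith)
  unfold momRatio
  rw [integral_sq_prodKernel hH hG, Real.mul_rpow (integral_nonneg fun p => sq_nonneg _)
    (integral_nonneg fun p => sq_nonneg _), ← mul_div_mul_comm]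
  simp_rw [prodKernel, abs_mul, Real.mul_rpow (abs_nonneg _) (abs_nonneg _)]
  rw [integral_prod_pair_mul (F := fun p => |H p.1 p.2| ^ (2 + 2 * τ))
    (E := fun p => |G p.1 p.2| ^ (2 + 2 * τ))
    (hm.comp_aestronglyMeasurable hH.memLp.aestronglyMeasurable)
    (hm.comp_aestronglyMeasurable hG.memLp.aestronglyMeasurable)]

/-- Jensen. It lets each Lyapunov ratio be dominated by the product of the two, about which the
hypotheses speak. -/
lemma one_le_momRatio {τ : ℝ} (hτ : 0 < τ) (hH : DegenKernel π H)
    (hr : MemLp (fun p : α × α => H p.1 p.2) (ENNReal.ofReal (2 + 2 * τ)) (π.prod π))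
    (hv : 0 < ∫ p, H p.1 p.2 ^ 2 ∂(π.prod π)) : 1 ≤ momRatio π H τ := by
  have e : ∀ p : α × α, (H p.1 p.2 ^ 2) ^ (1 + τ) = |H p.1 p.2| ^ (2 + 2 * τ) := fun p => by
    rw [← sq_abs, ← Real.rpow_natCast, ← Real.rpow_mul (abs_nonneg _)]
    congr 1; push_cast; ring
  unfold momRatio
  rw [le_div_iff₀ (by positivity), one_mul]
  have := rpow_integral_le (μ := π.prod π) (s := 1 + τ) (f := fun p => H p.1 p.2 ^ 2) (by linarith)
    (fun p => sq_nonneg _) hH.memLp.integrable_sq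
    (by simp_rw [e]; exact integrable_abs_rpow (by linarith) hr)
  simp_rw [e] at this
  exact this

lemma specRatio_nonneg : 0 ≤ specRatio π H :=
  div_nonneg (integral_nonneg fun _ => sq_nonneg _) (sq_nonneg _)

lemma specRatio_le_one (hH : DegenKernel π H) : specRatio π H ≤ 1 :=
  div_le_one_of_le₀ (integral_sq_iterKernel_le hH) (sq_nonneg _)

end ProductKernel

/-! ### Comparison of the test statistic with its leading `U`-statistic -/

lemma measurable_sampleDCov {γ : Type*} [MeasurableSpace γ] {n p q : ℕ}
    {f : γ → Fin n → EuclideanSpace ℝ (Fin p)} {g : γ → Fin n → EuclideanSpace ℝ (Fin q)}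
    (hf : Measurable f) (hg : Measurable g) : Measurable (fun z => sampleDCov (f z) (g z)) := by
  have hp : ∀ {d : ℕ} (k l : Fin n), Measurable (fun z : Fin n → EuclideanSpace ℝ (Fin d) =>
      uCenter (pairDist z) k l) := fun k l => by
    unfold uCenter pairDist
    fun_prop
  unfold sampleDCov
  refine Measurable.const_mul ?_ _
  refine Finset.measurable_fun_sum _ fun k _ => Finset.measurable_fun_sum _ fun l _ => ?_
  split_ifs
  · exact ((hp k l).comp hf).mul ((hp k l).comp hg)
  · exact measurable_const

lemma measurable_testStat {γ : Type*} [MeasurableSpace γ] {n p q : ℕ}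
    {f : γ → Fin n → EuclideanSpace ℝ (Fin p)} {g : γ → Fin n → EuclideanSpace ℝ (Fin q)}
    (hf : Measurable f) (hg : Measurable g) : Measurable (fun z => testStat (f z) (g z)) := by
  have h1 := measurable_sampleDCov hf hg
  have h2 := measurable_sampleDCov hf hf
  have h3 := measurable_sampleDCov hg hg
  have h4 : Measurable (fun a : ℝ × ℝ × ℝ => if 0 < a.2.1 * a.2.2 then a.1 / √(a.2.1 * a.2.2) else 0) :=
    Measurable.ite (measurableSet_lt measurable_const (by fun_prop)) (by fun_prop) measurable_const
  exact (h4.comp (h1.prodMk (h2.prodMk h3))).const_mul _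

lemma norm_cexp_mul_I_sub_cexp_le (a b : ℝ) :
    ‖Complex.exp (a * Complex.I) - Complex.exp (b * Complex.I)‖ ≤ |a - b| := by
  have e : Complex.exp (a * Complex.I) - Complex.exp (b * Complex.I)
      = Complex.exp (b * Complex.I) * (Complex.exp ((a - b : ℝ) * Complex.I) - 1) := by
    rw [mul_sub, mul_one, ← Complex.exp_add]
    congr 2; push_cast; ring
  rw [e, norm_mul, Complex.norm_exp_ofReal_mul_I, one_mul]
  exact norm_cexp_mul_I_sub_one_le _

lemma abs_inv_sqrt_mul_sub_one_le {x y δ : ℝ} (hδ2 : δ ≤ 1 / 2)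
    (hx : |x - 1| ≤ δ) (hy : |y - 1| ≤ δ) : 0 < x ∧ 0 < y ∧ |(√(x * y))⁻¹ - 1| ≤ 2 * δ := by
  rw [abs_le] at hx hy
  have hx0 : 0 < x := by linarith
  have hy0 : 0 < y := by linarith
  refine ⟨hx0, hy0, ?_⟩
  have hδ : 0 ≤ δ := by linarith
  have h1 : 1 - δ ≤ √(x * y) := Real.le_sqrt_of_sq_le (by nlinarith)
  have h2 : √(x * y) ≤ 1 + δ := by
    rw [Real.sqrt_le_left (by linarith)]; nlinarith
  have h0 : 0 < √(x * y) := by linarith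
  rw [abs_le, ← one_div]
  constructor
  · rw [le_sub_iff_add_le, le_div_iff₀ h0]; nlinarith
  · rw [sub_le_iff_le_add, div_le_iff₀ h0]; nlinarith

/-- Replacing the sample normalisation by the population one. -/
lemma norm_cexp_studentized_sub_le {m a b c v w u δ : ℝ} (hv : 0 < v) (hw : 0 < w) (hδ : 0 < δ)
    (hδ2 : δ ≤ 1 / 2) (t : ℝ) :
    ‖Complex.exp ((t * (m * if 0 < a * b then c / √(a * b) else 0) : ℝ) * Complex.I)
      - Complex.exp ((t * u : ℝ) * Complex.I)‖
      ≤ |t| * (2 * δ * |u| + 2 * |m * (c / √(v * w)) - u|)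
        + 2 / δ * (|a / v - 1| + |b / w - 1|) := by
  set T := m * if 0 < a * b then c / √(a * b) else 0 with hT
  set U := m * (c / √(v * w)) with hU
  by_cases hc : |a / v - 1| ≤ δ ∧ |b / w - 1| ≤ δ
  · obtain ⟨hx, hy, h3⟩ := abs_inv_sqrt_mul_sub_one_le hδ2 hc.1 hc.2
    have ha : 0 < a := by rwa [div_pos_iff_of_pos_right hv] at hx
    have hb : 0 < b := by rwa [div_pos_iff_of_pos_right hw] at hy
    have e : T = U * (√(a / v * (b / w)))⁻¹ := by
      rw [hT, hU, if_pos (by positivity), div_mul_div_comm, Real.sqrt_div (by positivity)]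
      have h1 : √(a * b) ≠ 0 := by positivity
      have h2 : √(v * w) ≠ 0 := by positivity
      field_simp
    have h4 : |T - U| ≤ 2 * δ * |U| := by
      rw [e, show U * (√(a / v * (b / w)))⁻¹ - U = ((√(a / v * (b / w)))⁻¹ - 1) * U by ring, abs_mul]
      gcongr
    have h5 : |U| ≤ |u| + |U - u| := by
      have := abs_add_le u (U - u); rwa [add_sub_cancel] at this
    have h6 : |T - u| ≤ |T - U| + |U - u| := abs_sub_le _ _ _
    have h7 : |T - u| ≤ 2 * δ * |u| + 2 * |U - u| := by
      have := abs_nonneg (U - u)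
      nlinarith
    refine (norm_cexp_mul_I_sub_cexp_le _ _).trans ?_
    rw [← mul_sub, abs_mul]
    have : 0 ≤ 2 / δ * (|a / v - 1| + |b / w - 1|) := by positivity
    have h8 := mul_le_mul_of_nonneg_left h7 (abs_nonneg t)
    linarith
  · have h1 : δ ≤ |a / v - 1| + |b / w - 1| := by
      have := abs_nonneg (a / v - 1)
      have := abs_nonneg (b / w - 1)
      by_contra hlt
      push Not at hlt
      exact hc ⟨by linarith, by linarith⟩
    -- Outside this event the difference of exponentials is at most `2`, paid for by a Markov type
    -- bound valid pointwise.
    have h2 : 2 ≤ 2 / δ * (|a / v - 1| + |b / w - 1|) := by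
      rw [div_mul_eq_mul_div, le_div_iff₀ hδ]; linarith
    have h3 : 0 ≤ |t| * (2 * δ * |u| + 2 * |U - u|) := by positivity
    refine (norm_sub_le _ _).trans ?_
    rw [Complex.norm_exp_ofReal_mul_I, Complex.norm_exp_ofReal_mul_I]
    linarith

/-- The divisor `N(N - 3)` replaces the natural `N(N - 1)`; the quotient `(N - 1)/(N - 3)` equals `1
+ 2/(N - 3)` and is at most `2`. -/
lemma abs_normalized_sub_leading_le {N O R V : ℝ} (hN : 6 ≤ N) (hV : 0 < V) :
    |√(N * (N - 1) / 2) * (1 / (N * (N - 3)) * (O + R) / √V) - O / √(2 * (N * (N - 1)) * V)|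
      ≤ 2 / (N - 3) * |O / √(2 * (N * (N - 1)) * V)| + 2 * (|R| / √(2 * (N * (N - 1)) * V)) := by
  have hM : 0 < N * (N - 1) := mul_pos (by linarith) (by linarith)
  have h3 : 0 < N - 3 := by linarith
  have hN0 : 0 < N := by linarith
  have hs : √(2 * (N * (N - 1)) * V) = 2 * √(N * (N - 1) / 2) * √V := by
    rw [show 2 * (N * (N - 1)) * V = 2 ^ 2 * (N * (N - 1) / 2) * V by ring,
      Real.sqrt_mul (by positivity), Real.sqrt_mul (by positivity), Real.sqrt_sq (by norm_num)]
  have hq : 0 < √(N * (N - 1) / 2) := Real.sqrt_pos.2 (by linarith)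
  have hqq : √(N * (N - 1) / 2) * √(N * (N - 1) / 2) = N * (N - 1) / 2 :=
    Real.mul_self_sqrt (by linarith)
  have hV' : 0 < √V := Real.sqrt_pos.2 hV
  rw [hs]
  set s := √(N * (N - 1) / 2)
  set r := √V
  have e : s * (1 / (N * (N - 3)) * (O + R) / r) - O / (2 * s * r)
      = 2 / (N - 3) * (O / (2 * s * r)) + (N - 1) / (N - 3) * (R / (2 * s * r)) := by
    have h1 : s * (1 / (N * (N - 3)) * (O + R) / r)
        = (N - 1) / (N - 3) * ((O + R) / (2 * s * r)) := by
      have : s * (2 * s) = N * (N - 1) := by linarith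
      rw [mul_div_assoc', div_mul_div_comm, div_eq_div_iff (by positivity) (by positivity)]
      have e2 : 1 / (N * (N - 3)) = 1 / N * (1 / (N - 3)) := by field_simp
      rw [e2]
      field_simp
      linear_combination (O + R) * this
    rw [h1]
    field_simp
    ring
  rw [e]
  refine (abs_add_le _ _).trans ?_
  rw [abs_mul, abs_mul, abs_of_pos (by positivity : 0 < 2 / (N - 3)), abs_div R,
    abs_of_pos (by positivity : 0 < 2 * s * r)]
  gcongr
  rw [abs_of_nonneg (div_nonneg (by linarith) h3.le), div_le_iff₀ h3]
  linarith

lemma integral_comp_measurePreserving {α β E : Type*} [MeasurableSpace α] [MeasurableSpace β]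
    [NormedAddCommGroup E] [NormedSpace ℝ E] {μ : Measure α} {ν : Measure β} {g : α → β} {f : β → E}
    (hg : MeasurePreserving g μ ν) (hf : AEStronglyMeasurable f ν) :
    ∫ x, f (g x) ∂μ = ∫ y, f y ∂ν := by
  rw [← hg.map_eq] at hf ⊢
  rw [integral_map hg.measurable.aemeasurable hf]

lemma sampleDCov_eq_covRem {n p q : ℕ} (hn : 3 ≤ n) (μ : Measure (EuclideanSpace ℝ (Fin p)))
    (ν : Measure (EuclideanSpace ℝ (Fin q))) (x : Fin n → EuclideanSpace ℝ (Fin p))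
    (y : Fin n → EuclideanSpace ℝ (Fin q)) :
    sampleDCov x y = 1 / ((n : ℝ) * ((n : ℝ) - 3))
      * (offSum (fun k l => distKernel μ (x k) (x l) * distKernel ν (y k) (y l))
        + covRem (fun k l => distKernel μ (x k) (x l)) fun k l => distKernel ν (y k) (y l)) := by
  rw [sampleDCov_eq hn (μ := μ) (ν := ν), covRem]
  ring

/-! ### Sizes of the normalized leading sum and of the remainder -/

section LeadingTerm

variable {α β : Type*} [MeasurableSpace α] [MeasurableSpace β] {π : Measure α} {ρ : Measure β}
  [IsProbabilityMeasure π] [IsProbabilityMeasure ρ] {H : α → α → ℝ} {G : β → β → ℝ} {n : ℕ}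

lemma measurePreserving_pi_prod (π : Measure α) (ρ : Measure β) [IsProbabilityMeasure π]
    [IsProbabilityMeasure ρ] :
    MeasurePreserving (fun z : Fin n → α × β => ((fun i => (z i).1), fun i => (z i).2))
      (Measure.pi fun _ => π.prod ρ) ((Measure.pi fun _ => π).prod (Measure.pi fun _ => ρ)) :=
  measurePreserving_arrowProdEquivProdArrow _ _ (Fin n) (fun _ => π) fun _ => ρ

lemma leading_bound (hH : DegenKernel π H) (hG : DegenKernel ρ G)
    (hv : 0 < ∫ z, H z.1 z.2 ^ 2 ∂(π.prod π)) (hw : 0 < ∫ z, G z.1 z.2 ^ 2 ∂(ρ.prod ρ))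
    (hn : 6 ≤ n) :
    MemLp (fun z : Fin n → α × β => (offSum fun k l => prodKernel H G (z k) (z l))
      / √(2 * (n * (n - 1)) * ((∫ z, H z.1 z.2 ^ 2 ∂(π.prod π)) * ∫ z, G z.1 z.2 ^ 2 ∂(ρ.prod ρ)))) 2
      (Measure.pi fun _ => π.prod ρ) ∧
    ∫ z, |(offSum fun k l => prodKernel H G (z k) (z l))
      / √(2 * (n * (n - 1)) * ((∫ z, H z.1 z.2 ^ 2 ∂(π.prod π)) * ∫ z, G z.1 z.2 ^ 2 ∂(ρ.prod ρ)))|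
      ∂(Measure.pi fun _ : Fin n => π.prod ρ) ≤ 1 := by
  have hn6 : (6 : ℝ) ≤ n := by exact_mod_cast hn
  have hM : (0 : ℝ) < n * (n - 1) := mul_pos (by linarith) (by linarith)
  have i0 := (hH.prod hG).memLp_offSum_one (n := n)
  have b0 := (hH.prod hG).integral_sq_offSum_one_le (n := n)
  rw [integral_sq_prodKernel hH hG] at b0
  set V := (∫ z, H z.1 z.2 ^ 2 ∂(π.prod π)) * ∫ z, G z.1 z.2 ^ 2 ∂(ρ.prod ρ) with hV
  have hV0 : 0 < V := mul_pos hv hw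
  have hQ2 : √(2 * (n * (n - 1)) * V) ^ 2 = 2 * (n * (n - 1)) * V := Real.sq_sqrt (by positivity)
  have hm := i0.const_mul (√(2 * (n * (n - 1)) * V))⁻¹
  simp_rw [← div_eq_inv_mul] at hm
  refine ⟨hm, (abs_integral_le_sqrt hm).trans (Real.sqrt_le_one.2 ?_)⟩
  simp_rw [div_pow, hQ2]
  rw [integral_div, div_le_one (by positivity)]
  exact b0

lemma covRem_bound (hH : DegenKernel π H) (hG : DegenKernel ρ G)
    (hv : 0 < ∫ z, H z.1 z.2 ^ 2 ∂(π.prod π)) (hw : 0 < ∫ z, G z.1 z.2 ^ 2 ∂(ρ.prod ρ))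
    (hn : 6 ≤ n) :
    Integrable (fun z : Fin n → α × β => |covRem (fun k l => H (z k).1 (z l).1)
      (fun k l => G (z k).2 (z l).2)| / √(2 * (n * (n - 1))
        * ((∫ z, H z.1 z.2 ^ 2 ∂(π.prod π)) * ∫ z, G z.1 z.2 ^ 2 ∂(ρ.prod ρ))))
      (Measure.pi fun _ => π.prod ρ) ∧
    ∫ z, |covRem (fun k l => H (z k).1 (z l).1) (fun k l => G (z k).2 (z l).2)|
      / √(2 * (n * (n - 1)) * ((∫ z, H z.1 z.2 ^ 2 ∂(π.prod π)) * ∫ z, G z.1 z.2 ^ 2 ∂(ρ.prod ρ)))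
      ∂(Measure.pi fun _ : Fin n => π.prod ρ) ≤ √(80 / n) := by
  have hn6 : (6 : ℝ) ≤ n := by exact_mod_cast hn
  have hM : (0 : ℝ) < n * (n - 1) := mul_pos (by linarith) (by linarith)
  obtain ⟨ir, br⟩ := integral_sq_covRem_le hH hG hn
  set V := (∫ z, H z.1 z.2 ^ 2 ∂(π.prod π)) * ∫ z, G z.1 z.2 ^ 2 ∂(ρ.prod ρ) with hV
  have hV0 : 0 < V := mul_pos hv hw
  set Q := 2 * (n * (n - 1)) * V with hQ
  have hQ0 : 0 < Q := by positivity
  have hi := (ir.integrable (by norm_num)).abs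
  refine ⟨((measurePreserving_pi_prod π ρ).integrable_comp_of_integrable hi).div_const _, ?_⟩
  have e := integral_comp_measurePreserving (measurePreserving_pi_prod (n := n) π ρ)
    hi.aestronglyMeasurable
  rw [integral_div]
  have b := abs_integral_le_sqrt ir
  rw [← e] at b
  calc _ ≤ √(160 * (n - 1) * V) / √Q :=
        div_le_div_of_nonneg_right (b.trans (Real.sqrt_le_sqrt br)) (Real.sqrt_nonneg _)
    _ = √(80 / n) := by
        have h1 : (n : ℝ) - 1 ≠ 0 := by linarith
        rw [← Real.sqrt_div' _ hQ0.le, hQ]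
        congr 1
        field_simp
        norm_num

end LeadingTerm

/-! ### Characteristic functions of the test statistic and of its leading sum -/

section Comparison

variable {p q n : ℕ} {μ : Measure (EuclideanSpace ℝ (Fin p))} {ν : Measure (EuclideanSpace ℝ (Fin q))}
  [IsProbabilityMeasure μ] [IsProbabilityMeasure ν] {τ : ℝ}

/-- Error bound for the sample normalisation. -/
noncomputable def normErr (μ : Measure (EuclideanSpace ℝ (Fin p))) (τ : ℝ) (n : ℕ) : ℝ :=
  4 * ((n : ℝ) ^ (-τ) * momRatio μ (distKernel μ) τ)
    + 2 * √(1032 * ((n : ℝ) ^ (-τ) * momRatio μ (distKernel μ) τ)) + 24 / n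

lemma integral_abs_sampleDCov_div_sub_one_le (hD : DegenKernel μ (distKernel μ)) (hτ : 0 < τ)
    (hτ2 : τ ≤ 1 / 2)
    (hr : MemLp (fun z : EuclideanSpace ℝ (Fin p) × EuclideanSpace ℝ (Fin p) =>
      distKernel μ z.1 z.2) (ENNReal.ofReal (2 + 2 * τ)) (μ.prod μ))
    (hv : 0 < ∫ z, distKernel μ z.1 z.2 ^ 2 ∂(μ.prod μ)) (hn : 6 ≤ n) :
    Integrable (fun x : Fin n → EuclideanSpace ℝ (Fin p) =>
      |sampleDCov x x / (∫ z, distKernel μ z.1 z.2 ^ 2 ∂(μ.prod μ)) - 1|) (Measure.pi fun _ => μ) ∧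
    ∫ x, |sampleDCov x x / (∫ z, distKernel μ z.1 z.2 ^ 2 ∂(μ.prod μ)) - 1|
      ∂(Measure.pi fun _ : Fin n => μ) ≤ normErr μ τ n := by
  obtain ⟨h1, h2⟩ := integral_abs_offSum_sq_add_covRem_sub_le hD hτ hτ2 hr hv hn
  simp_rw [sampleDCov_eq_covRem (by omega : 3 ≤ n) μ μ]
  exact ⟨(((h1.const_mul _).div_const _).sub (integrable_const _)).abs, h2⟩

lemma integrable_cexp_ofReal_mul_I {α : Type*} [MeasurableSpace α] {π : Measure α}
    [IsProbabilityMeasure π] {f : α → ℝ} (hf : AEStronglyMeasurable f π) :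
    Integrable (fun x => Complex.exp ((f x : ℝ) * Complex.I)) π := by
  have hc : Continuous fun x : ℝ => Complex.exp (x * Complex.I) := by fun_prop
  exact Integrable.of_bound (hc.comp_aestronglyMeasurable hf) 1
    (Eventually.of_forall fun x => (Complex.norm_exp_ofReal_mul_I _).le)

lemma norm_cexp_testStat_sub_le (μ : Measure (EuclideanSpace ℝ (Fin p)))
    (ν : Measure (EuclideanSpace ℝ (Fin q))) {v w : ℝ} (hv : 0 < v) (hw : 0 < w) (hn : 6 ≤ n) {δ : ℝ}
    (hδ : 0 < δ) (hδ2 : δ ≤ 1 / 2) (t : ℝ) (x : Fin n → EuclideanSpace ℝ (Fin p))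
    (y : Fin n → EuclideanSpace ℝ (Fin q)) :
    ‖Complex.exp ((t * testStat x y : ℝ) * Complex.I)
      - Complex.exp ((t * ((offSum fun k l => distKernel μ (x k) (x l) * distKernel ν (y k) (y l))
        / √(2 * (n * (n - 1)) * (v * w))) : ℝ) * Complex.I)‖
      ≤ (|t| * (2 * δ + 4 / (n - 3)))
          * |(offSum fun k l => distKernel μ (x k) (x l) * distKernel ν (y k) (y l))
            / √(2 * (n * (n - 1)) * (v * w))|
        + (|t| * 4) * (|covRem (fun k l => distKernel μ (x k) (x l))
            fun k l => distKernel ν (y k) (y l)| / √(2 * (n * (n - 1)) * (v * w)))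
        + 2 / δ * |sampleDCov x x / v - 1| + 2 / δ * |sampleDCov y y / w - 1| := by
  have hn6 : (6 : ℝ) ≤ n := by exact_mod_cast hn
  unfold testStat sampleDCor
  rw [sampleDCov_eq_covRem (by omega) μ ν x y]
  set O := offSum fun k l => distKernel μ (x k) (x l) * distKernel ν (y k) (y l)
  set R := covRem (fun k l => distKernel μ (x k) (x l)) fun k l => distKernel ν (y k) (y l)
  have h2 := abs_normalized_sub_leading_le (N := n) (O := O) (R := R) hn6 (mul_pos hv hw)
  refine (norm_cexp_studentized_sub_le hv hw hδ hδ2 t).trans ?_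
  set u := O / √(2 * (n * (n - 1)) * (v * w))
  have h3 := mul_le_mul_of_nonneg_left h2 (mul_nonneg (abs_nonneg t) zero_le_two)
  have e2 : |t| * 2 * (2 / (n - 3) * |u| + 2 * (|R| / √(2 * (n * (n - 1)) * (v * w))))
      = |t| * (4 / (n - 3)) * |u| + |t| * 4 * (|R| / √(2 * (n * (n - 1)) * (v * w))) := by ring
  rw [e2] at h3
  linarith

/-- The pathwise comparison is integrated, the projections of the joint sample to the `X` and `Y`
samples being measure preserving. The parameter `δ` stays free: for fixed `δ` the variance errors
vanish with `n`, and `δ` is sent to zero last. -/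
theorem norm_integral_cexp_testStat_sub_le (hD : DegenKernel μ (distKernel μ))
    (hE : DegenKernel ν (distKernel ν)) (hτ : 0 < τ) (hτ2 : τ ≤ 1 / 2)
    (hrD : MemLp (fun z : EuclideanSpace ℝ (Fin p) × EuclideanSpace ℝ (Fin p) =>
      distKernel μ z.1 z.2) (ENNReal.ofReal (2 + 2 * τ)) (μ.prod μ))
    (hrE : MemLp (fun z : EuclideanSpace ℝ (Fin q) × EuclideanSpace ℝ (Fin q) =>
      distKernel ν z.1 z.2) (ENNReal.ofReal (2 + 2 * τ)) (ν.prod ν))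
    (hv : 0 < ∫ z, distKernel μ z.1 z.2 ^ 2 ∂(μ.prod μ))
    (hw : 0 < ∫ z, distKernel ν z.1 z.2 ^ 2 ∂(ν.prod ν)) (hn : 6 ≤ n) {δ : ℝ} (hδ : 0 < δ)
    (hδ2 : δ ≤ 1 / 2) (t : ℝ) :
    ‖∫ w, Complex.exp ((t * testStat (fun i => (w i).1) (fun i => (w i).2) : ℝ) * Complex.I)
        ∂(Measure.pi fun _ : Fin n => μ.prod ν)
      - ∫ w, Complex.exp ((t * ((offSum fun k l => prodKernel (distKernel μ) (distKernel ν) (w k) (w l))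
          / √(2 * (n * (n - 1)) * ∫ z, prodKernel (distKernel μ) (distKernel ν) z.1 z.2 ^ 2
            ∂((μ.prod ν).prod (μ.prod ν)))) : ℝ) * Complex.I)
        ∂(Measure.pi fun _ : Fin n => μ.prod ν)‖
      ≤ |t| * (2 * δ + 4 / (n - 3) + 4 * √(80 / n)) + 2 / δ * (normErr μ τ n + normErr ν τ n) := by
  have hn6 : (6 : ℝ) ≤ n := by exact_mod_cast hn
  have hM : (0 : ℝ) < n * (n - 1) := mul_pos (by linarith) (by linarith)
  rw [integral_sq_prodKernel hD hE]
  obtain ⟨ix, bx⟩ := integral_abs_sampleDCov_div_sub_one_le hD hτ hτ2 hrD hv hn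
  obtain ⟨iy, b_y⟩ := integral_abs_sampleDCov_div_sub_one_le hE hτ hτ2 hrE hw hn
  obtain ⟨hUm, hUb⟩ := leading_bound hD hE hv hw hn
  obtain ⟨hRi, hRb⟩ := covRem_bound hD hE hv hw hn
  set v := ∫ z, distKernel μ z.1 z.2 ^ 2 ∂(μ.prod μ) with hvdef
  set w := ∫ z, distKernel ν z.1 z.2 ^ 2 ∂(ν.prod ν) with hwdef
  set Λ := Measure.pi fun _ : Fin n => μ.prod ν with hΛ
  have hpx : MeasurePreserving (fun (z : Fin n → EuclideanSpace ℝ (Fin p) × EuclideanSpace ℝ (Fin q))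
      i => (z i).1) Λ (Measure.pi fun _ => μ) :=
    measurePreserving_pi (fun _ => μ.prod ν) (fun _ => μ) fun _ => measurePreserving_fst
  have hpy : MeasurePreserving (fun (z : Fin n → EuclideanSpace ℝ (Fin p) × EuclideanSpace ℝ (Fin q))
      i => (z i).2) Λ (Measure.pi fun _ => ν) :=
    measurePreserving_pi (fun _ => μ.prod ν) (fun _ => ν) fun _ => measurePreserving_snd
  have hXi := hpx.integrable_comp_of_integrable ix
  have hYi := hpy.integrable_comp_of_integrable iy
  rw [← integral_comp_measurePreserving hpx ix.aestronglyMeasurable] at bx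
  rw [← integral_comp_measurePreserving hpy iy.aestronglyMeasurable] at b_y
  have hUi := (hUm.integrable (by norm_num)).abs
  have key := fun z : Fin n → EuclideanSpace ℝ (Fin p) × EuclideanSpace ℝ (Fin q) =>
    norm_cexp_testStat_sub_le μ ν hv hw hn hδ hδ2 t (fun i => (z i).1) (fun i => (z i).2)
  have hT : Measurable (fun z : Fin n → EuclideanSpace ℝ (Fin p) × EuclideanSpace ℝ (Fin q) =>
      testStat (fun i => (z i).1) (fun i => (z i).2)) :=
    measurable_testStat (by fun_prop) (by fun_prop)
  have c1 : Integrable (fun z : Fin n → EuclideanSpace ℝ (Fin p) × EuclideanSpace ℝ (Fin q) =>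
      Complex.exp ((t * testStat (fun i => (z i).1) (fun i => (z i).2) : ℝ) * Complex.I)) Λ :=
    integrable_cexp_ofReal_mul_I (hT.const_mul t).aestronglyMeasurable
  have c2 := integrable_cexp_ofReal_mul_I (hUm.const_mul t).aestronglyMeasurable
  have j1 := hUi.const_mul (|t| * (2 * δ + 4 / ((n : ℝ) - 3)))
  have j2 := hRi.const_mul (|t| * 4)
  have j3 := hXi.const_mul (2 / δ)
  have j4 := hYi.const_mul (2 / δ)
  have e4 := integral_add₄ j1 j2 j3 j4
  rw [← integral_sub c1 c2]
  refine (norm_integral_le_integral_norm _).trans ((integral_mono (c1.sub c2).norm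
    (((j1.add j2).add j3).add j4) key).trans (e4.trans_le ?_))
  rw [integral_const_mul, integral_const_mul, integral_const_mul, integral_const_mul]
  have p1 : 0 ≤ |t| * (2 * δ + 4 / ((n : ℝ) - 3)) :=
    mul_nonneg (abs_nonneg t) (add_nonneg (by linarith) (div_nonneg (by norm_num) (by linarith)))
  have q1 := mul_le_mul_of_nonneg_left hUb p1
  have q2 := mul_le_mul_of_nonneg_left hRb (by positivity : 0 ≤ |t| * 4)
  have q3 := mul_le_mul_of_nonneg_left bx (by positivity : 0 ≤ 2 / δ)
  have q4 := mul_le_mul_of_nonneg_left b_y (by positivity : 0 ≤ 2 / δ)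
  refine (add_le_add (add_le_add (add_le_add q1 q2) q3) q4).trans_eq ?_
  ring

end Comparison

/-! ### Asymptotic normality -/

section OneSetting

variable {p q n : ℕ} {μ : Measure (EuclideanSpace ℝ (Fin p))} {ν : Measure (EuclideanSpace ℝ (Fin q))}
  [IsProbabilityMeasure μ] [IsProbabilityMeasure ν] {τ : ℝ}

lemma degenKernel_distKernel_of_moment (hτ : 0 < τ) (hτ2 : τ ≤ 1 / 2)
    (h : Integrable (fun x => ‖x‖ ^ (4 + 4 * τ)) μ) :
    DegenKernel μ (distKernel μ) ∧
    MemLp (fun z : EuclideanSpace ℝ (Fin p) × EuclideanSpace ℝ (Fin p) =>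
      distKernel μ z.1 z.2) (ENNReal.ofReal (2 + 2 * τ)) (μ.prod μ) := by
  refine ⟨degenKernel_distKernel ?_, (memLp_distKernel (by linarith) (by linarith)
    (memLp_norm_of_moment hτ h (by linarith))).1⟩
  simpa using memLp_norm_of_moment (r := 2) hτ h (by linarith)

/-- The bound on the distance of characteristic functions. -/
noncomputable def charFunErr (t δ N a b c s : ℝ) : ℝ :=
  |t| * (2 * δ + 4 / (N - 3) + 4 * √(80 / N))
    + 2 / δ * ((4 * a + 2 * √(1032 * a) + 24 / N) + (4 * b + 2 * √(1032 * b) + 24 / N))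
    + |t| * (1 + t ^ 2) * (92 * c + 2 * √c + 2 * √s + 2 * √(1 / N))

lemma map_sample_eq_pi {Ω : Type*} [MeasurableSpace Ω] {P : Measure Ω} [IsProbabilityMeasure P]
    {X : Fin n → Ω → EuclideanSpace ℝ (Fin p)} {Y : Fin n → Ω → EuclideanSpace ℝ (Fin q)}
    (hX : ∀ i, HasLaw (X i) μ P) (hY : ∀ i, HasLaw (Y i) ν P)
    (hXY : ∀ i, IndepFun (X i) (Y i) P) (h_indep : iIndepFun (fun i ω => (X i ω, Y i ω)) P) :
    P.map (fun ω i => (X i ω, Y i ω)) = Measure.pi fun _ : Fin n => μ.prod ν := by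
  rw [(iIndepFun_iff_map_fun_eq_pi_map fun i =>
    (hX i).aemeasurable.prodMk (hY i).aemeasurable).1 h_indep]
  congr 1 with i : 1
  rw [(indepFun_iff_map_prod_eq_prod_map_map (hX i).aemeasurable (hY i).aemeasurable).1 (hXY i),
    (hX i).map_eq, (hY i).map_eq]

lemma aemeasurable_testStat {Ω : Type*} [MeasurableSpace Ω] {P : Measure Ω}
    {X : Fin n → Ω → EuclideanSpace ℝ (Fin p)} {Y : Fin n → Ω → EuclideanSpace ℝ (Fin q)}
    (hX : ∀ i, AEMeasurable (X i) P) (hY : ∀ i, AEMeasurable (Y i) P) :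
    AEMeasurable (fun ω => testStat (fun i => X i ω) (fun i => Y i ω)) P := by
  have h1 : AEMeasurable (fun ω i => (X i ω, Y i ω)) P :=
    aemeasurable_pi_lambda _ fun i => (hX i).prodMk (hY i)
  have h2 : Measurable (fun z : Fin n → EuclideanSpace ℝ (Fin p) × EuclideanSpace ℝ (Fin q) =>
      testStat (fun i => (z i).1) (fun i => (z i).2)) :=
    measurable_testStat (by fun_prop) (by fun_prop)
  have h3 : ∀ g : (Fin n → EuclideanSpace ℝ (Fin p) × EuclideanSpace ℝ (Fin q)) → ℝ, Measurable g →
      AEMeasurable (fun ω => g fun i => (X i ω, Y i ω)) P := fun g hg => hg.comp_aemeasurable h1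
  exact h3 (fun z => testStat (fun i => (z i).1) (fun i => (z i).2)) h2

theorem norm_charFun_testStat_sub_le {Ω : Type*} [MeasurableSpace Ω] {P : Measure Ω}
    [IsProbabilityMeasure P] {X : Fin n → Ω → EuclideanSpace ℝ (Fin p)}
    {Y : Fin n → Ω → EuclideanSpace ℝ (Fin q)}
    (hX : ∀ i, HasLaw (X i) μ P) (hY : ∀ i, HasLaw (Y i) ν P)
    (hXY : ∀ i, IndepFun (X i) (Y i) P) (h_indep : iIndepFun (fun i ω => (X i ω, Y i ω)) P)
    (hτ : 0 < τ) (hτ2 : τ ≤ 1 / 2)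
    (hμ : Integrable (fun x => ‖x‖ ^ (4 + 4 * τ)) μ) (hν : Integrable (fun x => ‖x‖ ^ (4 + 4 * τ)) ν)
    (hv : 0 < ∫ z, distKernel μ z.1 z.2 ^ 2 ∂(μ.prod μ))
    (hw : 0 < ∫ z, distKernel ν z.1 z.2 ^ 2 ∂(ν.prod ν)) (hn : 6 ≤ n) {δ : ℝ} (hδ : 0 < δ)
    (hδ2 : δ ≤ 1 / 2) (t : ℝ) :
    ‖charFun (P.map fun ω => testStat (fun i => X i ω) (fun i => Y i ω)) t
        - charFun (gaussianReal 0 1) t‖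
      ≤ charFunErr t δ n ((n : ℝ) ^ (-τ) * momRatio μ (distKernel μ) τ)
        ((n : ℝ) ^ (-τ) * momRatio ν (distKernel ν) τ)
        ((n : ℝ) ^ (-τ) * (momRatio μ (distKernel μ) τ * momRatio ν (distKernel ν) τ))
        (specRatio μ (distKernel μ) * specRatio ν (distKernel ν)) := by
  obtain ⟨hD, hrD⟩ := degenKernel_distKernel_of_moment hτ hτ2 hμ
  obtain ⟨hE, hrE⟩ := degenKernel_distKernel_of_moment hτ hτ2 hν
  have h1 := norm_integral_cexp_testStat_sub_le hD hE hτ hτ2 hrD hrE hv hw hn hδ hδ2 t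
  have h2 := norm_charFun_offSum_sub_gaussian_le (hD.prod hE) hτ hτ2
    (memLp_prodKernel (by linarith) hrD hrE) (by omega : 2 ≤ n)
    (by rw [integral_sq_prodKernel hD hE]; exact mul_pos hv hw) t
  rw [momRatio_prodKernel hτ hD hE, specRatio_prodKernel hD hE] at h2
  have hXm := fun i => (hX i).aemeasurable
  have hYm := fun i => (hY i).aemeasurable
  have hc : charFun (P.map fun ω => testStat (fun i => X i ω) (fun i => Y i ω)) t
      = ∫ w, Complex.exp ((t * testStat (fun i => (w i).1) (fun i => (w i).2) : ℝ) * Complex.I)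
        ∂(Measure.pi fun _ : Fin n => μ.prod ν) := by
    rw [charFun_apply_real, integral_map (aemeasurable_testStat hXm hYm) (by fun_prop),
      ← map_sample_eq_pi hX hY hXY h_indep, integral_map
        (aemeasurable_pi_lambda _ fun i => (hXm i).prodMk (hYm i))]
    · simp only [Complex.ofReal_mul]
    · have : Measurable (fun z : Fin n → EuclideanSpace ℝ (Fin p) × EuclideanSpace ℝ (Fin q) =>
          testStat (fun i => (z i).1) (fun i => (z i).2)) :=
        measurable_testStat (by fun_prop) (by fun_prop)
      exact (by fun_prop : Measurable _).aestronglyMeasurable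
  have hg : charFun (gaussianReal 0 1) t = (Real.exp (-t ^ 2 / 2) : ℂ) := by
    rw [charFun_gaussianReal]
    push_cast
    congr 1
    simp
    ring
  rw [hc, hg]
  refine (norm_sub_le_norm_sub_add_norm_sub _ _ _).trans ((add_le_add h1 h2).trans_eq ?_)
  simp only [charFunErr, normErr]

end OneSetting

/-! ### Uniform bounds along a sequence of settings -/

section Sequences

variable {τ : ℝ}

lemma tendsto_charFunErr {N a b c s : ℕ → ℝ} (hN : Tendsto N atTop atTop)
    (ha : Tendsto a atTop (𝓝 0)) (hb : Tendsto b atTop (𝓝 0)) (hc : Tendsto c atTop (𝓝 0))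
    (hs : Tendsto s atTop (𝓝 0)) (t δ : ℝ) :
    Tendsto (fun k => charFunErr t δ (N k) (a k) (b k) (c k) (s k)) atTop (𝓝 (|t| * (2 * δ))) := by
  have hdiv : ∀ r : ℝ, Tendsto (fun k => r / N k) atTop (𝓝 0) := fun r =>
    hN.const_div_atTop r
  have h3 : Tendsto (fun k => 4 / (N k - 3)) atTop (𝓝 0) :=
    (tendsto_atTop_add_const_right _ (-3) hN).const_div_atTop 4
  have hsq : ∀ {f : ℕ → ℝ}, Tendsto f atTop (𝓝 0) → Tendsto (fun k => √(f k)) atTop (𝓝 0) :=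
    fun hf => by simpa using hf.sqrt
  have hm : ∀ {f : ℕ → ℝ} (r : ℝ), Tendsto f atTop (𝓝 0) → Tendsto (fun k => r * f k) atTop (𝓝 0) :=
    fun r hf => by simpa using hf.const_mul r
  have e1 := ((h3.const_add (2 * δ)).add (hm 4 (hsq (hdiv 80)))).const_mul |t|
  have hadd : ∀ {f g : ℕ → ℝ}, Tendsto f atTop (𝓝 0) → Tendsto g atTop (𝓝 0) →
      Tendsto (fun k => f k + g k) atTop (𝓝 0) := fun hf hg => by simpa using hf.add hg
  have e2 := hm (2 / δ) (hadd (hadd (hadd (hm 4 ha) (hm 2 (hsq (hm 1032 ha)))) (hdiv 24))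
    (hadd (hadd (hm 4 hb) (hm 2 (hsq (hm 1032 hb)))) (hdiv 24)))
  have e3 := hm (|t| * (1 + t ^ 2)) (hadd (hadd (hadd (hm 92 hc) (hm 2 (hsq hc))) (hm 2 (hsq hs)))
    (hm 2 (hsq (hdiv 1))))
  have e := (e1.add e2).add e3
  rw [add_zero, add_zero, add_zero, add_zero] at e
  exact e

/-- Unfolds a limit taken only as the dimension grows into a threshold `Q`. Dimensions below `Q` are
then bounded and need a separate argument. -/
lemma exists_forall_of_eventually_inf_comap {p : ℕ → ℕ} {A : ℕ → Prop}
    (h : ∀ᶠ k in atTop ⊓ comap p atTop, A k) : ∃ Q, ∀ᶠ k in atTop, Q ≤ p k → A k := by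
  obtain ⟨⟨S, Q⟩, ⟨hS, -⟩, h'⟩ := (atTop.basis_sets.inf (atTop_basis.comap p)).eventually_iff.1 h
  exact ⟨Q, mem_of_superset hS fun k hk hQ => h' ⟨hk, hQ⟩⟩

variable {p : ℕ → ℕ} {μ : ∀ k, Measure (EuclideanSpace ℝ (Fin (p k)))}
  [∀ k, IsProbabilityMeasure (μ k)]

/-- Above the threshold `E_x` is small and the expansion of the distance applies; below it the bound
depending on the dimension has constant at most `2^48 Q^5`. The sum of the two constants covers both
cases. -/
lemma exists_forall_momRatio_le (hτ : 0 < τ) (hτ2 : τ ≤ 1 / 2)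
    (hmom : ∀ k, Integrable (fun x => ‖x‖ ^ (4 + 4 * τ)) (μ k)) (hmean : ∀ k, ∫ x, x ∂(μ k) = 0)
    (hpos : ∀ k, 0 < momSq (μ k))
    (hE : Tendsto (fun k => momE (μ k) τ) (atTop ⊓ comap p atTop) (𝓝 0)) :
    ∃ C : ℝ, 0 < C ∧ ∀ᶠ k in atTop, 0 < ∫ z, distKernel (μ k) z.1 z.2 ^ 2 ∂((μ k).prod (μ k)) ∧
      momRatio (μ k) (distKernel (μ k)) τ ≤ C * (momL (μ k) τ / momSq (μ k) ^ (1 + τ)) := by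
  obtain ⟨Q, hQ⟩ := exists_forall_of_eventually_inf_comap
    (hE.eventually (ge_mem_nhds (by norm_num : (0 : ℝ) < 1 / 131072)))
  refine ⟨16777728 + 2 ^ 48 * Q ^ 5, by positivity, hQ.mono fun k hk => ?_⟩
  have hL : 0 ≤ momL (μ k) τ / momSq (μ k) ^ (1 + τ) :=
    div_nonneg momL_nonneg (Real.rpow_nonneg (hpos k).le _)
  rcases le_total Q (p k) with h | h
  · obtain ⟨h1, h2, -⟩ := distKernel_bounds_of_momE_le hτ hτ2 (hmom k) (hmean k) (hpos k) (hk h)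
    refine ⟨h1, h2.trans (mul_le_mul_of_nonneg_right ?_ hL)⟩
    have : (0 : ℝ) ≤ 2 ^ 48 * Q ^ 5 := by positivity
    linarith
  · obtain ⟨h1, h2⟩ := distKernel_bounds_of_dim hτ hτ2 (hmom k) (hmean k) (hpos k)
    refine ⟨h1, h2.trans (mul_le_mul_of_nonneg_right ?_ hL)⟩
    have h3 : (p k : ℝ) ≤ Q := by exact_mod_cast h
    have : (2 : ℝ) ^ 48 * (p k : ℝ) ^ 5 ≤ 2 ^ 48 * Q ^ 5 := by gcongr
    linarith

lemma exists_forall_specRatio_le (hτ : 0 < τ) (hτ2 : τ ≤ 1 / 2)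
    (hmom : ∀ k, Integrable (fun x => ‖x‖ ^ (4 + 4 * τ)) (μ k)) (hmean : ∀ k, ∫ x, x ∂(μ k) = 0)
    (hpos : ∀ k, 0 < momSq (μ k))
    (hE : Tendsto (fun k => momE (μ k) τ) (atTop ⊓ comap p atTop) (𝓝 0)) {ε : ℝ} (hε : 0 < ε) :
    ∃ Q, ∀ᶠ k in atTop, Q ≤ p k → specRatio (μ k) (distKernel (μ k)) ≤ ε := by
  obtain ⟨Q, hQ⟩ := exists_forall_of_eventually_inf_comap (hE.eventually (ge_mem_nhds
    (lt_min (by norm_num : (0 : ℝ) < 1 / 131072) (by positivity : 0 < ε / 8388608))))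
  refine ⟨Q, hQ.mono fun k hk h => ?_⟩
  have h1 := le_min_iff.1 (hk h)
  refine (distKernel_bounds_of_momE_le hτ hτ2 (hmom k) (hmean k) (hpos k) h1.1).2.2.trans ?_
  linarith [h1.2]

end Sequences

section Sequences

variable {τ : ℝ} {n p q : ℕ → ℕ} {μ : ∀ k, Measure (EuclideanSpace ℝ (Fin (p k)))}
  {ν : ∀ k, Measure (EuclideanSpace ℝ (Fin (q k)))}
  [∀ k, IsProbabilityMeasure (μ k)] [∀ k, IsProbabilityMeasure (ν k)]

/-- Once `p + q` reaches `Q₁ + Q₂`, at least one dimension is past its threshold. That spectral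
ratio is small and the other is at most one. -/
lemma tendsto_specRatio_mul (hτ : 0 < τ) (hτ2 : τ ≤ 1 / 2)
    (hpq : Tendsto (fun k => p k + q k) atTop atTop)
    (hμ_mom : ∀ k, Integrable (fun x => ‖x‖ ^ (4 + 4 * τ)) (μ k))
    (hν_mom : ∀ k, Integrable (fun y => ‖y‖ ^ (4 + 4 * τ)) (ν k))
    (hμ_mean : ∀ k, ∫ x, x ∂(μ k) = 0) (hν_mean : ∀ k, ∫ y, y ∂(ν k) = 0)
    (hμ_pos : ∀ k, 0 < momSq (μ k)) (hν_pos : ∀ k, 0 < momSq (ν k))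
    (hEx : Tendsto (fun k => momE (μ k) τ) (atTop ⊓ comap p atTop) (𝓝 0))
    (hEy : Tendsto (fun k => momE (ν k) τ) (atTop ⊓ comap q atTop) (𝓝 0)) :
    Tendsto (fun k => specRatio (μ k) (distKernel (μ k)) * specRatio (ν k) (distKernel (ν k)))
      atTop (𝓝 0) := by
  have hx1 : ∀ k, specRatio (μ k) (distKernel (μ k)) ≤ 1 := fun k =>
    specRatio_le_one (degenKernel_distKernel_of_moment hτ hτ2 (hμ_mom k)).1
  have hy1 : ∀ k, specRatio (ν k) (distKernel (ν k)) ≤ 1 := fun k =>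
    specRatio_le_one (degenKernel_distKernel_of_moment hτ hτ2 (hν_mom k)).1
  have hx0 : ∀ k, 0 ≤ specRatio (μ k) (distKernel (μ k)) := fun k => specRatio_nonneg
  have hy0 : ∀ k, 0 ≤ specRatio (ν k) (distKernel (ν k)) := fun k => specRatio_nonneg
  refine Metric.tendsto_nhds.2 fun ε hε => ?_
  obtain ⟨Q₁, h₁⟩ := exists_forall_specRatio_le hτ hτ2 hμ_mom hμ_mean hμ_pos hEx (half_pos hε)
  obtain ⟨Q₂, h₂⟩ := exists_forall_specRatio_le hτ hτ2 hν_mom hν_mean hν_pos hEy (half_pos hε)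
  filter_upwards [h₁, h₂, hpq.eventually_ge_atTop (Q₁ + Q₂)] with k h₁ h₂ h₃
  rw [Real.dist_eq, sub_zero, abs_of_nonneg (mul_nonneg (hx0 k) (hy0 k))]
  rcases le_or_gt Q₁ (p k) with h | h
  · have := mul_le_mul (h₁ h) (hy1 k) (hy0 k) (half_pos hε).le
    linarith
  · have := mul_le_mul (hx1 k) (h₂ (by omega)) (hy0 k) zero_le_one
    linarith

/-- The product of the ratios is bounded by a constant times the quantity in `h_ratio`. Each single
ratio is at most the product, because the other is at least one. -/
lemma tendsto_momRatio_mul (hτ : 0 < τ) (hτ2 : τ ≤ 1 / 2)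
    (hμ_mom : ∀ k, Integrable (fun x => ‖x‖ ^ (4 + 4 * τ)) (μ k))
    (hν_mom : ∀ k, Integrable (fun y => ‖y‖ ^ (4 + 4 * τ)) (ν k))
    (hμ_mean : ∀ k, ∫ x, x ∂(μ k) = 0) (hν_mean : ∀ k, ∫ y, y ∂(ν k) = 0)
    (hμ_pos : ∀ k, 0 < momSq (μ k)) (hν_pos : ∀ k, 0 < momSq (ν k))
    (h_ratio : Tendsto (fun k => (n k : ℝ) ^ (-τ) * momL (μ k) τ * momL (ν k) τ /
        (momSq (μ k) * momSq (ν k)) ^ (1 + τ)) atTop (𝓝 0))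
    (hEx : Tendsto (fun k => momE (μ k) τ) (atTop ⊓ comap p atTop) (𝓝 0))
    (hEy : Tendsto (fun k => momE (ν k) τ) (atTop ⊓ comap q atTop) (𝓝 0)) :
    (∀ᶠ k in atTop, 0 < ∫ z, distKernel (μ k) z.1 z.2 ^ 2 ∂((μ k).prod (μ k)) ∧
      0 < ∫ z, distKernel (ν k) z.1 z.2 ^ 2 ∂((ν k).prod (ν k))) ∧
    Tendsto (fun k => (n k : ℝ) ^ (-τ) * momRatio (μ k) (distKernel (μ k)) τ) atTop (𝓝 0) ∧
    Tendsto (fun k => (n k : ℝ) ^ (-τ) * momRatio (ν k) (distKernel (ν k)) τ) atTop (𝓝 0) ∧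
    Tendsto (fun k => (n k : ℝ) ^ (-τ) * (momRatio (μ k) (distKernel (μ k)) τ
      * momRatio (ν k) (distKernel (ν k)) τ)) atTop (𝓝 0) := by
  obtain ⟨C₁, hC₁, h₁⟩ := exists_forall_momRatio_le hτ hτ2 hμ_mom hμ_mean hμ_pos hEx
  obtain ⟨C₂, hC₂, h₂⟩ := exists_forall_momRatio_le hτ hτ2 hν_mom hν_mean hν_pos hEy
  have hD := fun k => degenKernel_distKernel_of_moment hτ hτ2 (hμ_mom k)
  have hE := fun k => degenKernel_distKernel_of_moment hτ hτ2 (hν_mom k)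
  have hx : ∀ᶠ k in atTop, 1 ≤ momRatio (μ k) (distKernel (μ k)) τ :=
    h₁.mono fun k h => one_le_momRatio hτ (hD k).1 (hD k).2 h.1
  have hy : ∀ᶠ k in atTop, 1 ≤ momRatio (ν k) (distKernel (ν k)) τ :=
    h₂.mono fun k h => one_le_momRatio hτ (hE k).1 (hE k).2 h.1
  have hn0 : ∀ k, 0 ≤ (n k : ℝ) ^ (-τ) := fun k => by positivity
  have hlim := h_ratio.const_mul (C₁ * C₂)
  rw [mul_zero] at hlim
  have hxy : Tendsto (fun k => (n k : ℝ) ^ (-τ) * (momRatio (μ k) (distKernel (μ k)) τ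
      * momRatio (ν k) (distKernel (ν k)) τ)) atTop (𝓝 0) := by
    refine squeeze_zero' ?_ ?_ hlim
    · filter_upwards [hx, hy] with k hx hy
      exact mul_nonneg (hn0 k) (mul_nonneg (by linarith) (by linarith))
    · filter_upwards [h₁, h₂, hx, hy] with k h₁ h₂ hx hy
      have h3 := mul_le_mul h₁.2 h₂.2 (by linarith) (mul_nonneg hC₁.le
        (div_nonneg momL_nonneg (Real.rpow_nonneg (hμ_pos k).le _)))
      refine (mul_le_mul_of_nonneg_left h3 (hn0 k)).trans_eq ?_
      rw [Real.mul_rpow (hμ_pos k).le (hν_pos k).le]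
      field_simp
  refine ⟨(h₁.and h₂).mono fun k h => ⟨h.1.1, h.2.1⟩, ?_, ?_, hxy⟩
  · refine squeeze_zero' ?_ ?_ hxy
    · filter_upwards [hx] with k hx
      exact mul_nonneg (hn0 k) (by linarith)
    · filter_upwards [hx, hy] with k hx hy
      exact mul_le_mul_of_nonneg_left (le_mul_of_one_le_right (by linarith) hy) (hn0 k)
  · refine squeeze_zero' ?_ ?_ hxy
    · filter_upwards [hy] with k hy
      exact mul_nonneg (hn0 k) (by linarith)
    · filter_upwards [hx, hy] with k hx hy
      exact mul_le_mul_of_nonneg_left (le_mul_of_one_le_left (by linarith) hx) (hn0 k)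

end Sequences

end DistCorr

/-! ### The limit theorem -/

theorem theorem2
    (τ : ℝ) (hτ_pos : 0 < τ) (hτ_le : τ ≤ 1 / 2)
    -- sample sizes and dimensions along an arbitrary sequence with `n → ∞`, `p + q → ∞`
    (n p q : ℕ → ℕ)
    (hn : Tendsto n atTop atTop) (hpq : Tendsto (fun k => p k + q k) atTop atTop)
    -- the laws of `X` and `Y`: centred, with finite moments of order `4 + 4τ`, nondegenerate
    (μ : ∀ k, Measure (EuclideanSpace ℝ (Fin (p k))))
    (ν : ∀ k, Measure (EuclideanSpace ℝ (Fin (q k))))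
    [∀ k, IsProbabilityMeasure (μ k)] [∀ k, IsProbabilityMeasure (ν k)]
    (hμ_mom : ∀ k, Integrable (fun x => ‖x‖ ^ (4 + 4 * τ)) (μ k))
    (hν_mom : ∀ k, Integrable (fun y => ‖y‖ ^ (4 + 4 * τ)) (ν k))
    (hμ_mean : ∀ k, ∫ x, x ∂(μ k) = 0) (hν_mean : ∀ k, ∫ y, y ∂(ν k) = 0)
    (hμ_pos : ∀ k, 0 < DistCorr.momSq (μ k)) (hν_pos : ∀ k, 0 < DistCorr.momSq (ν k))
    -- i.i.d. samples from `(X, Y)`, with `X` and `Y` independent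
    {Ω : ℕ → Type*} [∀ k, MeasurableSpace (Ω k)]
    (P : ∀ k, Measure (Ω k)) [∀ k, IsProbabilityMeasure (P k)]
    (X : ∀ k, Fin (n k) → Ω k → EuclideanSpace ℝ (Fin (p k)))
    (Y : ∀ k, Fin (n k) → Ω k → EuclideanSpace ℝ (Fin (q k)))
    (hX : ∀ k i, HasLaw (X k i) (μ k) (P k)) (hY : ∀ k i, HasLaw (Y k i) (ν k) (P k))
    (hXY : ∀ k i, IndepFun (X k i) (Y k i) (P k))
    (h_indep : ∀ k, iIndepFun (fun i ω => (X k i ω, Y k i ω)) (P k))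
    -- the moment conditions
    (h_ratio : Tendsto
      (fun k => (n k : ℝ) ^ (-τ) * DistCorr.momL (μ k) τ * DistCorr.momL (ν k) τ /
        (DistCorr.momSq (μ k) * DistCorr.momSq (ν k)) ^ (1 + τ)) atTop (𝓝 0))
    -- `E_x → 0` as `p → ∞`, `E_y → 0` as `q → ∞` (vacuous if `p`, resp. `q`, stays bounded)
    (hEx : Tendsto (fun k => DistCorr.momE (μ k) τ) (atTop ⊓ comap p atTop) (𝓝 0))
    (hEy : Tendsto (fun k => DistCorr.momE (ν k) τ) (atTop ⊓ comap q atTop) (𝓝 0)) :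
    TendstoInDistribution
      (fun k ω => DistCorr.testStat (fun i => X k i ω) (fun i => Y k i ω))
      atTop (id : ℝ → ℝ) P (gaussianReal 0 1) := by
  have hXm : ∀ k i, AEMeasurable (X k i) (P k) := fun k i => (hX k i).aemeasurable
  have hYm : ∀ k i, AEMeasurable (Y k i) (P k) := fun k i => (hY k i).aemeasurable
  refine ⟨fun k => DistCorr.aemeasurable_testStat (hXm k) (hYm k), aemeasurable_id, ?_⟩
  -- Lévy's continuity theorem reduces the claim to pointwise convergence of characteristic
  -- functions.
  refine ProbabilityMeasure.tendsto_iff_tendsto_charFun.2 fun t => ?_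
  change Tendsto (fun k => charFun ((P k).map fun ω => DistCorr.testStat (fun i => X k i ω)
    fun i => Y k i ω) t) atTop (𝓝 (charFun ((gaussianReal 0 1).map id) t))
  rw [Measure.map_id]
  obtain ⟨hpos, ha, hb, hc⟩ := DistCorr.tendsto_momRatio_mul hτ_pos hτ_le hμ_mom hν_mom hμ_mean
    hν_mean hμ_pos hν_pos h_ratio hEx hEy
  have hs := DistCorr.tendsto_specRatio_mul hτ_pos hτ_le hpq hμ_mom hν_mom hμ_mean hν_mean hμ_pos
    hν_pos hEx hEy
  have hN : Tendsto (fun k => (n k : ℝ)) atTop atTop := tendsto_natCast_atTop_atTop.comp hn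
  refine Metric.tendsto_nhds.2 fun ε hε => ?_
  -- For fixed `δ` the error bound tends to `2δ|t|`, so `δ` is chosen from `t` and `ε` before `k` is
  -- taken large.
  obtain ⟨δ, hδ, hδ2, hδε⟩ : ∃ δ : ℝ, 0 < δ ∧ δ ≤ 1 / 2 ∧ |t| * (2 * δ) < ε := by
    refine ⟨min (1 / 2) (ε / (4 * (|t| + 1))), by positivity, min_le_left _ _, ?_⟩
    have h1 : min (1 / 2) (ε / (4 * (|t| + 1))) ≤ ε / (4 * (|t| + 1)) := min_le_right _ _
    rw [le_div_iff₀ (by positivity)] at h1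
    have h2 : 0 < min (1 / 2) (ε / (4 * (|t| + 1))) := by positivity
    nlinarith
  filter_upwards [hpos, hn.eventually_ge_atTop 6,
    (DistCorr.tendsto_charFunErr hN ha hb hc hs t δ).eventually_lt_const hδε] with k hk h6 hlt
  rw [dist_eq_norm]
  exact (DistCorr.norm_charFun_testStat_sub_le (hX k) (hY k) (hXY k) (h_indep k) hτ_pos hτ_le
    (hμ_mom k) (hν_mom k) hk.1 hk.2 h6 hδ hδ2 t).trans_lt hlt
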